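/- All matroids are finite. $U_{r,n}$ is the uniform matroid of rank $r$ on $n$ elements. A matroid is *$(2,2)$-uniform* if it has no minor isomorphic to $U_{2,2}\oplus U_{0,2}$, and *binary* if it is representable over $GF(2)$. It is *3-connected* if it has no $k$-separation with $k\in\{1,2\}$, that is, no partition $(X,Y)$ of the ground set with $|X|,|Y|\ge k$ and $r(X)+r(Y)-r(M)<k$. $M(\mathcal W_3)$ is the cycle matroid of the wheel with three spokes, $F_7$ the Fano matroid, $AG(3,2)$ the rank-$4$ binary affine geometry, and $Z_4$ the rank-$4$ binary spike with tip $t$, that is, the vector matroid over $GF(2)$ of $[\,I_4\mid J_4-I_4\mid \mathbf 1\,]$, where $J_4$ is the all-ones matrix and $t$ labels the all-ones column $\mathbf 1$. $S_8$ is the deletion of a non-tip element from $Z_4$. $P(M_1,M_2)$ is the parallel connection of $M_1$ and $M_2$ across a basepoint. For $M(\mathcal W_3)$, $F_7$, $F_7^*$, $AG(3,2)$ and $U_{2,3}$ the choice of the element used as basepoint does not matter up to isomorphism; for $Z_4$ and $S_8$ the basepoint is the tip $t$. **Corollary.** Up to isomorphism, the following matroids and their duals are all the binary $(2,2)$-uniform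 matroids that are not $3$-connected; that is, a matroid $M$ is binary, $(2,2)$-uniform and not $3$-connected if and only if $M$ or $M^*$ is one of the following. (i) The matroids of rank at most $1$ other than $U_{0,0}$, $U_{0,1}$, $U_{1,1}$, $U_{1,2}$, $U_{1,3}$; (ii) the non-simple rank-$2$ binary matroids with at most one loop; (iii) the loopless, non-simple rank-$3$ binary matroids in which every parallel class has size at most $2$; (iv) $M_p\oplus U_{0,1}$ and $M_p\oplus U_{1,2}$, for $M_p$ in $\{M(\mathcal W_3),F_7,F_7^*,AG(3,2)\}$; (v) $P(Z_4,U_{2,3})\backslash t$ and $P(S_8,U_{2,3})\backslash t$, where $t$ is the tip of $Z_4$; (vi) $P(F_7,U_{2,3})\backslash p$ and $P(AG(3,2),U_{2,3})\backslash p$, where $p$ is the basepoint; (vii) $P(M_p,U_{2,3})$, for $M_p$ in $\{M(\mathcal W_3),F_7,F_7^*,AG(3,2)\}$. -/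

import Mathlib

namespace Matroid

universe u v w

/-! ### Isomorphism, uniform matroids, `(k, l)`-uniformity -/

/-- Two matroids are isomorphic if there is a bijection between their ground sets that preserves
independence in both directions. -/
def IsIsoTo {α : Type u} {β : Type v} (M : Matroid α) (N : Matroid β) : Prop :=
  ∃ f : M.E ≃ N.E, ∀ I : Set M.E,
    M.Indep (Subtype.val '' I) ↔ N.Indep (Subtype.val '' (f '' I))

/-- The uniform matroid `U_{r,n}` on an `n`-element ground set: the independent sets are the sets
with at most `r` elements. -/
def unif (r n : ℕ) : Matroid (Fin n) :=
  (IndepMatroid.ofFinite (E := Set.univ) Set.finite_univ (fun I => I.ncard ≤ r)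
    (by simp)
    (fun I J hJ hIJ => (Set.ncard_le_ncard hIJ J.toFinite).trans hJ)
    (fun I J _ hJ hlt => by
      obtain ⟨e, heJ, heI⟩ := Set.exists_mem_notMem_of_ncard_lt_ncard hlt I.toFinite
      refine ⟨e, heJ, heI, ?_⟩
      rw [Set.ncard_insert_of_notMem heI I.toFinite]
      omega)
    (fun I _ => Set.subset_univ I)).matroid

/-- `M` is `(k, l)`-uniform if no minor of `M` is isomorphic to `U_{k,k} ⊕ U_{0,l}`. -/
def IsKLUniform {α : Type u} (M : Matroid α) (k l : ℕ) : Prop :=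
  ¬ ∃ N : Matroid α, N ≤m M ∧ N.IsIsoTo ((unif k k).sum (unif 0 l))

/-! ### Connectivity -/

/-- `(X, E(M) - X)` is a `k`-separation of `M`: both sides have at least `k` elements and
`r(X) + r(E(M) - X) - r(M) < k`. -/
def IsKSeparation {α : Type u} (M : Matroid α) (k : ℕ) (X : Set α) : Prop :=
  X ⊆ M.E ∧ (k : ℕ∞) ≤ X.encard ∧ (k : ℕ∞) ≤ (M.E \ X).encard ∧
    M.eRk X + M.eRk (M.E \ X) < M.eRank + k

/-- `M` is `n`-connected (in the sense of Tutte) if it has no `k`-separation with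
`1 ≤ k < n`. -/
def IsNConnected {α : Type u} (M : Matroid α) (n : ℕ) : Prop :=
  ∀ k : ℕ, 1 ≤ k → k < n → ¬ ∃ X : Set α, M.IsKSeparation k X

/-! ### Simple matroids and parallel classes -/

/-- A matroid is simple if it has neither loops nor parallel pairs of elements, that is, if it has
no circuit with at most two elements. -/
def IsSimple {α : Type u} (M : Matroid α) : Prop :=
  ∀ C : Set α, M.IsCircuit C → 3 ≤ C.encard

/-- A parallel class of `M` is a maximal subset `X` of the ground set such that no member of `X` is
a loop and any two distinct members of `X` form a circuit. -/
def IsParallelClass {α : Type u} (M : Matroid α) (X : Set α) : Prop :=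
  Maximal (fun Y : Set α =>
    (∀ e ∈ Y, M.IsNonloop e) ∧ ∀ e ∈ Y, ∀ f ∈ Y, e ≠ f → M.IsCircuit {e, f}) X

/-! ### Vector matroids and binary matroids -/

/-- The vector matroid `M[A]` of a matrix `A` over a field: the elements are the column labels, and
a set of labels is independent if the corresponding family of columns is linearly independent. -/
def vectorMatroid {F : Type u} [Field F] {m : Type v} {α : Type w} (A : Matrix m α F) : Matroid α :=
  (IndepMatroid.ofFinitaryCardAugment (E := Set.univ) (fun I => LinearIndepOn F A.col I)
    (linearIndepOn_empty F A.col)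
    (fun _ _ hJ hIJ => hJ.mono hIJ)
    (fun I J hI hIfin hJ hJfin hlt => by
      by_contra! hcon
      have hspan : ∀ e ∈ J, A.col e ∈ Submodule.span F (A.col '' I) := by
        intro e he
        by_cases heI : e ∈ I
        · exact Submodule.subset_span (Set.mem_image_of_mem _ heI)
        · by_contra hns
          exact hcon e he heI ((linearIndepOn_insert heI).2 ⟨hI, hns⟩)
      have hle : Submodule.span F (A.col '' J) ≤ Submodule.span F (A.col '' I) := by
        rw [Submodule.span_le]
        rintro _ ⟨e, he, rfl⟩
        exact hspan e he
      have : FiniteDimensional F (Submodule.span F (A.col '' I)) :=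
        FiniteDimensional.span_of_finite F (hIfin.image _)
      have key : ∀ K : Set α, LinearIndepOn F A.col K → K.Finite →
          Module.finrank F (Submodule.span F (A.col '' K)) = K.ncard := by
        intro K hK hKfin
        have := hKfin.fintype
        have h := finrank_span_eq_card (R := F) hK
        rw [← Nat.card_eq_fintype_card, Nat.card_coe_set_eq] at h
        rw [← h, Set.image_eq_range]
      have := Submodule.finrank_mono hle
      rw [key I hI hIfin, key J hJ hJfin] at this
      omega)
    (fun I h => linearIndepOn_of_finite I h)
    (fun I _ => Set.subset_univ I)).matroid

/-- A matroid is binary if it is represented by the columns of a matrix over `GF(2)` whose columns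
are labelled by the elements of the matroid. -/
def IsBinary {α : Type u} (M : Matroid α) : Prop :=
  ∃ (n : ℕ) (A : Matrix (Fin n) α (ZMod 2)), M = (vectorMatroid A) ↾ M.E

/-! ### The named matroids -/

/-- The binary projective geometry `PG(n,2)`: the vector matroid of all nonzero vectors of
`GF(2)^(n+1)`. -/
def binaryPG (n : ℕ) : Matroid (Fin (n + 1) → ZMod 2) :=
  vectorMatroid (Matrix.of fun (i : Fin (n + 1)) (x : Fin (n + 1) → ZMod 2) => x i) ↾ {x | x ≠ 0}

/-- The binary affine geometry `AG(n,2)`, obtained from `PG(n,2)` by deleting a hyperplane. -/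
def binaryAG (n : ℕ) : Matroid (Fin (n + 1) → ZMod 2) :=
  binaryPG n ＼ {x | x 0 = 0}

/-- The Fano matroid `F_7 = PG(2,2)`. -/
def fano : Matroid (Fin 3 → ZMod 2) := binaryPG 2

/-- Augmentation for edge sets of forests. -/
theorem exists_insert_isAcyclic {V : Type u} [Finite V] (G : SimpleGraph V) {I J : Set (Sym2 V)}
    (hI : I ⊆ G.edgeSet) (hIa : (SimpleGraph.fromEdgeSet I).IsAcyclic)
    (hJ : J ⊆ G.edgeSet) (hJa : (SimpleGraph.fromEdgeSet J).IsAcyclic) (hlt : I.ncard < J.ncard) :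
    ∃ e ∈ J, e ∉ I ∧ insert e I ⊆ G.edgeSet ∧
      (SimpleGraph.fromEdgeSet (insert e I)).IsAcyclic := by
  by_contra! hcon
  have hreach : ∀ x y, s(x, y) ∈ J → (SimpleGraph.fromEdgeSet I).Reachable x y := by
    intro x y hxy
    by_cases hI' : s(x, y) ∈ I
    · have hne : x ≠ y := (show G.Adj x y from hI hI').ne
      exact SimpleGraph.Adj.reachable ((SimpleGraph.fromEdgeSet_adj I).2 ⟨hI', hne⟩)
    · by_contra hnr
      refine hcon _ hxy hI' (Set.insert_subset (hJ hxy) hI) ?_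
      have h := hIa.sup_edge_of_not_reachable hnr
      rwa [SimpleGraph.edge, ← SimpleGraph.fromEdgeSet_union, Set.union_singleton] at h
  have hJne : J.Nonempty := by
    rw [← Set.ncard_pos J.toFinite]
    omega
  have hV : Nonempty V := by
    obtain ⟨e, -⟩ := hJne
    induction e with
    | _ x y => exact ⟨x⟩
  obtain ⟨T, hJT, -, hT⟩ :=
    (SimpleGraph.connected_top (V := V)).exists_isTree_le_of_le_of_isAcyclic le_top hJa
  have hJE : J ⊆ T.edgeSet := by
    intro e he
    induction e with
    | _ x y =>
      exact hJT ((SimpleGraph.fromEdgeSet_adj J).2 ⟨he, (show G.Adj x y from hJ he).ne⟩)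
  have hconn : (SimpleGraph.fromEdgeSet (I ∪ (T.edgeSet \ J))).Connected := by
    have hstep : ∀ x y, T.Adj x y →
        (SimpleGraph.fromEdgeSet (I ∪ (T.edgeSet \ J))).Reachable x y := by
      intro x y hxy
      by_cases hJ' : s(x, y) ∈ J
      · exact (hreach x y hJ').mono (SimpleGraph.fromEdgeSet_mono Set.subset_union_left)
      · exact SimpleGraph.Adj.reachable
          ((SimpleGraph.fromEdgeSet_adj _).2 ⟨Or.inr ⟨hxy, hJ'⟩, hxy.ne⟩)
    refine ⟨fun x y => ?_⟩
    obtain ⟨w⟩ := hT.connected.preconnected x y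
    induction w with
    | nil => exact SimpleGraph.Reachable.refl _
    | cons h _ ih => exact (hstep _ _ h).trans ih
  have h1 := hconn.card_vert_le_card_edgeSet_add_one
  have h2 := (SimpleGraph.isTree_iff_connected_and_card.1 hT).2
  have h3 : (SimpleGraph.fromEdgeSet (I ∪ (T.edgeSet \ J))).edgeSet.ncard ≤
      I.ncard + (T.edgeSet \ J).ncard :=
    (Set.ncard_le_ncard (by
      rw [SimpleGraph.edgeSet_fromEdgeSet]; exact Set.sdiff_subset) (Set.toFinite _)).trans
      (Set.ncard_union_le _ _)
  have h4 := Set.ncard_sdiff_add_ncard_of_subset hJE (Set.toFinite _)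
  rw [Nat.card_coe_set_eq] at h1 h2
  omega

/-- The cycle matroid `M(G)` of a finite simple graph: the elements are the edges of `G`, and a set
of edges is independent if it contains no cycle. -/
def cycleMatroid {V : Type u} [Finite V] (G : SimpleGraph V) : Matroid (Sym2 V) :=
  (IndepMatroid.ofFinite (E := G.edgeSet) (Set.toFinite _)
    (fun I => I ⊆ G.edgeSet ∧ (SimpleGraph.fromEdgeSet I).IsAcyclic)
    ⟨Set.empty_subset _, by simp⟩
    (fun I J hJ hIJ => ⟨hIJ.trans hJ.1, hJ.2.anti (SimpleGraph.fromEdgeSet_mono hIJ)⟩)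
    (fun _ _ hI hJ hlt => exists_insert_isAcyclic G hI.1 hI.2 hJ.1 hJ.2 hlt)
    (fun I hI => hI.1)).matroid

/-- The wheel graph with `n` spokes: a hub `none` joined to every vertex of an `n`-cycle. -/
def wheelGraph (n : ℕ) : SimpleGraph (Option (Fin n)) where
  Adj
    | none, none => False
    | none, some _ => True
    | some _, none => True
    | some i, some j => (SimpleGraph.cycleGraph n).Adj i j
  symm := ⟨by
    rintro (_ | i) (_ | j) h
    · exact h
    · trivial
    · trivial
    · exact SimpleGraph.Adj.symm h⟩
  loopless := ⟨by
    rintro (_ | i) h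
    · exact h
    · exact SimpleGraph.irrefl _ h⟩

/-- `M(W_3)`, the cycle matroid of the wheel with three spokes. -/
def wheel3 : Matroid (Sym2 (Option (Fin 3))) := cycleMatroid (wheelGraph 3)

/-- The rank-`r` binary spike `Z_r`: the vector matroid over `GF(2)` of the matrix
`[I_r | J_r - I_r | 1]`, where `J_r` is the all-ones matrix and `1` is the all-ones column. The last
column is the tip. -/
def spike (r : ℕ) : Matroid (Fin r ⊕ (Fin r ⊕ Unit)) :=
  vectorMatroid (F := ZMod 2) (Matrix.fromCols (1 : Matrix (Fin r) (Fin r) (ZMod 2))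
    (Matrix.fromCols (Matrix.of (fun _ _ => 1) - 1) (Matrix.of fun _ _ => 1)))

/-- The tip `t` of the binary spike `Z_r`. -/
def spikeTip (r : ℕ) : Fin r ⊕ (Fin r ⊕ Unit) := Sum.inr (Sum.inr ())

/-- `S_8`, the deletion of a non-tip element from `Z_4`. -/
def S8 : Matroid (Fin 4 ⊕ (Fin 4 ⊕ Unit)) := spike 4 ＼ {Sum.inr (Sum.inl 3)}

/-! ### Parallel connection -/

section ParallelConnection

variable {α : Type u} {β : Type v}

/-- The sets that define the parallel connection of `M` and `N` at the basepoints `p` and `q`; they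
are its circuits when neither basepoint is a loop. The ground set consists of the elements of `M` and of those of `N` other than `q`; the element `q` of `N` is
identified with `p`. Such a set is a circuit of `M`, a circuit of `N`, or the nonempty set
`(C - p) ∪ (D - q)` for circuits `C` of `M` and `D` of `N` that contain the basepoints. -/
def IsParallelCircuit (M : Matroid α) (N : Matroid β) (p : α) (q : β) (K : Set (α ⊕ β)) : Prop :=
  (∃ C, M.IsCircuit C ∧ K = Sum.inl '' C) ∨
  (∃ D, N.IsCircuit D ∧ q ∉ D ∧ K = Sum.inr '' D) ∨
  (∃ D, N.IsCircuit D ∧ q ∈ D ∧ K = insert (Sum.inl p) (Sum.inr '' (D \ {q}))) ∨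
  (∃ C D, M.IsCircuit C ∧ p ∈ C ∧ N.IsCircuit D ∧ q ∈ D ∧
    K = Sum.inl '' (C \ {p}) ∪ Sum.inr '' (D \ {q}) ∧ K.Nonempty)

/-- Augmentation for the independent sets whose closure does not contain `F`. -/
theorem exists_insert_not_subset_closure {γ : Type u} (S : Matroid γ) [S.Finite] (F : Set γ)
    {I J : Set γ} (hF : F ⊆ S.E) (hI : S.Indep I) (hIF : ¬ F ⊆ S.closure I) (hJ : S.Indep J)
    (hJF : ¬ F ⊆ S.closure J) (hlt : I.ncard < J.ncard) :
    ∃ e ∈ J, e ∉ I ∧ S.Indep (insert e I) ∧ ¬ F ⊆ S.closure (insert e I) := by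
  have hfin : ∀ X ⊆ S.E, X.Finite := fun X hX => S.ground_finite.subset hX
  by_contra! hcon
  obtain ⟨f, hfF, hfI⟩ := Set.not_subset.1 hIF
  have hfE := hF hfF
  have hIf : S.Indep (insert f I) := (hI.notMem_closure_iff hfE).1 hfI |>.1
  have hfnI : f ∉ I := fun h => hfI (S.mem_closure_of_mem h hI.subset_ground)
  have hJcl : J ⊆ S.closure (insert f I) := by
    intro x hx
    by_cases hxI : x ∈ S.closure I
    · exact S.closure_subset_closure (Set.subset_insert _ _) hxI
    · have hxnI : x ∉ I := fun h => hxI (S.mem_closure_of_mem h hI.subset_ground)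
      have hind := ((hI.notMem_closure_iff (hJ.subset_ground hx)).1 hxI).1
      have h := hcon x hx hxnI hind
      exact (S.closure_exchange ⟨h hfF, hfI⟩).1
  have hcardIf : (insert f I).ncard = I.ncard + 1 :=
    Set.ncard_insert_of_notMem hfnI (hfin _ hI.subset_ground)
  have hbJ : S.IsBasis J (S.closure (insert f I)) := by
    obtain ⟨K, hK, hJK⟩ := hJ.subset_isBasis_of_subset hJcl
    have hKb := hIf.isBasis_closure
    have hce := hK.encard_eq_encard hKb
    have hcard : K.ncard = (insert f I).ncard := by rw [Set.ncard_def, Set.ncard_def, hce]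
    have : J = K := Set.eq_of_subset_of_ncard_le hJK (by omega) (hfin _ hK.indep.subset_ground)
    rwa [this]
  have hcl : S.closure J = S.closure (insert f I) := by
    rw [hbJ.closure_eq_closure, closure_closure]
  obtain ⟨x, hxJ, hxI⟩ : ∃ x ∈ J, x ∉ S.closure I := by
    by_contra! hsub
    have hle := hJ.encard_le_eRk_of_subset (X := S.closure I) hsub
    rw [eRk_closure_eq, hI.eRk_eq_encard,
      ← (hfin _ hI.subset_ground).cast_ncard_eq, ← (hfin _ hJ.subset_ground).cast_ncard_eq,
      Nat.cast_le] at hle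
    omega
  have hxnI : x ∉ I := fun h => hxI (S.mem_closure_of_mem h hI.subset_ground)
  have hind := ((hI.notMem_closure_iff (hJ.subset_ground hxJ)).1 hxI).1
  have h := hcon x hxJ hxnI hind
  apply hJF
  rw [hcl]
  refine h.trans (S.closure_subset_closure_of_subset_closure ?_)
  exact Set.insert_subset (hJcl hxJ)
    ((Set.subset_insert _ _).trans (S.subset_closure _ hIf.subset_ground))

/-- Membership in closures of independent sets of a direct sum. -/
theorem sum_mem_closure_iff (M : Matroid α) (N : Matroid β) {I : Set (α ⊕ β)}
    (hI : (M.sum N).Indep I) :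
    (∀ x, Sum.inl x ∈ (M.sum N).closure I ↔ x ∈ M.closure (Sum.inl ⁻¹' I)) ∧
    (∀ y, Sum.inr y ∈ (M.sum N).closure I ↔ y ∈ N.closure (Sum.inr ⁻¹' I)) := by
  have hI' := (sum_indep_iff M N).1 hI
  have h1 : ∀ x : α, Sum.inl ⁻¹' (insert (Sum.inl x) I) = insert x (Sum.inl ⁻¹' I) := by
    intro x; ext z; simp
  have h2 : ∀ x : α, Sum.inr ⁻¹' (insert (Sum.inl x) I) = (Sum.inr ⁻¹' I : Set β) := by
    intro x; ext z; simp
  have h3 : ∀ x : β, Sum.inr ⁻¹' (insert (Sum.inr x) I) = insert x (Sum.inr ⁻¹' I) := by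
    intro x; ext z; simp
  have h4 : ∀ x : β, Sum.inl ⁻¹' (insert (Sum.inr x) I) = (Sum.inl ⁻¹' I : Set α) := by
    intro x; ext z; simp
  constructor
  · intro x
    rw [hI.mem_closure_iff', hI'.1.mem_closure_iff', sum_indep_iff, h1, h2]
    simp [hI'.2]
  · intro y
    rw [hI.mem_closure_iff', hI'.2.mem_closure_iff', sum_indep_iff, h3, h4]
    simp [hI'.1]

/-- A set contains no circuit of the parallel connection if and only if it is independent in the
direct sum and its closure there does not contain both basepoints, unless both are loops. -/
theorem forall_not_parallelCircuit_iff (M : Matroid α) (N : Matroid β) (p : α) (q : β)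
    {I : Set (α ⊕ β)} (hIE : I ⊆ Sum.inl '' M.E ∪ Sum.inr '' (N.E \ {q})) :
    (∀ K, M.IsParallelCircuit N p q K → ¬ K ⊆ I) ↔
      (M.sum N).Indep I ∧ ({Sum.inl p, Sum.inr q} ⊆ (M.sum N).closure I →
        {Sum.inl p, Sum.inr q} ⊆ (M.sum N).closure ∅) := by
  have hqI : Sum.inr q ∉ I := fun h => by simpa using hIE h
  have hE1 : Sum.inl ⁻¹' I ⊆ M.E := fun x hx => by simpa using hIE hx
  have hE2 : Sum.inr ⁻¹' I ⊆ N.E := fun x hx => by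
    have := hIE hx
    simp at this
    exact this.1
  have hemp := sum_mem_closure_iff M N (M.sum N).empty_indep
  simp only [Set.preimage_empty] at hemp
  have hsub : ∀ D : Set β, Sum.inr '' (D \ {q}) ⊆ I ↔ D ⊆ insert q (Sum.inr ⁻¹' I) := by
    intro D
    rw [Set.image_subset_iff, Set.sdiff_subset_iff, Set.singleton_union]
  constructor
  · intro h
    have hind : (M.sum N).Indep I := by
      rw [sum_indep_iff, indep_iff_forall_subset_not_isCircuit hE1,
        indep_iff_forall_subset_not_isCircuit hE2]
      refine ⟨fun C hCI hC => h _ (Or.inl ⟨C, hC, rfl⟩) (Set.image_subset_iff.2 hCI),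
        fun D hDI hD => h _ (Or.inr (Or.inl ⟨D, hD, fun hq => hqI (hDI hq), rfl⟩))
          (Set.image_subset_iff.2 hDI)⟩
    refine ⟨hind, fun hF => ?_⟩
    have hcl := sum_mem_closure_iff M N hind
    simp only [Set.insert_subset_iff, Set.singleton_subset_iff, hcl.1, hcl.2, hemp.1,
      hemp.2] at hF ⊢
    obtain ⟨D, hDI, hD, hqD⟩ := exists_isCircuit_of_mem_closure hF.2 hqI
    by_cases hpI : Sum.inl p ∈ I
    · exact (h _ (Or.inr (Or.inr (Or.inl ⟨D, hD, hqD, rfl⟩)))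
        (Set.insert_subset hpI ((hsub D).2 hDI))).elim
    · obtain ⟨C, hCI, hC, hpC⟩ := exists_isCircuit_of_mem_closure hF.1 hpI
      have hK : Sum.inl '' (C \ {p}) ∪ Sum.inr '' (D \ {q}) ⊆ I :=
        Set.union_subset (by
          rw [Set.image_subset_iff, Set.sdiff_subset_iff, Set.singleton_union]
          exact hCI) ((hsub D).2 hDI)
      have hne : ¬ (Sum.inl '' (C \ {p}) ∪ Sum.inr '' (D \ {q}) : Set (α ⊕ β)).Nonempty :=
        fun hne => h _ (Or.inr (Or.inr (Or.inr ⟨C, D, hC, hpC, hD, hqD, rfl, hne⟩))) hK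
      rw [Set.not_nonempty_iff_eq_empty, Set.union_empty_iff, Set.image_eq_empty,
        Set.image_eq_empty] at hne
      have hC' := hC.mem_closure_sdiff_singleton_of_mem hpC
      have hD' := hD.mem_closure_sdiff_singleton_of_mem hqD
      rw [hne.1] at hC'
      rw [hne.2] at hD'
      exact ⟨hC', hD'⟩
  · rintro ⟨hind, hF⟩ K hK hKI
    have hcl := sum_mem_closure_iff M N hind
    have hI' := (sum_indep_iff M N).1 hind
    simp only [Set.insert_subset_iff, Set.singleton_subset_iff, hcl.1, hcl.2, hemp.1,
      hemp.2] at hF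
    have hq : ∀ D, N.IsCircuit D → q ∈ D → Sum.inr '' (D \ {q}) ⊆ I →
        q ∈ N.closure (Sum.inr ⁻¹' I) := fun D hD hqD hDI =>
      N.closure_subset_closure (Set.image_subset_iff.1 hDI)
        (hD.mem_closure_sdiff_singleton_of_mem hqD)
    rcases hK with ⟨C, hC, rfl⟩ | ⟨D, hD, -, rfl⟩ | ⟨D, hD, hqD, rfl⟩ |
      ⟨C, D, hC, hpC, hD, hqD, rfl, hne⟩
    · exact hC.not_indep (hI'.1.subset (Set.image_subset_iff.1 hKI))
    · exact hD.not_indep (hI'.2.subset (Set.image_subset_iff.1 hKI))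
    · rw [Set.insert_subset_iff] at hKI
      have hpcl : p ∈ M.closure (Sum.inl ⁻¹' I) := M.mem_closure_of_mem hKI.1 hE1
      have hloop : M.IsLoop p := (hF ⟨hpcl, hq D hD hqD hKI.2⟩).1
      exact hloop.not_indep_of_mem hKI.1 hI'.1
    · rw [Set.union_subset_iff] at hKI
      have hpcl : p ∈ M.closure (Sum.inl ⁻¹' I) :=
        M.closure_subset_closure (Set.image_subset_iff.1 hKI.1)
          (hC.mem_closure_sdiff_singleton_of_mem hpC)
      obtain ⟨hpl, hql⟩ := hF ⟨hpcl, hq D hD hqD hKI.2⟩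
      have hCp : C = {p} := (hC.eq_of_superset_isCircuit
        (singleton_isCircuit.2 hpl) (Set.singleton_subset_iff.2 hpC))
      have hDq : D = {q} := (hD.eq_of_superset_isCircuit
        (singleton_isCircuit.2 hql) (Set.singleton_subset_iff.2 hqD))
      simp [hCp, hDq] at hne

/-- Augmentation for the parallel connection. -/
theorem exists_insert_parallel (M : Matroid α) (N : Matroid β) [M.Finite] [N.Finite] (p : α) (q : β)
    {I J : Set (α ⊕ β)}
    (hI : I ⊆ Sum.inl '' M.E ∪ Sum.inr '' (N.E \ {q}) ∧
      ∀ K, M.IsParallelCircuit N p q K → ¬ K ⊆ I)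
    (hJ : J ⊆ Sum.inl '' M.E ∪ Sum.inr '' (N.E \ {q}) ∧
      ∀ K, M.IsParallelCircuit N p q K → ¬ K ⊆ J) (hlt : I.ncard < J.ncard) :
    ∃ e ∈ J, e ∉ I ∧ insert e I ⊆ Sum.inl '' M.E ∪ Sum.inr '' (N.E \ {q}) ∧
      ∀ K, M.IsParallelCircuit N p q K → ¬ K ⊆ insert e I := by
  have hfin : (M.sum N).Finite := ⟨by
    rw [sum_ground]
    exact (M.ground_finite.image _).union (N.ground_finite.image _)⟩
  obtain ⟨hIE, hI⟩ := hI
  obtain ⟨hJE, hJ⟩ := hJ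
  rw [forall_not_parallelCircuit_iff M N p q hIE] at hI
  rw [forall_not_parallelCircuit_iff M N p q hJE] at hJ
  suffices h : ∃ e ∈ J, e ∉ I ∧ (M.sum N).Indep (insert e I) ∧
      ({Sum.inl p, Sum.inr q} ⊆ (M.sum N).closure (insert e I) →
        {Sum.inl p, Sum.inr q} ⊆ (M.sum N).closure ∅) by
    obtain ⟨e, heJ, heI, h⟩ := h
    have hE := Set.insert_subset (hJE heJ) hIE
    exact ⟨e, heJ, heI, hE, (forall_not_parallelCircuit_iff M N p q hE).2 h⟩
  by_cases hF : {Sum.inl p, Sum.inr q} ⊆ (M.sum N).closure ∅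
  · obtain ⟨e, he, hi⟩ := hI.1.augment hJ.1 (by
      rw [← ((M.sum N).ground_finite.subset hI.1.subset_ground).cast_ncard_eq,
        ← ((M.sum N).ground_finite.subset hJ.1.subset_ground).cast_ncard_eq]
      exact_mod_cast hlt)
    exact ⟨e, he.1, he.2, hi, fun _ => hF⟩
  by_cases hFE : {Sum.inl p, Sum.inr q} ⊆ (M.sum N).E
  · obtain ⟨e, heJ, heI, hi, hn⟩ := exists_insert_not_subset_closure (M.sum N) _ hFE hI.1
      (fun h => hF (hI.2 h)) hJ.1 (fun h => hF (hJ.2 h)) hlt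
    exact ⟨e, heJ, heI, hi, fun h => (hn h).elim⟩
  · obtain ⟨e, he, hi⟩ := hI.1.augment hJ.1 (by
      rw [← ((M.sum N).ground_finite.subset hI.1.subset_ground).cast_ncard_eq,
        ← ((M.sum N).ground_finite.subset hJ.1.subset_ground).cast_ncard_eq]
      exact_mod_cast hlt)
    exact ⟨e, he.1, he.2, hi, fun h => (hFE (h.trans (closure_subset_ground _ _))).elim⟩

/-- The parallel connection `P(M, N)` of `M` and `N` at the basepoints `p ∈ E(M)` and `q ∈ E(N)`,
where `q` is identified with `p`. The independent sets are the subsets of the ground set that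
contain none of the defining circuits. In the result, the basepoint is `Sum.inl p`. -/
def parallelConnection (M : Matroid α) (N : Matroid β) [M.Finite] [N.Finite] (p : α) (q : β) :
    Matroid (α ⊕ β) :=
  (IndepMatroid.ofFinite (E := Sum.inl '' M.E ∪ Sum.inr '' (N.E \ {q}))
    ((M.ground_finite.image _).union ((N.ground_finite.subset Set.sdiff_subset).image _))
    (fun I => I ⊆ Sum.inl '' M.E ∪ Sum.inr '' (N.E \ {q}) ∧
      ∀ K, M.IsParallelCircuit N p q K → ¬ K ⊆ I)
    ⟨Set.empty_subset _, fun K hK hKe => by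
      obtain rfl := Set.subset_empty_iff.1 hKe
      rcases hK with ⟨C, hC, h⟩ | ⟨D, hD, -, h⟩ | ⟨D, hD, hqD, h⟩ |
        ⟨C, D, hC, hpC, hD, hqD, h, hne⟩
      · exact hC.nonempty.ne_empty (Set.image_eq_empty.1 h.symm)
      · exact hD.nonempty.ne_empty (Set.image_eq_empty.1 h.symm)
      · exact (Set.insert_nonempty _ _).ne_empty h.symm
      · exact Set.not_nonempty_empty hne⟩
    (fun _ _ hJ hIJ => ⟨hIJ.trans hJ.1, fun K hK hKI => hJ.2 K hK (hKI.trans hIJ)⟩)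
    (fun _ _ hI hJ hlt => exists_insert_parallel M N p q hI hJ hlt)
    (fun _ hI => hI.1)).matroid

end ParallelConnection

/-! ### The list -/

/-- `M ≅ P(N, U_{2,3})`, where the parallel connection is across some element `p` of `N`. -/
def IsParallelTriangle {α : Type u} {β : Type v} (M : Matroid α) (N : Matroid β) [N.Finite] : Prop :=
  ∃ p ∈ N.E, M.IsIsoTo (parallelConnection N (unif 2 3) p 0)

/-- `M ≅ P(N, U_{2,3}) \ p`, where the parallel connection is across the element `p` of `N`. -/
def IsParallelTriangleDelete {α : Type u} {β : Type v} (M : Matroid α) (N : Matroid β) [N.Finite]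
    (p : β) : Prop :=
  M.IsIsoTo (parallelConnection N (unif 2 3) p 0 ＼ {Sum.inl p})

/-- `M` is one of the matroids of the items (i) to (vii) of the list, up to isomorphism. -/
def InBinaryList {α : Type u} (M : Matroid α) : Prop :=
  -- (i)
  (M.eRank ≤ 1 ∧ ¬ M.IsIsoTo (unif 0 0) ∧ ¬ M.IsIsoTo (unif 0 1) ∧ ¬ M.IsIsoTo (unif 1 1) ∧
    ¬ M.IsIsoTo (unif 1 2) ∧ ¬ M.IsIsoTo (unif 1 3)) ∨
  -- (ii)
  (M.IsBinary ∧ M.eRank = 2 ∧ ¬ M.IsSimple ∧ M.loops.encard ≤ 1) ∨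
  -- (iii)
  (M.IsBinary ∧ M.eRank = 3 ∧ M.Loopless ∧ ¬ M.IsSimple ∧
    ∀ X, M.IsParallelClass X → X.encard ≤ 2) ∨
  -- (iv)
  (M.IsIsoTo (wheel3.sum (unif 0 1)) ∨ M.IsIsoTo (fano.sum (unif 0 1)) ∨
    M.IsIsoTo (fano✶.sum (unif 0 1)) ∨ M.IsIsoTo ((binaryAG 3).sum (unif 0 1))) ∨
  (M.IsIsoTo (wheel3.sum (unif 1 2)) ∨ M.IsIsoTo (fano.sum (unif 1 2)) ∨
    M.IsIsoTo (fano✶.sum (unif 1 2)) ∨ M.IsIsoTo ((binaryAG 3).sum (unif 1 2))) ∨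
  -- (v)
  (M.IsParallelTriangleDelete (spike 4) (spikeTip 4) ∨
    M.IsParallelTriangleDelete S8 (spikeTip 4)) ∨
  -- (vi)
  ((∃ p ∈ fano.E, M.IsParallelTriangleDelete fano p) ∨
    ∃ p ∈ (binaryAG 3).E, M.IsParallelTriangleDelete (binaryAG 3) p) ∨
  -- (vii)
  (M.IsParallelTriangle wheel3 ∨ M.IsParallelTriangle fano ∨ M.IsParallelTriangle fano✶ ∨
    M.IsParallelTriangle (binaryAG 3))

end Matroid

/-!
# The binary `(2, 2)`-uniform matroids that are not `3`-connected

The corank of a set `X` is `r(M) - r(X)` and its nullity is `|X| - r(X)`. A matroid is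
`(k, l)`-uniform if and only if no set has corank at least `k` and nullity at least `l`
(`isKLUniform_iff_rankGap`). In this form, duality, which exchanges corank and nullity, and the
effect of adding a loop or a series pair are immediate rank computations.

The argument rests on the binary matroids of rank and dual rank at least `3` in which no set has
corank at least `2` and nullity at least `1`, that is, in which all circuits have at least `r(M)`
elements (`Core`). Over `GF(2)`, an element outside a basis is the sum of at least `r(M) - 1` basis
elements, and the symmetric difference of two such sums cannot be too small; this bounds the rank by
`4`. The vectors of such a matroid are all nonzero vectors of `GF(2)^3`, or all vectors off a
hyperplane of `GF(2)^4`, with at most one vector omitted (`Core.isCoreSet`). Hence the core matroids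
are `F₇`, `M(W₃)`, `AG(3, 2)` and `F₇✶` (`IsCoreSet.realizes`).

Let `M` be binary, `(2, 2)`-uniform and not `3`-connected, and let its rank and dual rank be at
least `3`; smaller ranks are treated directly. A separation of a simple matroid with simple dual
would have a side that is both a triangle and a triad, which is impossible in a binary matroid
(`IsSimple.isNConnected_three`). So `M` or its dual has a loop or a parallel pair. The deletion of a
loop is a core matroid unless the dual rank is `3`. If the rank and the dual rank are at least `4`,
a parallel pair of a loopless matroid is a series pair of the dual, the deletion of which is a core
matroid with a set `S` of vectors, and the whole matroid is determined by `S` and a vector `w` of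
the span of `S` (`Rep.exists_seriesRep`). The position of `w` relative to `S` decides between the
direct sum with `U_{1,2}` and the parallel connections with a triangle (`SeriesRep.inBinaryList`).
In the remaining cases `M` or its dual is a loopless non-simple matroid of rank `3`.

Conversely, every matroid with a series pair of this form over a core matroid is `(2, 2)`-uniform
and has a `2`-separation (`SeriesRep.spec`), so that explicit representations of the named matroids
settle the items of the list that involve them.
-/

namespace Matroid

universe u v w

variable {α : Type u} {β : Type v} {M : Matroid α} {N : Matroid β}

/-! ### Natural-number rank -/

/-- The rank of a set as a natural number; it is `0`, a junk value, on sets of infinite rank. -/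
noncomputable def rk (M : Matroid α) (X : Set α) : ℕ := (M.eRk X).toNat

theorem cast_rk (M : Matroid α) [M.RankFinite] (X : Set α) : (M.rk X : ℕ∞) = M.eRk X :=
  ENat.natCast_toNat (eRk_ne_top_iff.2 (M.isRkFinite_set X))

theorem cast_rk_ground (M : Matroid α) [M.RankFinite] : (M.rk M.E : ℕ∞) = M.eRank := by
  rw [cast_rk, eRk_ground]

theorem Indep.rk_eq_ncard {I : Set α} (hI : M.Indep I) : M.rk I = I.ncard := by
  rw [rk, hI.eRk_eq_encard, Set.ncard_def]

theorem IsBasis.ncard_eq_rk {I X : Set α} (hI : M.IsBasis I X) : I.ncard = M.rk X := by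
  rw [rk, hI.eRk_eq_encard, Set.ncard_def]

theorem IsBase.ncard_eq_rk {B : Set α} (hB : M.IsBase B) : B.ncard = M.rk M.E :=
  hB.isBasis_ground.ncard_eq_rk

theorem rk_delete (M : Matroid α) {D X : Set α} (h : X ⊆ M.E \ D) : (M ＼ D).rk X = M.rk X := by
  rw [rk, rk, delete_eq_restrict, restrict_eRk_eq _ h]

theorem finite_of_subset_ground (M : Matroid α) [M.Finite] {X : Set α} (hX : X ⊆ M.E) : X.Finite :=
  M.ground_finite.subset hX

theorem rk_insert_of_mem_closure {X : Set α} {e : α} (h : e ∈ M.closure X) :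
    M.rk (insert e X) = M.rk X := by
  rw [rk, ← eRk_closure_eq, closure_insert_eq_of_mem_closure h, eRk_closure_eq, rk]

section Finite

variable [M.Finite] {X Y : Set α} {e : α}

theorem rk_mono (M : Matroid α) [M.Finite] (h : X ⊆ Y) : M.rk X ≤ M.rk Y := by
  have := M.eRk_mono h
  rw [← cast_rk, ← cast_rk] at this
  exact_mod_cast this

theorem rk_le_rk_ground (M : Matroid α) [M.Finite] (X : Set α) : M.rk X ≤ M.rk M.E := by
  have := M.eRk_le_eRank X
  rw [← cast_rk_ground, ← cast_rk] at this
  exact_mod_cast this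

theorem rk_le_ncard (hX : X ⊆ M.E) : M.rk X ≤ X.ncard := by
  have := M.eRk_le_encard X
  rw [← cast_rk, ← (finite_of_subset_ground M hX).cast_ncard_eq] at this
  exact_mod_cast this

theorem rk_union_le (M : Matroid α) [M.Finite] (X Y : Set α) :
    M.rk (X ∪ Y) ≤ M.rk X + M.rk Y := by
  have := M.eRk_union_le_eRk_add_eRk X Y
  simp only [← cast_rk] at this
  exact_mod_cast this

theorem rk_insert_of_notMem_closure (he : e ∈ M.E) (h : e ∉ M.closure X) :
    M.rk (insert e X) = M.rk X + 1 := by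
  have := eRk_insert_eq_add_one (M := M) ⟨he, h⟩
  simp only [← cast_rk] at this
  exact_mod_cast this

theorem indep_iff_rk_eq_ncard (hX : X ⊆ M.E) : M.Indep X ↔ M.rk X = X.ncard := by
  rw [indep_iff_eRk_eq_encard, ← cast_rk, ← (finite_of_subset_ground M hX).cast_ncard_eq]
  norm_cast

theorem rk_lt_ncard_iff_not_indep (hX : X ⊆ M.E) : M.rk X < X.ncard ↔ ¬ M.Indep X := by
  have := rk_le_ncard hX
  rw [indep_iff_rk_eq_ncard hX]
  omega

theorem IsCircuit.rk_add_one {C : Set α} (hC : M.IsCircuit C) : M.rk C + 1 = C.ncard := by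
  have := hC.eRk_add_one_eq
  rw [← cast_rk, ← (finite_of_subset_ground M hC.subset_ground).cast_ncard_eq] at this
  exact_mod_cast this

theorem rk_dual_add (hX : X ⊆ M.E) : M✶.rk X + M.rk M.E = M.rk (M.E \ X) + X.ncard := by
  have := M.eRk_dual_add_eRank X hX
  rw [← cast_rk, ← cast_rk, ← cast_rk_ground,
    ← (finite_of_subset_ground M hX).cast_ncard_eq] at this
  exact_mod_cast this

theorem rk_add_rk_dual (M : Matroid α) [M.Finite] : M.rk M.E + M✶.rk M.E = M.E.ncard := by
  have := rk_dual_add (subset_refl M.E)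
  have h0 : M.rk (M.E \ M.E) = 0 := by simp [rk]
  omega

theorem ncard_diff_add (hX : X ⊆ M.E) : (M.E \ X).ncard + X.ncard = M.E.ncard :=
  Set.ncard_sdiff_add_ncard_of_subset hX M.ground_finite

theorem spanning_iff_rk (hX : X ⊆ M.E) : M.Spanning X ↔ M.rk X = M.rk M.E := by
  have := M.rk_le_rk_ground X
  rw [spanning_iff_eRk_le, ← cast_rk, ← cast_rk_ground, Nat.cast_le]
  omega

theorem isLoop_iff_rk (he : e ∈ M.E) : M.IsLoop e ↔ M.rk {e} = 0 := by
  rw [← singleton_not_indep he, indep_iff_rk_eq_ncard (Set.singleton_subset_iff.2 he),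
    Set.ncard_singleton]
  have := rk_le_ncard (M := M) (Set.singleton_subset_iff.2 he)
  rw [Set.ncard_singleton] at this
  omega

end Finite

/-! ### Rank form of `(k, l)`-uniformity -/

/-- The rank form of `(k, l)`-uniformity: every set `X` of corank `r(M) - r(X)` at least `k` has
nullity `|X| - r(X)` less than `l`. -/
def RankGap (M : Matroid α) (k l : ℕ) : Prop :=
  ∀ X ⊆ M.E, M.rk X + k ≤ M.rk M.E → X.ncard < M.rk X + l

/-- Complementation swaps corank and nullity when passing to the dual. -/
theorem RankGap.dual [M.Finite] {k l : ℕ} (h : M.RankGap k l) : M✶.RankGap l k := by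
  intro X hX hle
  rw [dual_ground] at hX hle
  have h1 := rk_dual_add (M := M) hX
  have h2 := M.rk_add_rk_dual
  have h3 := ncard_diff_add hX
  have h4 := h (M.E \ X) Set.sdiff_subset
  omega

/-! ### Isomorphism -/

theorem IsIsoTo.symm (h : M.IsIsoTo N) : N.IsIsoTo M := by
  obtain ⟨f, hf⟩ := h
  refine ⟨f.symm, fun I => ?_⟩
  rw [hf, show f '' (f.symm '' I) = I by simp [Set.image_image]]

theorem isIsoTo_of_bijOn (F : α → β) (hF : Set.BijOn F M.E N.E)
    (h : ∀ I ⊆ M.E, (M.Indep I ↔ N.Indep (F '' I))) : M.IsIsoTo N := by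
  refine ⟨hF.equiv F, fun I => ?_⟩
  rw [h _ (by simp), Set.image_image, Set.image_image]
  rfl

/-- Isomorphic matroids are images of one matroid under two injections. -/
theorem IsIsoTo.exists_map (h : M.IsIsoTo N) :
    ∃ (γ : Type u) (K : Matroid γ) (f : γ → α) (g : γ → β) (hf : Set.InjOn f K.E)
      (hg : Set.InjOn g K.E), K.map f hf = M ∧ K.map g hg = N := by
  obtain ⟨e, he⟩ := h
  have hg : Function.Injective (fun x : M.E => (e x : β)) :=
    Subtype.val_injective.comp e.injective
  refine ⟨M.E, M.restrictSubtype M.E, Subtype.val, fun x => e x, Subtype.val_injective.injOn,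
    hg.injOn, by simp, ?_⟩
  refine ext_indep ?_ fun I hI => ?_
  · ext y
    simp only [map_ground, restrictSubtype_ground, Set.image_univ, Set.mem_range]
    constructor
    · rintro ⟨x, rfl⟩
      exact (e x).2
    · intro hy
      exact ⟨e.symm ⟨y, hy⟩, by simp⟩
  · rw [map_ground, Set.subset_image_iff] at hI
    obtain ⟨J, -, rfl⟩ := hI
    rw [map_image_indep_iff (by simp), restrictSubtype_indep_iff, he, Set.image_image]

theorem rk_map {f : α → β} (hf : Set.InjOn f M.E) {X : Set α} (hX : X ⊆ M.E) :
    (M.map f hf).rk (f '' X) = M.rk X := by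
  rw [rk, rk, eRk_map M hf hX]

theorem rankGap_map_iff {f : α → β} (hf : Set.InjOn f M.E) {k l : ℕ} :
    (M.map f hf).RankGap k l ↔ M.RankGap k l := by
  rw [RankGap, map_ground, Set.forall_subset_image_iff]
  refine forall₂_congr fun X hX => ?_
  rw [rk_map hf hX, rk_map hf subset_rfl, (hf.mono hX).ncard_image]

theorem IsIsoTo.rankGap_iff (h : M.IsIsoTo N) {k l : ℕ} : M.RankGap k l ↔ N.RankGap k l := by
  obtain ⟨γ, K, f, g, hf, hg, rfl, rfl⟩ := h.exists_map
  rw [rankGap_map_iff, rankGap_map_iff]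

theorem isKSeparation_map_iff {f : α → β} (hf : Set.InjOn f M.E) {k : ℕ} {X : Set α}
    (hX : X ⊆ M.E) : (M.map f hf).IsKSeparation k (f '' X) ↔ M.IsKSeparation k X := by
  rw [IsKSeparation, IsKSeparation, map_ground, ← hf.image_sdiff_subset hX,
    eRk_map _ hf, eRk_map _ hf, eRank_map, (hf.mono hX).encard_image,
    (hf.mono Set.sdiff_subset).encard_image]
  simp only [hX, Set.image_mono hX, true_and]

theorem isNConnected_map_iff {f : α → β} (hf : Set.InjOn f M.E) {n : ℕ} :
    (M.map f hf).IsNConnected n ↔ M.IsNConnected n := by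
  refine forall₃_congr fun k _ _ => not_congr ⟨?_, ?_⟩
  · rintro ⟨Y, hY⟩
    obtain ⟨X, hX, rfl⟩ := Set.subset_image_iff.1 hY.1
    exact ⟨X, (isKSeparation_map_iff hf hX).1 hY⟩
  · rintro ⟨X, hX⟩
    exact ⟨f '' X, (isKSeparation_map_iff hf hX.1).2 hX⟩

theorem IsIsoTo.isNConnected_iff (h : M.IsIsoTo N) {n : ℕ} :
    M.IsNConnected n ↔ N.IsNConnected n := by
  obtain ⟨γ, K, f, g, hf, hg, rfl, rfl⟩ := h.exists_map
  rw [isNConnected_map_iff, isNConnected_map_iff]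

theorem IsIsoTo.rk_ground_eq (h : M.IsIsoTo N) : M.rk M.E = N.rk N.E := by
  obtain ⟨γ, K, f, g, hf, hg, rfl, rfl⟩ := h.exists_map
  rw [map_ground, map_ground, rk_map hf subset_rfl, rk_map hg subset_rfl]

/-! ### Binary representations -/

section Rep

variable {V W : Type*} [AddCommGroup V] [Module (ZMod 2) V] [AddCommGroup W] [Module (ZMod 2) W]

/-- `M.Rep v`: the family `v` of vectors over `GF(2)` represents `M`. The values of `v` off the
ground set are irrelevant. -/
def Rep (M : Matroid α) (v : α → V) : Prop :=
  ∀ I ⊆ M.E, M.Indep I ↔ LinearIndepOn (ZMod 2) v I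

theorem Rep.congr {v v' : α → V} (h : M.Rep v) (hv : Set.EqOn v v' M.E) : M.Rep v' :=
  fun I hI => (h I hI).trans (linearIndepOn_congr (hv.mono hI))

theorem Rep.comp {v : α → V} (h : M.Rep v) (L : V →ₗ[ZMod 2] W) (hL : Function.Injective L) :
    M.Rep (L ∘ v) :=
  fun I hI => (h I hI).trans (L.linearIndepOn_iff_of_injOn hL.injOn).symm

theorem Rep.of_comp {v : α → V} (L : V →ₗ[ZMod 2] W) (hL : Function.Injective L)
    (h : M.Rep (L ∘ v)) : M.Rep v :=
  fun I hI => (h I hI).trans (L.linearIndepOn_iff_of_injOn hL.injOn)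

theorem Rep.delete {v : α → V} (h : M.Rep v) (D : Set α) : (M ＼ D).Rep v := by
  intro I hI
  rw [delete_ground, Set.subset_sdiff] at hI
  rw [delete_indep_iff, h I hI.1]
  exact and_iff_left hI.2

theorem linearIndepOn_image_iff {f : α → β} {v : β → V} {I : Set α} (hf : Set.InjOn f I) :
    LinearIndepOn (ZMod 2) v (f '' I) ↔ LinearIndepOn (ZMod 2) (v ∘ f) I :=
  ⟨fun h => h.comp_of_image hf, fun h => h.image_of_comp f v⟩

theorem Rep.map_iff {f : α → β} (hf : Set.InjOn f M.E) {v : β → V} :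
    (M.map f hf).Rep v ↔ M.Rep (v ∘ f) := by
  rw [Rep, map_ground, Set.forall_subset_image_iff]
  refine forall₂_congr fun I hI => ?_
  rw [map_image_indep_iff hI, linearIndepOn_image_iff (hf.mono hI)]

/-- A representation can be restricted to the span of its vectors. -/
theorem Rep.exists_span_eq_top {v : α → V} (h : M.Rep v) :
    ∃ v' : α → Submodule.span (ZMod 2) (v '' M.E), M.Rep v' ∧ (∀ e ∈ M.E, (v' e : V) = v e) ∧
      Submodule.span (ZMod 2) (v' '' M.E) = ⊤ := by
  classical
  set S := Submodule.span (ZMod 2) (v '' M.E)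
  let v' : α → S := fun e => if he : e ∈ M.E then
    ⟨v e, Submodule.subset_span (Set.mem_image_of_mem v he)⟩ else 0
  have hv' : ∀ e ∈ M.E, (v' e : V) = v e := fun e he => by simp [v', he]
  refine ⟨v', Rep.of_comp S.subtype S.injective_subtype (h.congr fun e he => (hv' e he).symm), hv',
    ?_⟩
  apply Submodule.map_injective_of_injective S.injective_subtype
  rw [Submodule.map_span, Submodule.map_top, Submodule.range_subtype, Set.image_image]
  exact congrArg _ (Set.image_congr fun e he => hv' e he)

theorem Rep.isBinary [M.Finite] {v : α → V} (h : M.Rep v) : M.IsBinary := by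
  obtain ⟨v', hv', -, hs⟩ := h.exists_span_eq_top
  have : FiniteDimensional (ZMod 2) (Submodule.span (ZMod 2) (v '' M.E)) :=
    FiniteDimensional.span_of_finite _ (M.ground_finite.image _)
  let b := Module.finBasis (ZMod 2) (Submodule.span (ZMod 2) (v '' M.E))
  refine ⟨_, Matrix.of fun i e => b.equivFun (v' e) i, ext_indep rfl fun I hI => ?_⟩
  rw [hv'.comp _ b.equivFun.injective I hI, restrict_indep_iff]
  exact (and_iff_left hI).symm

theorem isBinary_iff_exists_rep [M.Finite] :
    M.IsBinary ↔ ∃ (n : ℕ) (v : α → Fin n → ZMod 2), M.Rep v := by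
  constructor
  · rintro ⟨n, A, hA⟩
    refine ⟨n, A.col, fun I hI => ?_⟩
    rw [hA, restrict_indep_iff]
    exact and_iff_left hI
  · rintro ⟨n, v, h⟩
    exact h.isBinary

theorem IsBinary.delete [M.Finite] (h : M.IsBinary) (D : Set α) : (M ＼ D).IsBinary := by
  obtain ⟨n, v, hv⟩ := isBinary_iff_exists_rep.1 h
  exact (hv.delete D).isBinary

theorem IsIsoTo.isBinary [M.Finite] [N.Finite] (h : M.IsIsoTo N) (hN : N.IsBinary) :
    M.IsBinary := by
  obtain ⟨n, v, hv⟩ := isBinary_iff_exists_rep.1 hN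
  obtain ⟨γ, K, f, g, hf, hg, rfl, rfl⟩ := h.exists_map
  rcases isEmpty_or_nonempty γ with hγ | hγ
  · exact Rep.isBinary (V := Fin n → ZMod 2) (v := fun _ => 0) ((Rep.map_iff hf).2 fun I hI => by
      have := Set.eq_empty_of_isEmpty I
      subst this
      simp)
  · refine Rep.isBinary (v := (v ∘ g) ∘ Function.invFunOn f K.E) ((Rep.map_iff hf).2
      (((Rep.map_iff hg).1 hv).congr fun x hx => ?_))
    simp only [Function.comp_apply]
    rw [hf.leftInvOn_invFunOn hx]

theorem Rep.mem_closure_iff {v : α → V} (h : M.Rep v) {X : Set α} {e : α} (hX : X ⊆ M.E)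
    (he : e ∈ M.E) : e ∈ M.closure X ↔ v e ∈ Submodule.span (ZMod 2) (v '' X) := by
  have key : ∀ I, M.Indep I → ∀ x ∈ M.E,
      (x ∈ M.closure I ↔ v x ∈ Submodule.span (ZMod 2) (v '' I)) := by
    intro I hI x hx
    by_cases hxI : x ∈ I
    · exact iff_of_true (M.mem_closure_of_mem hxI hI.subset_ground)
        (Submodule.subset_span (Set.mem_image_of_mem v hxI))
    · rw [← not_iff_not, hI.notMem_closure_iff_of_notMem hxI hx,
        h _ (Set.insert_subset hx hI.subset_ground), linearIndepOn_insert hxI]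
      exact and_iff_right ((h I hI.subset_ground).1 hI)
  obtain ⟨I, hI⟩ := M.exists_isBasis X hX
  rw [← hI.closure_eq_closure, key I hI.indep e he]
  have : Submodule.span (ZMod 2) (v '' I) = Submodule.span (ZMod 2) (v '' X) := by
    refine le_antisymm (Submodule.span_mono (Set.image_mono hI.subset)) ?_
    rw [Submodule.span_le]
    rintro _ ⟨x, hx, rfl⟩
    exact (key I hI.indep x (hX hx)).1 (hI.subset_closure hx)
  rw [this]

theorem Rep.spanning_iff {v : α → V} (h : M.Rep v) {X : Set α} (hX : X ⊆ M.E) :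
    M.Spanning X ↔ Submodule.span (ZMod 2) (v '' X) = Submodule.span (ZMod 2) (v '' M.E) := by
  rw [spanning_iff_ground_subset_closure hX]
  constructor
  · intro hc
    refine le_antisymm (Submodule.span_mono (Set.image_mono hX)) (Submodule.span_le.2 ?_)
    rintro _ ⟨x, hx, rfl⟩
    exact (h.mem_closure_iff hX hx).1 (hc hx)
  · intro hc x hx
    rw [h.mem_closure_iff hX hx, hc]
    exact Submodule.subset_span (Set.mem_image_of_mem v hx)

theorem Rep.finrank_span [M.Finite] {v : α → V} (h : M.Rep v) {X : Set α} (hX : X ⊆ M.E) :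
    Module.finrank (ZMod 2) (Submodule.span (ZMod 2) (v '' X)) = M.rk X := by
  obtain ⟨I, hI⟩ := M.exists_isBasis X hX
  have hspan : Submodule.span (ZMod 2) (v '' I) = Submodule.span (ZMod 2) (v '' X) := by
    refine le_antisymm (Submodule.span_mono (Set.image_mono hI.subset)) (Submodule.span_le.2 ?_)
    rintro _ ⟨x, hx, rfl⟩
    exact (h.mem_closure_iff hI.indep.subset_ground (hX hx)).1 (hI.subset_closure hx)
  have hfin := (finite_of_subset_ground M hI.indep.subset_ground).fintype
  have h1 := finrank_span_eq_card ((h I hI.indep.subset_ground).1 hI.indep)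
  rw [← Nat.card_eq_fintype_card, Nat.card_coe_set_eq] at h1
  rw [← hspan, ← hI.ncard_eq_rk, ← h1, Set.image_eq_range]

/-- Elements of a span over `GF(2)` are sums over finite subsets of the spanning family. -/
theorem exists_finset_sum_of_mem_span {v : α → V} {S : Set α} {x : V}
    (hx : x ∈ Submodule.span (ZMod 2) (v '' S)) :
    ∃ T : Finset α, ↑T ⊆ S ∧ x = ∑ i ∈ T, v i := by
  obtain ⟨l, hl, rfl⟩ := (Finsupp.mem_span_image_iff_linearCombination (ZMod 2)).1 hx
  refine ⟨l.support, hl, ?_⟩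
  rw [Finsupp.linearCombination_apply, Finsupp.sum]
  refine Finset.sum_congr rfl fun i hi => ?_
  have h2 : ∀ a : ZMod 2, a ≠ 0 → a = 1 := by decide
  rw [h2 _ (Finsupp.mem_support_iff.1 hi), one_smul]

theorem linearIndepOn_iff_sum_ne_zero {v : α → V} {S : Set α} :
    LinearIndepOn (ZMod 2) v S ↔ ∀ T : Finset α, ↑T ⊆ S → T.Nonempty → ∑ i ∈ T, v i ≠ 0 := by
  classical
  rw [linearIndepOn_iff']
  constructor
  · rintro h T hT ⟨i, hi⟩ h0
    exact one_ne_zero (h T (fun _ => 1) hT (by simpa using h0) i hi)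
  · intro h T g hT h0 i hi
    by_contra hgi
    refine h (T.filter fun i => g i ≠ 0) (fun j hj => hT (by simp at hj; exact hj.1))
      ⟨i, by simp [hi, hgi]⟩ ?_
    rw [← h0, Finset.sum_filter]
    refine Finset.sum_congr rfl fun j _ => ?_
    have h2 : ∀ a : ZMod 2, a = 0 ∨ a = 1 := by decide
    rcases h2 (g j) with hj | hj <;> simp [hj]

theorem zmod_two_add_self (x : V) : x + x = 0 := by
  rw [← two_smul (ZMod 2), show (2 : ZMod 2) = 0 from rfl, zero_smul]

theorem zmod_two_add_eq_zero_iff (x y : V) : x + y = 0 ↔ x = y := by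
  constructor
  · intro h
    rw [← add_zero x, ← zmod_two_add_self y, ← add_assoc, h, zero_add]
  · rintro rfl
    exact zmod_two_add_self x

theorem sum_add_sum_eq_sum_symmDiff [DecidableEq α] (v : α → V) (S T : Finset α) :
    ∑ i ∈ S, v i + ∑ i ∈ T, v i = ∑ i ∈ symmDiff S T, v i := by
  have h1 := Finset.sum_sdiff (f := v) (Finset.inter_subset_left (s₁ := S) (s₂ := T))
  have h2 := Finset.sum_sdiff (f := v) (Finset.inter_subset_right (s₁ := S) (s₂ := T))
  rw [Finset.sdiff_inter_self_left] at h1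
  rw [Finset.sdiff_inter_self_right] at h2
  rw [symmDiff_def, Finset.sup_eq_union, Finset.sum_union disjoint_sdiff_sdiff, ← h1, ← h2,
    add_add_add_comm, zmod_two_add_self, add_zero]

/-- A subfamily spans the same space if and only if every functional that vanishes on it vanishes on
the whole family. -/
theorem span_eq_span_iff_forall_functional {v : α → V} {S T : Set α} (hST : S ⊆ T) :
    Submodule.span (ZMod 2) (v '' S) = Submodule.span (ZMod 2) (v '' T) ↔
      ∀ φ : Module.Dual (ZMod 2) V, (∀ e ∈ S, φ (v e) = 0) → ∀ e ∈ T, φ (v e) = 0 := by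
  constructor
  · intro h φ hφ e he
    have : Submodule.span (ZMod 2) (v '' T) ≤ LinearMap.ker φ := by
      rw [← h, Submodule.span_le]
      rintro _ ⟨x, hx, rfl⟩
      exact hφ x hx
    exact this (Submodule.subset_span (Set.mem_image_of_mem v he))
  · intro h
    refine le_antisymm (Submodule.span_mono (Set.image_mono hST)) (Submodule.span_le.2 ?_)
    rintro _ ⟨x, hx, rfl⟩
    by_contra hns
    obtain ⟨φ, hφ, hφ0⟩ := Submodule.exists_le_ker_of_notMem hns
    refine hφ (h φ (fun e he => hφ0 (Submodule.subset_span (Set.mem_image_of_mem v he))) x hx)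

end Rep

/-- The dual of a binary matroid is binary: the coordinate vectors modulo the row space of a
representation of `M` represent `M✶`. -/
theorem IsBinary.dual [M.Finite] (h : M.IsBinary) : M✶.IsBinary := by
  classical
  obtain ⟨n, v, hv⟩ := isBinary_iff_exists_rep.1 h
  let R : Module.Dual (ZMod 2) (Fin n → ZMod 2) →ₗ[ZMod 2] (M.E → ZMod 2) :=
    LinearMap.pi fun e => LinearMap.applyₗ (v e)
  let w : α → (M.E → ZMod 2) ⧸ LinearMap.range R := fun e =>
    if he : e ∈ M.E then (LinearMap.range R).mkQ (Pi.single ⟨e, he⟩ 1) else 0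
  refine Rep.isBinary (v := w) fun I hI => ?_
  rw [dual_ground] at hI
  rw [← coindep_def, coindep_iff_compl_spanning hI, hv.spanning_iff Set.sdiff_subset,
    span_eq_span_iff_forall_functional Set.sdiff_subset, linearIndepOn_iff_sum_ne_zero]
  -- A sum of the vectors `w` vanishes exactly when the indicator function lies in the row space.
  have hsum : ∀ T : Finset α, ↑T ⊆ M.E → ∑ i ∈ T, w i =
      (LinearMap.range R).mkQ (fun x => if (x : α) ∈ T then 1 else 0) := by
    intro T hT
    have : (fun x : M.E => if (x : α) ∈ T then (1 : ZMod 2) else 0) =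
        ∑ i ∈ T.attach, Pi.single (⟨i, hT i.2⟩ : M.E) 1 := by
      ext x
      rw [Finset.sum_apply]
      simp only [Pi.single_apply]
      by_cases hx : (x : α) ∈ T
      · rw [if_pos hx, Finset.sum_eq_single ⟨x, hx⟩]
        · simp
        · intro b _ hb
          rw [if_neg]
          rintro rfl
          exact hb rfl
        · simp
      · rw [if_neg hx, Finset.sum_eq_zero]
        intro b _
        rw [if_neg]
        rintro rfl
        exact hx b.2
    rw [this, map_sum, ← Finset.sum_attach]
    refine Finset.sum_congr rfl fun i _ => ?_
    simp only [w, dif_pos (hT i.2)]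
  constructor
  · intro hφ T hTI hT h0
    rw [hsum T (hTI.trans hI), Submodule.mkQ_apply, Submodule.Quotient.mk_eq_zero] at h0
    obtain ⟨φ, hφR⟩ := h0
    obtain ⟨i, hi⟩ := hT
    have hRφ : ∀ x (hx : x ∈ M.E), φ (v x) = if x ∈ T then 1 else 0 := fun x hx =>
      congrFun hφR ⟨x, hx⟩
    have := hφ φ (fun e he => by
      rw [hRφ e he.1, if_neg fun hc => he.2 (hTI (Finset.mem_coe.2 hc))]) i (hI (hTI hi))
    rw [hRφ i (hI (hTI hi)), if_pos hi] at this
    exact one_ne_zero this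
  · intro hT φ hφ e he
    by_contra hne
    have hfin := finite_of_subset_ground M hI
    -- The support of `φ ∘ v` gives an element of the row space that is supported on `I`.
    refine hT (hfin.toFinset.filter fun i => φ (v i) ≠ 0) (fun x hx => by simp at hx; exact hx.1)
      ⟨e, ?_⟩ ?_
    · simp only [Finset.mem_filter, Set.Finite.mem_toFinset]
      exact ⟨by_contra fun heI => hne (hφ e ⟨he, heI⟩), hne⟩
    · rw [hsum _ (fun x hx => hI (by simp at hx; exact hx.1)), Submodule.mkQ_apply,
        Submodule.Quotient.mk_eq_zero]
      refine ⟨φ, funext fun x => ?_⟩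
      have h2 : ∀ a : ZMod 2, a ≠ 0 → a = 1 := by decide
      have hx : R φ x = φ (v x) := rfl
      rw [hx]
      by_cases hx0 : φ (v x) = 0
      · simp [hx0]
      · have hxI : (x : α) ∈ I := by_contra fun hxI => hx0 (hφ x ⟨x.2, hxI⟩)
        rw [if_pos (by simp [hxI, hx0]), h2 _ hx0]

/-! ### Uniformity and connectivity in terms of rank -/

theorem unif_ground (r n : ℕ) : (unif r n).E = Set.univ := rfl

theorem unif_indep_iff {r n : ℕ} {I : Set (Fin n)} : (unif r n).Indep I ↔ I.ncard ≤ r := by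
  simp [unif]

instance unif_finite (r n : ℕ) : (unif r n).Finite := ⟨Set.toFinite _⟩

theorem sum_unif_indep_iff {k l : ℕ} {I : Set (Fin k ⊕ Fin l)} :
    ((unif k k).sum (unif 0 l)).Indep I ↔ ∀ y, Sum.inr y ∉ I := by
  rw [sum_indep_iff, unif_indep_iff, unif_indep_iff, Nat.le_zero, Set.ncard_eq_zero,
    Set.eq_empty_iff_forall_notMem]
  refine and_iff_right ((Set.ncard_le_ncard (Set.subset_univ _)).trans ?_)
  simp

/-- Contracting a basis `I` of a set `X` of corank at least `k` and nullity at least `l` turns `l`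
elements of `X` into loops and keeps `k` elements of a basis of `M` independent, which gives a minor
`U_{k,k} ⊕ U_{0,l}`. Conversely, the contracted set of such a minor together with the `l` loops has
corank at least `k` and nullity at least `l`. -/
theorem isKLUniform_iff_rankGap [M.Finite] (k l : ℕ) : M.IsKLUniform k l ↔ M.RankGap k l := by
  constructor
  · intro h X hX hle
    by_contra! hge
    obtain ⟨I, hI⟩ := M.exists_isBasis X hX
    obtain ⟨B, hB, hIB⟩ := hI.indep.exists_isBase_superset
    have hXfin := finite_of_subset_ground M hX
    have hBfin := finite_of_subset_ground M hB.subset_ground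
    have c1 := Set.ncard_sdiff_add_ncard_of_subset hI.subset hXfin
    have c2 := Set.ncard_sdiff_add_ncard_of_subset hIB hBfin
    rw [hI.ncard_eq_rk] at c1 c2
    rw [hB.ncard_eq_rk] at c2
    obtain ⟨K, hK, hKc⟩ := Set.exists_subset_card_eq (show k ≤ (B \ I).ncard by omega)
    obtain ⟨L, hL, hLc⟩ := Set.exists_subset_card_eq (show l ≤ (X \ I).ncard by omega)
    have : Finite K := hBfin.subset (hK.trans Set.sdiff_subset)
    have : Finite L := hXfin.subset (hL.trans Set.sdiff_subset)
    let g := (Finite.equivFinOfCardEq hKc).symm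
    let g' := (Finite.equivFinOfCardEq hLc).symm
    let F : Fin k ⊕ Fin l → α := Sum.elim (fun i => g i) (fun i => g' i)
    have hKL : Disjoint K L := by
      refine Set.disjoint_left.2 fun x hxK hxL => ?_
      have := (hB.indep.subset (Set.insert_subset (hK hxK).1 hIB))
      exact (hL hxL).2 (hI.mem_of_insert_indep (hL hxL).1 this)
    have hKE : K ⊆ M.E := hK.trans (Set.sdiff_subset.trans hB.subset_ground)
    have hLE : L ⊆ M.E := hL.trans (Set.sdiff_subset.trans hX)
    have hsub : K ∪ L ⊆ (M ／ I).E := by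
      rw [contract_ground]
      exact Set.union_subset (fun x hx => ⟨hKE hx, (hK hx).2⟩) fun x hx => ⟨hLE hx, (hL hx).2⟩
    refine h ⟨(M ／ I) ↾ (K ∪ L), ⟨I, (M ／ I).E \ (K ∪ L), by rw [delete_compl hsub]⟩,
      (isIsoTo_of_bijOn F ⟨?_, ?_, ?_⟩ ?_).symm⟩
    · rintro (i | i) -
      · exact Or.inl (g i).2
      · exact Or.inr (g' i).2
    · rintro (i | i) - (j | j) - hij
      · exact congrArg _ (g.injective (Subtype.ext hij))
      · exact (hKL.ne_of_mem (g i).2 (g' j).2 hij).elim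
      · exact (hKL.ne_of_mem (g j).2 (g' i).2 hij.symm).elim
      · exact congrArg _ (g'.injective (Subtype.ext hij))
    · rintro x (hx | hx)
      · exact ⟨Sum.inl (g.symm ⟨x, hx⟩), by simp [unif_ground], by simp [F]⟩
      · exact ⟨Sum.inr (g'.symm ⟨x, hx⟩), by simp [unif_ground], by simp [F]⟩
    · intro J _
      rw [sum_unif_indep_iff, restrict_indep_iff, hI.indep.contract_indep_iff]
      constructor
      · intro hJ
        have hJK : F '' J ⊆ K := by
          rintro _ ⟨(i | i), hi, rfl⟩
          · exact (g i).2
          · exact (hJ i hi).elim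
        refine ⟨⟨Set.disjoint_left.2 fun x hx hxI => (hK (hJK hx)).2 hxI, hB.indep.subset ?_⟩,
          hJK.trans Set.subset_union_left⟩
        exact Set.union_subset (hJK.trans (hK.trans Set.sdiff_subset)) hIB
      · rintro ⟨⟨-, hi⟩, -⟩ y hy
        have hyX := hL (g' y).2
        refine hyX.2 (hI.mem_of_insert_indep hyX.1 (hi.subset ?_))
        exact Set.insert_subset (Or.inl ⟨_, hy, rfl⟩) Set.subset_union_right
  · rintro h ⟨N, ⟨C, D, rfl⟩, hN⟩
    obtain ⟨f, hf⟩ := hN.symm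
    have huniv : ∀ x, x ∈ ((unif k k).sum (unif 0 l)).E := by simp [unif_ground]
    let F : Fin k ⊕ Fin l → α := fun x => f ⟨x, huniv x⟩
    have hF : Function.Injective F := fun x y hxy =>
      congrArg Subtype.val (f.injective (Subtype.ext hxy))
    have hFE : ∀ x, F x ∈ (M ／ C).E := fun x => (f ⟨x, huniv x⟩).2.1
    have hind : ∀ I, ((unif k k).sum (unif 0 l)).Indep I ↔ (M ／ C ＼ D).Indep (F '' I) := by
      intro I
      have h1 := hf (Subtype.val ⁻¹' I)
      have h2 : Subtype.val '' ((Subtype.val : ((unif k k).sum (unif 0 l)).E → _) ⁻¹' I) = I := by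
        rw [Subtype.image_preimage_coe, Set.inter_eq_right]
        exact fun x _ => huniv x
      rw [h2] at h1
      rw [h1]
      congr! 1
      ext x
      simp only [Set.mem_image, Set.mem_preimage, Subtype.exists, F]
      constructor
      · rintro ⟨y, hy, ⟨a, ha, haI, hay⟩, rfl⟩
        exact ⟨a, haI, by rw [hay]⟩
      · rintro ⟨a, haI, rfl⟩
        exact ⟨_, (f ⟨a, huniv a⟩).2, ⟨a, huniv a, haI, rfl⟩, rfl⟩
    -- The contracted set need not lie in the ground set of `M`.
    obtain ⟨J, hJ⟩ := M.exists_isBasis (C ∩ M.E) Set.inter_subset_right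
    have hloop : ∀ y, F (Sum.inr y) ∈ M.closure (C ∩ M.E) := by
      intro y
      have h1 : ¬ (M ／ C).Indep {F (Sum.inr y)} := fun hi => by
        have h2 : (M ／ C ＼ D).Indep (F '' {Sum.inr y}) := by
          rw [delete_indep_iff, Set.image_singleton]
          exact ⟨hi, Set.disjoint_singleton_left.2 (f ⟨Sum.inr y, huniv _⟩).2.2⟩
        exact sum_unif_indep_iff.1 ((hind _).2 h2) y rfl
      rw [singleton_not_indep (hFE _), contract_isLoop_iff_mem_closure] at h1
      rw [closure_inter_ground]
      exact h1.1
    have hK : (M ／ C).Indep (F '' Set.range Sum.inl) :=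
      ((hind _).1 (sum_unif_indep_iff.2 (by simp))).of_delete
    rw [← contract_inter_ground_eq, hJ.contract_indep_iff] at hK
    have hX : (C ∩ M.E) ∪ Set.range (F ∘ Sum.inr) ⊆ M.E := by
      refine Set.union_subset Set.inter_subset_right ?_
      rintro _ ⟨y, rfl⟩
      exact (hFE _).1
    have hdj : Disjoint (C ∩ M.E) (Set.range (F ∘ Sum.inr)) := by
      refine Set.disjoint_left.2 ?_
      rintro _ hx ⟨y, rfl⟩
      exact (hFE _).2 hx.1
    have hr : M.rk ((C ∩ M.E) ∪ Set.range (F ∘ Sum.inr)) = M.rk (C ∩ M.E) := by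
      rw [rk, rk, ← eRk_closure_eq, ← eRk_closure_eq M (C ∩ M.E)]
      congr 2
      refine subset_antisymm (closure_subset_closure_of_subset_closure ?_)
        (M.closure_subset_closure Set.subset_union_left)
      refine Set.union_subset (M.subset_closure _ Set.inter_subset_right) ?_
      rintro _ ⟨y, rfl⟩
      exact hloop y
    have hc := Set.ncard_union_eq hdj (finite_of_subset_ground M Set.inter_subset_right)
    have hcr : (Set.range (F ∘ Sum.inr)).ncard = l := by
      rw [← Set.image_univ, Set.ncard_image_of_injective _ (hF.comp Sum.inr_injective)]
      simp
    have hck : (F '' Set.range Sum.inl).ncard = k := by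
      rw [← Set.image_univ, Set.ncard_image_of_injective _ hF,
        Set.ncard_image_of_injective _ Sum.inl_injective]
      simp
    have hck2 := Set.ncard_union_eq (hK.2.symm.mono_right hJ.subset)
      (finite_of_subset_ground M (Set.subset_union_left.trans hK.1.subset_ground))
      (finite_of_subset_ground M hJ.indep.subset_ground)
    have hr1 := hK.1.rk_eq_ncard
    have hr2 := M.rk_le_rk_ground (F '' Set.range Sum.inl ∪ J)
    have hr3 := hJ.ncard_eq_rk
    have := h _ hX
    have hle := rk_le_ncard (M := M) (X := C ∩ M.E) Set.inter_subset_right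
    omega

theorem IsKSeparation.dual [M.Finite] {k : ℕ} {X : Set α} (h : M.IsKSeparation k X) :
    M✶.IsKSeparation k X := by
  obtain ⟨hX, h1, h2, h3⟩ := h
  refine ⟨hX, h1, h2, ?_⟩
  simp only [dual_ground, ← cast_rk, ← cast_rk_ground] at h3 ⊢
  have e1 := rk_dual_add (M := M) hX
  have e2 := rk_dual_add (M := M) (X := M.E \ X) Set.sdiff_subset
  rw [Set.sdiff_sdiff_cancel_left hX] at e2
  have e3 := M.rk_add_rk_dual
  have e4 := ncard_diff_add hX
  norm_cast at h3 ⊢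
  omega

theorem IsNConnected.dual [M.Finite] {n : ℕ} (h : M.IsNConnected n) : M✶.IsNConnected n :=
  fun k h1 h2 ⟨X, hX⟩ => h k h1 h2 ⟨X, by simpa using hX.dual⟩

theorem not_isNConnected_three_iff [M.Finite] : ¬ M.IsNConnected 3 ↔ ∃ X ⊆ M.E,
    (1 ≤ X.ncard ∧ 1 ≤ (M.E \ X).ncard ∧ M.rk X + M.rk (M.E \ X) ≤ M.rk M.E) ∨
    (2 ≤ X.ncard ∧ 2 ≤ (M.E \ X).ncard ∧ M.rk X + M.rk (M.E \ X) ≤ M.rk M.E + 1) := by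
  have key : ∀ (k : ℕ) (X : Set α), M.IsKSeparation k X ↔ X ⊆ M.E ∧ k ≤ X.ncard ∧
      k ≤ (M.E \ X).ncard ∧ M.rk X + M.rk (M.E \ X) < M.rk M.E + k := by
    intro k X
    refine and_congr_right fun hX => ?_
    rw [← cast_rk, ← cast_rk, ← cast_rk_ground, ← (finite_of_subset_ground M hX).cast_ncard_eq,
      ← (finite_of_subset_ground M Set.sdiff_subset).cast_ncard_eq]
    norm_cast
  constructor
  · intro h
    simp only [IsNConnected, not_forall, not_not] at h
    obtain ⟨k, h1, h2, X, hX⟩ := h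
    rw [key] at hX
    refine ⟨X, hX.1, ?_⟩
    omega
  · rintro ⟨X, hX, h | h⟩ hM
    · exact hM 1 le_rfl (by norm_num) ⟨X, (key 1 X).2 ⟨hX, h.1, h.2.1, by omega⟩⟩
    · exact hM 2 (by norm_num) (by norm_num) ⟨X, (key 2 X).2 ⟨hX, h.1, h.2.1, by omega⟩⟩

/-! ### Loops and parallel pairs -/

/-- A non-simple matroid has a loop, or is loopless with a parallel pair. -/
theorem exists_of_not_isSimple [M.Finite] (h : ¬ M.IsSimple) :
    (∃ e, M.IsLoop e) ∨ (M.Loopless ∧ ∃ a b, a ≠ b ∧ M.IsCircuit {a, b}) := by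
  by_cases hl : ∃ e, M.IsLoop e
  · exact Or.inl hl
  · refine Or.inr ⟨loopless_iff_forall_not_isLoop.2 fun e _ he => hl ⟨e, he⟩, ?_⟩
    simp only [IsSimple, not_forall, not_le] at h
    obtain ⟨C, hC, hlt⟩ := h
    have hfin := finite_of_subset_ground M hC.subset_ground
    rw [← hfin.cast_ncard_eq] at hlt
    have hlt' : C.ncard < 3 := by exact_mod_cast hlt
    have h0 : C.ncard ≠ 0 := fun h0 => hC.nonempty.ne_empty ((Set.ncard_eq_zero hfin).1 h0)
    have h1 : C.ncard ≠ 1 := fun h1 => by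
      obtain ⟨e, rfl⟩ := Set.ncard_eq_one.1 h1
      exact hl ⟨e, singleton_isCircuit.1 hC⟩
    obtain ⟨a, b, hab, rfl⟩ := Set.ncard_eq_two.1 (show C.ncard = 2 by omega)
    exact ⟨a, b, hab, hC⟩

theorem isSimple_iff_indep [M.Finite] : M.IsSimple ↔ ∀ I ⊆ M.E, I.ncard ≤ 2 → M.Indep I := by
  constructor
  · intro h I hI hI2
    by_contra hn
    obtain ⟨C, hCI, hC⟩ := ((not_indep_iff hI).1 hn).exists_isCircuit_subset
    have := h C hC
    rw [← (finite_of_subset_ground M hC.subset_ground).cast_ncard_eq] at this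
    have h3 : 3 ≤ C.ncard := by exact_mod_cast this
    have := Set.ncard_le_ncard hCI (finite_of_subset_ground M hI)
    omega
  · intro h C hC
    rw [← (finite_of_subset_ground M hC.subset_ground).cast_ncard_eq]
    by_contra hlt
    have hlt' : C.ncard < 3 := by simpa using hlt
    exact hC.not_indep (h C hC.subset_ground (by omega))

/-- A loop is one side of a `1`-separation and a parallel pair one side of a `1`- or
`2`-separation. -/
theorem not_isNConnected_of_not_isSimple [M.Finite] (h : ¬ M.IsSimple) (hr : 2 ≤ M.rk M.E) :
    ¬ M.IsNConnected 3 := by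
  rw [not_isNConnected_three_iff]
  have hn := rk_le_ncard (subset_refl M.E)
  rcases exists_of_not_isSimple h with ⟨e, he⟩ | ⟨-, a, b, hab, hC⟩
  · have hE : {e} ⊆ M.E := Set.singleton_subset_iff.2 he.mem_ground
    have h1 := ncard_diff_add hE
    have h2 := (isLoop_iff_rk he.mem_ground).1 he
    have h3 := M.rk_le_rk_ground (M.E \ {e})
    rw [Set.ncard_singleton] at h1
    exact ⟨{e}, hE, Or.inl ⟨by simp, by omega, by omega⟩⟩
  · have h1 := ncard_diff_add hC.subset_ground
    have h2 := hC.rk_add_one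
    rw [Set.ncard_pair hab] at h1 h2
    have h3 := M.rk_le_rk_ground (M.E \ {a, b})
    have h4 := rk_le_ncard (M := M) (X := M.E \ {a, b}) Set.sdiff_subset
    have h5 := hC.dep
    have h6 : M.rk M.E < M.E.ncard := (rk_lt_ncard_iff_not_indep subset_rfl).2 fun hi =>
      h5.not_indep (hi.subset hC.subset_ground)
    refine ⟨{a, b}, hC.subset_ground, ?_⟩
    rw [Set.ncard_pair hab]
    omega

/-! ### Binary matroids without short circuits -/

section Core

variable {V : Type*} [AddCommGroup V] [Module (ZMod 2) V]

/-- The corank of a dependent set with fewer than `r(M)` elements is at least `2`. -/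
theorem rankGap_two_one_iff [M.Finite] :
    M.RankGap 2 1 ↔ ∀ S ⊆ M.E, S.ncard < M.rk M.E → M.Indep S := by
  constructor
  · intro h S hS hlt
    by_contra hn
    have h1 := (rk_lt_ncard_iff_not_indep hS).2 hn
    have h2 := h S hS (by omega)
    omega
  · intro h X hX hle
    by_contra! hge
    obtain ⟨I, hI⟩ := M.exists_isBasis X hX
    have hr := hI.ncard_eq_rk
    have hfin := finite_of_subset_ground M hI.indep.subset_ground
    obtain ⟨e, heX, heI⟩ := Set.exists_mem_notMem_of_ncard_lt_ncard
      (show I.ncard < X.ncard by omega) hfin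
    refine heI (hI.mem_of_insert_indep heX (h _ (Set.insert_subset (hX heX)
      hI.indep.subset_ground) ?_))
    rw [Set.ncard_insert_of_notMem heI hfin]
    omega

theorem Rep.not_indep_of_sum_eq_zero {v : α → V} (h : M.Rep v) {T : Finset α} (hT : ↑T ⊆ M.E)
    (hne : T.Nonempty) (h0 : ∑ i ∈ T, v i = 0) : ¬ M.Indep (T : Set α) := fun hi =>
  linearIndepOn_iff_sum_ne_zero.1 ((h _ hT).1 hi) T subset_rfl hne h0

/-- The fundamental circuit of `e` with respect to `I`, written as a sum of vectors; if all circuits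
have at least `r(M)` elements, the sum has at least `r(M) - 1` terms. -/
theorem Rep.exists_sum [M.Finite] {v : α → V} (h : M.Rep v) (hg : M.RankGap 2 1) {I : Set α} {e : α}
    (hI : M.Indep I) (he : e ∈ M.closure I) (heI : e ∉ I) :
    ∃ T : Finset α, ↑T ⊆ I ∧ v e = ∑ i ∈ T, v i ∧ M.rk M.E ≤ T.card + 1 := by
  classical
  have heE := mem_ground_of_mem_closure he
  rw [h.mem_closure_iff hI.subset_ground heE] at he
  obtain ⟨T, hT, hs⟩ := exists_finset_sum_of_mem_span he
  refine ⟨T, hT, hs, ?_⟩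
  have heT : e ∉ T := fun hc => heI (hT hc)
  have hsub : ↑(insert e T) ⊆ M.E := by
    rw [Finset.coe_insert]
    exact Set.insert_subset heE (hT.trans hI.subset_ground)
  by_contra! hlt
  refine h.not_indep_of_sum_eq_zero hsub (Finset.insert_nonempty _ _) ?_
    (rankGap_two_one_iff.1 hg _ hsub ?_)
  · rw [Finset.sum_insert heT, hs, zmod_two_add_self]
  · rw [Set.ncard_coe_finset, Finset.card_insert_of_notMem heT]
    omega

/-- If all circuits have at least `r(M)` elements, an element of a non-spanning set outside a basis
of this set is the sum of the whole basis, so two such elements would be parallel. -/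
theorem IsBinary.rankGap_one_two [M.Finite] (hb : M.IsBinary) (h : M.RankGap 2 1)
    (hr : 3 ≤ M.rk M.E) : M.RankGap 1 2 := by
  classical
  obtain ⟨n, v, hv⟩ := isBinary_iff_exists_rep.1 hb
  intro X hX hle
  by_contra! hge
  obtain ⟨I, hI⟩ := M.exists_isBasis X hX
  have hIr := hI.ncard_eq_rk
  have hfin := finite_of_subset_ground M hX
  have hc := Set.ncard_sdiff_add_ncard_of_subset hI.subset hfin
  obtain ⟨e, f, he, hf, hef⟩ := (Set.one_lt_ncard_iff (hfin.subset Set.sdiff_subset)).1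
    (show 1 < (X \ I).ncard by omega)
  have key : ∀ e ∈ X \ I, v e = ∑ i ∈ (hfin.subset hI.subset).toFinset, v i := by
    intro e he
    obtain ⟨T, hT, hs, hle'⟩ := hv.exists_sum h hI.indep (hI.subset_closure he.1) he.2
    rw [hs]
    congr 1
    apply Finset.eq_of_subset_of_card_le
    · intro x hx
      simpa using hT hx
    · rw [← Set.ncard_eq_toFinset_card _ (hfin.subset hI.subset)]
      omega
  have hsub : (↑({e, f} : Finset α) : Set α) ⊆ M.E := by
    rw [Finset.coe_pair]
    exact Set.insert_subset (hX he.1) (Set.singleton_subset_iff.2 (hX hf.1))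
  refine hv.not_indep_of_sum_eq_zero hsub (by simp) ?_ (rankGap_two_one_iff.1 h _ hsub ?_)
  · rw [Finset.sum_pair hef, key e he, key f hf, zmod_two_add_self]
  · rw [Set.ncard_coe_finset, Finset.card_pair hef]
    omega

/-- The binary matroids of rank and dual rank at least `3` all of whose circuits have at least
`r(M)` elements. Up to isomorphism they are `M(W₃)`, `F₇`, `F₇✶` and `AG(3, 2)`. -/
structure Core (M : Matroid α) : Prop where
  isBinary : M.IsBinary
  gap : M.RankGap 2 1
  three_le_rk : 3 ≤ M.rk M.E
  three_le_dual_rk : 3 ≤ M✶.rk M.E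

theorem Core.gap' [M.Finite] (h : M.Core) : M.RankGap 1 2 :=
  h.isBinary.rankGap_one_two h.gap h.three_le_rk

theorem Core.dual [M.Finite] (h : M.Core) : M✶.Core :=
  ⟨h.isBinary.dual, h.gap'.dual, h.three_le_dual_rk, by rw [dual_dual]; exact h.three_le_rk⟩

theorem eq_or_eq_diff_singleton {S T : Set α} (hT : T.Finite) (hST : S ⊆ T)
    (h : T.ncard ≤ S.ncard + 1) : S = T ∨ ∃ u ∈ T, S = T \ {u} := by
  have hc := Set.ncard_sdiff_add_ncard_of_subset hST hT
  by_cases h0 : (T \ S).ncard = 0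
  · left
    rw [Set.ncard_eq_zero (hT.subset Set.sdiff_subset), Set.sdiff_eq_empty] at h0
    exact hST.antisymm h0
  · right
    obtain ⟨u, hu⟩ := Set.ncard_eq_one.1 (show (T \ S).ncard = 1 by omega)
    refine ⟨u, (hu ▸ rfl : u ∈ T \ S).1, ?_⟩
    rw [← hu, Set.sdiff_sdiff_cancel_left hST]

/-- Half of the vectors lie off a hyperplane. -/
theorem ncard_functional_eq_one [Finite V] {h : Module.Dual (ZMod 2) V} (hh : h ≠ 0) :
    2 * {x | h x = 1}.ncard = Nat.card V := by
  obtain ⟨m, hm⟩ : ∃ m, h m ≠ 0 := by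
    by_contra! hc
    exact hh (LinearMap.ext hc)
  have h2 : ∀ a : ZMod 2, a ≠ 0 ↔ a = 1 := by decide
  rw [h2] at hm
  have e1 : {x | h x = 1}ᶜ = (fun x => m + x) '' {x | h x = 1} := by
    have h3 : ∀ a : ZMod 2, ¬ a = 1 ↔ 1 + a = 1 := by decide
    ext x
    simp only [Set.mem_compl_iff, Set.mem_ofPred_eq, Set.mem_image, h3]
    constructor
    · intro hx
      exact ⟨m + x, by rw [map_add, hm, hx], by rw [← add_assoc, zmod_two_add_self, zero_add]⟩
    · rintro ⟨y, hy, rfl⟩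
      rw [map_add, hm, hy]
      decide
  have e2 := Set.ncard_add_ncard_compl {x | h x = 1}
  rw [e1, Set.ncard_image_of_injective _ (add_right_injective m)] at e2
  omega

/-- The possible images of a representation of a core matroid: all nonzero vectors of
a `3`-dimensional space with at most one omitted, or all vectors off a hyperplane `h = 0` of a
`4`-dimensional space with at most one omitted. -/
def IsCoreSet (S : Set V) : Prop :=
  (Module.finrank (ZMod 2) V = 3 ∧ (S = {x | x ≠ 0} ∨ ∃ u, u ≠ 0 ∧ S = {x | x ≠ 0} \ {u})) ∨
  (Module.finrank (ZMod 2) V = 4 ∧ ∃ h : Module.Dual (ZMod 2) V, h ≠ 0 ∧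
    (S = {x | h x = 1} ∨ ∃ m, h m = 1 ∧ S = {x | h x = 1} \ {m}))

/-- With respect to a basis `B`, every element outside `B` is the sum of at least `r - 1` basis
elements. Two such sums differ in at most two places, so `r ≤ 4`, and for `r = 4` all of them have
exactly three terms, so that the sum of the coordinates is `1` on all elements. -/
theorem Core.isCoreSet [M.Finite] (h : M.Core) {v : α → V} (hv : M.Rep v)
    (hs : Submodule.span (ZMod 2) (v '' M.E) = ⊤) :
    Set.InjOn v M.E ∧ IsCoreSet (v '' M.E) := by
  classical
  have hrk : Module.finrank (ZMod 2) V = M.rk M.E := by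
    rw [← hv.finrank_span subset_rfl, hs, finrank_top]
  have h3 := h.three_le_rk
  have hfd : Module.Finite (ZMod 2) V := Module.finite_of_finrank_pos (by omega)
  have hfinV : Finite V := Module.finite_of_finite (ZMod 2)
  have hcard : Nat.card V = 2 ^ M.rk M.E := by
    rw [Module.natCard_eq_pow_finrank (K := ZMod 2), hrk, Nat.card_zmod]
  have hn := M.rk_add_rk_dual
  have h3' := h.three_le_dual_rk
  have hinj : Set.InjOn v M.E := by
    intro e he f hf hef
    by_contra hne
    have hsub : (↑({e, f} : Finset α) : Set α) ⊆ M.E := by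
      rw [Finset.coe_pair]
      exact Set.insert_subset he (Set.singleton_subset_iff.2 hf)
    refine hv.not_indep_of_sum_eq_zero hsub (by simp) ?_ (rankGap_two_one_iff.1 h.gap _ hsub ?_)
    · rw [Finset.sum_pair hne, hef, zmod_two_add_self]
    · rw [Set.ncard_coe_finset, Finset.card_pair hne]
      omega
  have hne : ∀ e ∈ M.E, v e ≠ 0 := by
    intro e he h0
    have hsub : (↑({e} : Finset α) : Set α) ⊆ M.E := by simpa using he
    refine hv.not_indep_of_sum_eq_zero hsub (by simp) (by simpa using h0)
      (rankGap_two_one_iff.1 h.gap _ hsub ?_)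
    rw [Set.ncard_coe_finset, Finset.card_singleton]
    omega
  have himg : (v '' M.E).ncard = M.E.ncard := hinj.ncard_image
  -- Compare the elements outside a basis `B` by their expansions `S` and `T` in `B`: the elements
  -- `e`, `f` and the symmetric difference of `S` and `T` contain a circuit.
  obtain ⟨B, hB⟩ := M.exists_isBase
  have hBr := hB.ncard_eq_rk
  have hBfin := finite_of_subset_ground M hB.subset_ground
  have hsum : ∀ e ∈ M.E \ B, ∃ T : Finset α, ↑T ⊆ B ∧ v e = ∑ i ∈ T, v i ∧
      M.rk M.E ≤ T.card + 1 := fun e he =>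
    hv.exists_sum h.gap hB.indep (by rw [hB.closure_eq]; exact he.1) he.2
  have hpair : ∀ e ∈ M.E \ B, ∀ f ∈ M.E \ B, e ≠ f → ∀ S T : Finset α, ↑S ⊆ B → ↑T ⊆ B →
      v e = ∑ i ∈ S, v i → v f = ∑ i ∈ T, v i → S.card + T.card ≤ M.rk M.E + 2 := by
    intro e he f hf hef S T hS hT hSe hTf
    have hST : symmDiff S T ⊆ S ∪ T := by
      rw [symmDiff_eq_sup_sdiff_inf]
      exact Finset.sdiff_subset
    have hSTB : ∀ x ∈ S ∪ T, x ∈ B := fun x hx => by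
      rcases Finset.mem_union.1 hx with hx | hx
      · exact hS hx
      · exact hT hx
    have hf1 : f ∉ symmDiff S T := fun hc => hf.2 (hSTB _ (hST hc))
    have he1 : e ∉ insert f (symmDiff S T) := fun hc => by
      rcases Finset.mem_insert.1 hc with hc | hc
      · exact hef hc
      · exact he.2 (hSTB _ (hST hc))
    have hsub : (↑(insert e (insert f (symmDiff S T))) : Set α) ⊆ M.E := by
      rw [Finset.coe_insert, Finset.coe_insert]
      exact Set.insert_subset he.1 (Set.insert_subset hf.1 fun x hx =>
        hB.subset_ground (hSTB x (hST hx)))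
    have hdep : ¬ M.Indep (↑(insert e (insert f (symmDiff S T))) : Set α) := by
      refine hv.not_indep_of_sum_eq_zero hsub (by simp) ?_
      rw [Finset.sum_insert he1, Finset.sum_insert hf1, ← sum_add_sum_eq_sum_symmDiff, ← hSe, ← hTf,
        ← add_assoc, zmod_two_add_self]
    have hlt : ¬ _ := fun hlt => hdep (rankGap_two_one_iff.1 h.gap _ hsub hlt)
    rw [Set.ncard_coe_finset, Finset.card_insert_of_notMem he1, Finset.card_insert_of_notMem hf1]
      at hlt
    have c1 : (S ∪ T).card ≤ M.rk M.E := by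
      rw [← hBr, ← Set.ncard_coe_finset]
      exact Set.ncard_le_ncard (fun x hx => hSTB x hx) hBfin
    have c2 := Finset.card_union_add_card_inter S T
    have c3 : (symmDiff S T).card + (S ∩ T).card = (S ∪ T).card := by
      rw [symmDiff_eq_sup_sdiff_inf]
      exact Finset.card_sdiff_add_card_eq_card
        (Finset.inter_subset_left.trans Finset.subset_union_left)
    omega
  have hcB := ncard_diff_add hB.subset_ground
  have hother : ∀ e, ∃ f ∈ M.E \ B, f ≠ e := fun e => by
    obtain ⟨f, hf, hfe⟩ := Set.exists_ne_of_one_lt_ncard (show 1 < (M.E \ B).ncard by omega) e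
    exact ⟨f, hf, hfe⟩
  have hr4 : M.rk M.E ≤ 4 := by
    obtain ⟨e, he⟩ : (M.E \ B).Nonempty := Set.nonempty_of_ncard_ne_zero (by omega)
    obtain ⟨f, hf, hfe⟩ := hother e
    obtain ⟨S, hS, hSe, hSr⟩ := hsum e he
    obtain ⟨T, hT, hTf, hTr⟩ := hsum f hf
    have := hpair f hf e he hfe T S hT hS hTf hSe
    omega
  refine ⟨hinj, ?_⟩
  rcases (show M.rk M.E = 3 ∨ M.rk M.E = 4 by omega) with hr | hr
  · left
    refine ⟨by omega, ?_⟩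
    have hsub : v '' M.E ⊆ {x | x ≠ 0} := by
      rintro _ ⟨e, he, rfl⟩
      exact hne e he
    have hc0 : ({x | x ≠ 0} : Set V).ncard = 7 := by
      have := Set.ncard_add_ncard_compl ({0} : Set V)
      rw [Set.ncard_singleton, hcard, hr] at this
      change ({0}ᶜ : Set V).ncard = 7
      omega
    exact eq_or_eq_diff_singleton (Set.toFinite _) hsub (by omega)
  · right
    refine ⟨by omega, ?_⟩
    have hli := ((hv B hB.subset_ground).1 hB.indep).linearIndependent
    have hspan : ⊤ ≤ Submodule.span (ZMod 2) (Set.range fun x : B => v x) := by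
      rw [← hs, ← (hv.spanning_iff hB.subset_ground).1 hB.spanning, Set.image_eq_range]
    -- The functional is the sum of the coordinates with respect to `B`.
    let b := Module.Basis.mk hli hspan
    let φ : Module.Dual (ZMod 2) V := b.constr (ZMod 2) fun _ => (1 : ZMod 2)
    have hφB : ∀ e ∈ B, φ (v e) = 1 := by
      intro e he
      have : v e = b ⟨e, he⟩ := by rw [Module.Basis.mk_apply]
      rw [this, Module.Basis.constr_basis]
    have hφ : ∀ e ∈ M.E, φ (v e) = 1 := by
      intro e he
      by_cases heB : e ∈ B
      · exact hφB e heB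
      · obtain ⟨S, hS, hSe, hSr⟩ := hsum e ⟨he, heB⟩
        obtain ⟨f, hf, hfe⟩ := hother e
        obtain ⟨T, hT, hTf, hTr⟩ := hsum f hf
        have := hpair f hf e ⟨he, heB⟩ hfe T S hT hS hTf hSe
        have hS3 : S.card = 3 := by omega
        rw [hSe, map_sum, Finset.sum_congr rfl fun i hi => hφB i (hS hi)]
        simp [hS3]
        rfl
    have hsub : v '' M.E ⊆ {x | φ x = 1} := by
      rintro _ ⟨e, he, rfl⟩
      exact hφ e he
    have hφ0 : φ ≠ 0 := by
      intro h0
      obtain ⟨e, he⟩ : B.Nonempty := Set.nonempty_of_ncard_ne_zero (by omega)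
      have := hφB e he
      rw [h0] at this
      exact zero_ne_one this
    have hc0 := ncard_functional_eq_one hφ0
    rw [hcard, hr] at hc0
    exact ⟨φ, hφ0, eq_or_eq_diff_singleton (Set.toFinite _) hsub (by omega)⟩

/-- The converse of `Core.isCoreSet`. -/
theorem Rep.core [M.Finite] {v : α → V} (hv : M.Rep v) (hinj : Set.InjOn v M.E)
    (hS : IsCoreSet (v '' M.E)) : M.Core := by
  -- A zero sum over two elements contradicts injectivity.
  have hpair : ∀ T : Finset α, ↑T ⊆ M.E → T.card = 2 → ∑ i ∈ T, v i ≠ 0 := by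
    classical
    intro T hT hc
    obtain ⟨e, f, hef, rfl⟩ := Finset.card_eq_two.1 hc
    rw [Finset.sum_pair hef, Ne, zmod_two_add_eq_zero_iff]
    exact fun h => hef (hinj (hT (by simp)) (hT (by simp)) h)
  have himg : (v '' M.E).ncard = M.E.ncard := hinj.ncard_image
  have hrk : M.rk M.E ≤ Module.finrank (ZMod 2) V := by
    have hfd : Module.Finite (ZMod 2) V := Module.finite_of_finrank_pos (by
      rcases hS with h | h <;> omega)
    rw [← hv.finrank_span subset_rfl]
    exact Submodule.finrank_le _
  have hn := M.rk_add_rk_dual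
  -- It suffices to bound `|M.E|` from below and to exclude zero sums with few terms.
  suffices h : (∀ T : Finset α, ↑T ⊆ M.E → T.Nonempty → T.card < M.rk M.E → ∑ i ∈ T, v i ≠ 0) ∧
      M.rk M.E + 3 ≤ M.E.ncard ∧ 6 ≤ M.E.ncard ∧ ∀ e ∈ M.E, v e ≠ 0 by
    refine ⟨hv.isBinary, rankGap_two_one_iff.2 fun X hX hlt => ?_, ?_, by omega⟩
    · rw [hv X hX, linearIndepOn_iff_sum_ne_zero]
      intro T hT hne
      refine h.1 T (hT.trans hX) hne (lt_of_le_of_lt ?_ hlt)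
      rw [← Set.ncard_coe_finset]
      exact Set.ncard_le_ncard hT (finite_of_subset_ground M hX)
    -- At least six nonzero vectors do not fit into a space of dimension two.
    · set U := Submodule.span (ZMod 2) (v '' M.E)
      have hfd : Module.Finite (ZMod 2) U :=
        FiniteDimensional.span_of_finite _ (M.ground_finite.image v)
      have hfinU : Finite U := Module.finite_of_finite (ZMod 2)
      have hcU : Nat.card U = 2 ^ M.rk M.E := by
        rw [Module.natCard_eq_pow_finrank (K := ZMod 2), hv.finrank_span subset_rfl, Nat.card_zmod]
      have hle : (insert 0 (v '' M.E)).ncard ≤ Nat.card U := by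
        refine Set.ncard_le_ncard (Set.insert_subset U.zero_mem Submodule.subset_span) ?_
        exact Set.toFinite (U : Set V)
      rw [Set.ncard_insert_of_notMem ?_ (M.ground_finite.image v), himg, hcU] at hle
      · by_contra! hlt
        have : 2 ^ M.rk M.E ≤ 2 ^ 2 := Nat.pow_le_pow_right (by norm_num) (by omega)
        omega
      · rintro ⟨e, he, h0⟩
        exact h.2.2.2 e he h0
  rcases hS with ⟨hr, hS⟩ | ⟨hr, φ, hφ, hS⟩
  · have hfd : Module.Finite (ZMod 2) V := Module.finite_of_finrank_pos (by omega)
    have hfinV : Finite V := Module.finite_of_finite (ZMod 2)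
    have hcard : Nat.card V = 2 ^ 3 := by
      rw [Module.natCard_eq_pow_finrank (K := ZMod 2), hr, Nat.card_zmod]
    have hc0 : ({x | x ≠ 0} : Set V).ncard = 7 := by
      have := Set.ncard_add_ncard_compl ({0} : Set V)
      rw [Set.ncard_singleton, hcard] at this
      change ({0}ᶜ : Set V).ncard = 7
      omega
    have hsub : v '' M.E ⊆ {x | x ≠ 0} := by
      rcases hS with hS | ⟨u, -, hS⟩ <;> rw [hS]
      exact Set.sdiff_subset
    have hne : ∀ e ∈ M.E, v e ≠ 0 := fun e he => hsub (Set.mem_image_of_mem v he)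
    have h6 : 6 ≤ M.E.ncard := by
      rw [← himg]
      rcases hS with hS | ⟨u, -, hS⟩ <;> rw [hS]
      · omega
      · have := Set.pred_ncard_le_ncard_sdiff_singleton {x : V | x ≠ 0} u
        omega
    refine ⟨fun T hT hTne hlt => ?_, by omega, h6, hne⟩
    have := hTne.card_pos
    rcases (show T.card = 1 ∨ T.card = 2 by omega) with hc | hc
    · obtain ⟨e, rfl⟩ := Finset.card_eq_one.1 hc
      rw [Finset.sum_singleton]
      exact hne e (hT (by simp))
    · exact hpair T hT hc
  · have hfd : Module.Finite (ZMod 2) V := Module.finite_of_finrank_pos (by omega)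
    have hfinV : Finite V := Module.finite_of_finite (ZMod 2)
    have hcard : Nat.card V = 2 ^ 4 := by
      rw [Module.natCard_eq_pow_finrank (K := ZMod 2), hr, Nat.card_zmod]
    have hc0 := ncard_functional_eq_one hφ
    rw [hcard] at hc0
    have hsub : v '' M.E ⊆ {x | φ x = 1} := by
      rcases hS with hS | ⟨u, -, hS⟩ <;> rw [hS]
      exact Set.sdiff_subset
    have hφ1 : ∀ e ∈ M.E, φ (v e) = 1 := fun e he => hsub (Set.mem_image_of_mem v he)
    have h7 : 7 ≤ M.E.ncard := by
      rw [← himg]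
      rcases hS with hS | ⟨u, -, hS⟩ <;> rw [hS]
      · omega
      · have := Set.pred_ncard_le_ncard_sdiff_singleton {x : V | φ x = 1} u
        omega
    refine ⟨fun T hT hTne hlt => ?_, by omega, by omega, fun e he h0 => ?_⟩
    · have := hTne.card_pos
      rcases (show T.card = 2 ∨ T.card = 1 ∨ T.card = 3 by omega) with hc | hc
      · exact hpair T hT hc
      -- The functional excludes zero sums with an odd number of terms.
      · intro h0
        have h1 := congrArg φ h0
        rw [map_sum, Finset.sum_congr rfl fun i hi => hφ1 i (hT hi), map_zero] at h1
        rcases hc with hc | hc <;> simp [hc] at h1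
        exact absurd h1 (by decide)
    · have := hφ1 e he
      rw [h0, map_zero] at this
      exact zero_ne_one this

end Core

/-! ### Isomorphisms between represented matroids -/

theorem exists_bijOn_of_image_eq [Nonempty β] {V : Type*} {W : Type*} {u : α → V} {u' : β → W}
    {D : Set α} {D' : Set β}
    (hu : Set.InjOn u D) (hu' : Set.InjOn u' D') {L : V → W} (hL : Function.Injective L)
    (h : L '' (u '' D) = u' '' D') :
    ∃ F : α → β, Set.BijOn F D D' ∧ ∀ e ∈ D, u' (F e) = L (u e) := by
  have hex : ∀ e ∈ D, ∃ x ∈ D', u' x = L (u e) := fun e he => by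
    have : L (u e) ∈ u' '' D' := h ▸ Set.mem_image_of_mem L (Set.mem_image_of_mem u he)
    exact this
  choose! F hFD hF using hex
  refine ⟨F, ⟨hFD, fun e he f hf hef => ?_, fun x hx => ?_⟩, hF⟩
  · exact hu he hf (hL (by rw [← hF e he, ← hF f hf, hef]))
  · have : u' x ∈ L '' (u '' D) := h ▸ Set.mem_image_of_mem u' hx
    obtain ⟨_, ⟨e, he, rfl⟩, hex⟩ := this
    exact ⟨e, he, hu' (hFD e he) hx (by rw [hF e he, hex])⟩

section RepIso

variable {V W : Type*} [AddCommGroup V] [Module (ZMod 2) V] [AddCommGroup W] [Module (ZMod 2) W]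

theorem Rep.isIsoTo {u : α → V} {u' : β → W} (hM : M.Rep u) (hN : N.Rep u') {F : α → β}
    (hF : Set.BijOn F M.E N.E) (L : V →ₗ[ZMod 2] W) (hL : Function.Injective L)
    (h : ∀ e ∈ M.E, u' (F e) = L (u e)) : M.IsIsoTo N := by
  refine isIsoTo_of_bijOn F hF fun I hI => ?_
  rw [(hM.comp L hL) I hI, hN _ ((Set.image_mono hI).trans hF.mapsTo.image_subset),
    linearIndepOn_image_iff (hF.injOn.mono hI)]
  exact linearIndepOn_congr fun e he => (h e (hI he)).symm

theorem Rep.sum {u : α → V} {u' : β → W} (hM : M.Rep u) (hN : N.Rep u') :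
    (M.sum N).Rep (Sum.elim (fun x => (u x, (0 : W))) fun y => ((0 : V), u' y)) := by
  intro I hI
  rw [sum_ground] at hI
  have hI1 : Sum.inl ⁻¹' I ⊆ M.E := fun x hx => by simpa using hI hx
  have hI2 : Sum.inr ⁻¹' I ⊆ N.E := fun x hx => by simpa using hI hx
  have hIe : I = Sum.inl '' (Sum.inl ⁻¹' I) ∪ Sum.inr '' (Sum.inr ⁻¹' I) := by
    rw [Set.image_preimage_inl_union_image_preimage_inr]
  set f : α ⊕ β → V × W := Sum.elim (fun x => (u x, (0 : W))) fun y => ((0 : V), u' y)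
  rw [sum_indep_iff, hM _ hI1, hN _ hI2]
  have h1 : ∀ A : Set α, LinearIndepOn (ZMod 2) f (Sum.inl '' A) ↔ LinearIndepOn (ZMod 2) u A :=
    fun A => by
      rw [linearIndepOn_image_iff Sum.inl_injective.injOn]
      exact (LinearMap.inl (ZMod 2) V W).linearIndepOn_iff_of_injOn LinearMap.inl_injective.injOn
  have h2 : ∀ A : Set β, LinearIndepOn (ZMod 2) f (Sum.inr '' A) ↔ LinearIndepOn (ZMod 2) u' A :=
    fun A => by
      rw [linearIndepOn_image_iff Sum.inr_injective.injOn]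
      exact (LinearMap.inr (ZMod 2) V W).linearIndepOn_iff_of_injOn LinearMap.inr_injective.injOn
  conv_rhs => rw [hIe]
  rw [linearIndepOn_union_iff (Set.isCompl_range_inl_range_inr.disjoint.mono
    (Set.image_subset_range _ _) (Set.image_subset_range _ _)), h1, h2]
  refine and_congr_right fun _ => (and_iff_left ?_).symm
  rw [Submodule.disjoint_def]
  intro x hx hx'
  have e1 : Submodule.span (ZMod 2) (f '' (Sum.inl '' (Sum.inl ⁻¹' I))) ≤
      LinearMap.ker (LinearMap.snd (ZMod 2) V W) := by
    rw [Submodule.span_le]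
    rintro _ ⟨_, ⟨y, -, rfl⟩, rfl⟩
    simp [f]
  have e2 : Submodule.span (ZMod 2) (f '' (Sum.inr '' (Sum.inr ⁻¹' I))) ≤
      LinearMap.ker (LinearMap.fst (ZMod 2) V W) := by
    rw [Submodule.span_le]
    rintro _ ⟨_, ⟨y, -, rfl⟩, rfl⟩
    simp [f]
  exact Prod.ext (e2 hx') (e1 hx)

end RepIso

/-! ### Linear algebra over `GF(2)` -/

section LinearAlgebra

variable {V W : Type*} [AddCommGroup V] [Module (ZMod 2) V] [AddCommGroup W] [Module (ZMod 2) W]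

theorem exists_linearEquiv_of_linearIndependent [FiniteDimensional (ZMod 2) V]
    [FiniteDimensional (ZMod 2) W]
    (hd : Module.finrank (ZMod 2) V = Module.finrank (ZMod 2) W) {ι : Type*} {x : ι → V} {y : ι → W}
    (hx : LinearIndependent (ZMod 2) x) (hy : LinearIndependent (ZMod 2) y) :
    ∃ L : V ≃ₗ[ZMod 2] W, ∀ i, L (x i) = y i := by
  let e := LinearEquiv.ofFinrankEq V W hd
  have hex : LinearIndependent (ZMod 2) (e ∘ x) := hx.map' e.toLinearMap e.ker
  let f := (Module.Basis.span hex).equiv (Module.Basis.span hy) (Equiv.refl ι)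
  obtain ⟨g, hg⟩ := Submodule.exists_linearEquiv_restrict_eq f
  refine ⟨e.trans g, fun i => ?_⟩
  have h1 : f (Module.Basis.span hex i) = Module.Basis.span hy i := Module.Basis.equiv_apply _ _ _ _
  have h2 := hg (Module.Basis.span hex i)
  rw [h1, Module.Basis.span_apply, Module.Basis.span_apply] at h2
  exact h2.symm

theorem exists_linearEquiv_apply_eq [FiniteDimensional (ZMod 2) V] [FiniteDimensional (ZMod 2) W]
    (hd : Module.finrank (ZMod 2) V = Module.finrank (ZMod 2) W) {x : V} {y : W}
    (hx : x ≠ 0) (hy : y ≠ 0) : ∃ L : V ≃ₗ[ZMod 2] W, L x = y := by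
  obtain ⟨L, hL⟩ := exists_linearEquiv_of_linearIndependent hd (x := fun _ : Unit => x)
    (y := fun _ : Unit => y) (linearIndependent_unique_iff.2 hx) (linearIndependent_unique_iff.2 hy)
  exact ⟨L, hL ()⟩

/-- The linear group is transitive on triples of a hyperplane `h = 0`, a vector `m` off it and a
nonzero vector `w` on it. -/
theorem exists_linearEquiv_functional [FiniteDimensional (ZMod 2) V] [FiniteDimensional (ZMod 2) W]
    (hd : Module.finrank (ZMod 2) V = Module.finrank (ZMod 2) W)
    {h : Module.Dual (ZMod 2) V} {h' : Module.Dual (ZMod 2) W} {m w : V} {m' w' : W}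
    (hm : h m = 1) (hm' : h' m' = 1) (hw : h w = 0) (hw' : h' w' = 0) (hw0 : w ≠ 0)
    (hw0' : w' ≠ 0) : ∃ L : V ≃ₗ[ZMod 2] W, L m = m' ∧ L w = w' ∧ ∀ x, h' (L x) = h x := by
  have hk : Module.finrank (ZMod 2) (LinearMap.ker h) =
      Module.finrank (ZMod 2) (LinearMap.ker h') := by
    have e1 := h.finrank_range_add_finrank_ker
    have e2 := h'.finrank_range_add_finrank_ker
    rw [LinearMap.range_eq_top.2 (fun c => ⟨c • m, by simp [hm]⟩), finrank_top] at e1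
    rw [LinearMap.range_eq_top.2 (fun c => ⟨c • m', by simp [hm']⟩), finrank_top] at e2
    omega
  obtain ⟨L₁, hL₁⟩ := exists_linearEquiv_apply_eq hk (x := ⟨w, hw⟩) (y := ⟨w', hw'⟩)
    (fun hc => hw0 (congrArg Subtype.val hc)) (fun hc => hw0' (congrArg Subtype.val hc))
  -- Extend `L₁` along the decomposition of the space into the hyperplane and the line of `m`.
  let P : V →ₗ[ZMod 2] LinearMap.ker h :=
    LinearMap.codRestrict (LinearMap.ker h) (LinearMap.id - h.smulRight m) fun x => by
      simp [hm]
  let L₀ : V →ₗ[ZMod 2] W :=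
    (LinearMap.ker h').subtype ∘ₗ L₁.toLinearMap ∘ₗ P + h.smulRight m'
  have hL₀ : ∀ x, L₀ x = (L₁ (P x) : W) + h x • m' := fun x => rfl
  have hh : ∀ x, h' (L₀ x) = h x := fun x => by
    rw [hL₀, map_add, show h' (L₁ (P x)) = 0 from (L₁ (P x)).2, map_smul, hm']
    simp
  have hP : ∀ x, (P x : V) = x - h x • m := fun x => rfl
  have hinj : Function.Injective L₀ := by
    rw [injective_iff_map_eq_zero]
    intro x hx
    have h1 : h x = 0 := by rw [← hh, hx, map_zero]
    rw [hL₀, h1, zero_smul, add_zero] at hx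
    have h2 : L₁ (P x) = 0 := Subtype.ext hx
    rw [LinearEquiv.map_eq_zero_iff] at h2
    have h3 := hP x
    rw [h2, h1, zero_smul, sub_zero] at h3
    exact h3.symm
  refine ⟨L₀.linearEquivOfInjective hinj hd, ?_, ?_, ?_⟩
  · rw [LinearMap.linearEquivOfInjective_apply, hL₀, hm, one_smul]
    have : P m = 0 := Subtype.ext (by rw [hP, hm]; simp)
    simp [this]
  · rw [LinearMap.linearEquivOfInjective_apply, hL₀, hw, zero_smul, add_zero]
    have : P w = ⟨w, hw⟩ := Subtype.ext (by rw [hP, hw]; simp)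
    rw [this, hL₁]
  · intro x
    rw [LinearMap.linearEquivOfInjective_apply, hh]

theorem exists_ne_zero_functional_eq_zero [FiniteDimensional (ZMod 2) V]
    (hd : 2 ≤ Module.finrank (ZMod 2) V) (h : Module.Dual (ZMod 2) V) : ∃ w, w ≠ 0 ∧ h w = 0 := by
  by_contra! hc
  have h1 := h.finrank_range_add_finrank_ker
  have h2 : LinearMap.ker h = ⊥ := (LinearMap.ker_eq_bot').2 fun x hx => by
    by_contra hne
    exact hc x hne hx
  rw [h2, finrank_bot] at h1
  have h3 := Submodule.finrank_le (LinearMap.range h)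
  rw [Module.finrank_self] at h3
  omega

theorem exists_functional_eq_one {h : Module.Dual (ZMod 2) V} (hh : h ≠ 0) : ∃ m, h m = 1 := by
  by_contra! hc
  have h2 : ∀ a : ZMod 2, a ≠ 1 → a = 0 := by decide
  exact hh (LinearMap.ext fun x => h2 _ (hc x))

theorem image_functional_eq_one (L : V ≃ₗ[ZMod 2] W) {h : Module.Dual (ZMod 2) V}
    {h' : Module.Dual (ZMod 2) W} (hL : ∀ x, h' (L x) = h x) :
    L '' {x | h x = 1} = {x | h' x = 1} := by
  ext y
  constructor
  · rintro ⟨x, hx, rfl⟩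
    exact (hL x).trans hx
  · intro hy
    exact ⟨L.symm y, by rw [Set.mem_ofPred_eq, ← hL]; simpa using hy, by simp⟩

theorem image_ne_zero (L : V ≃ₗ[ZMod 2] W) : L '' {x | x ≠ 0} = {x | x ≠ 0} := by
  ext y
  constructor
  · rintro ⟨x, hx, rfl⟩
    simpa using hx
  · intro hy
    exact ⟨L.symm y, by simpa using hy, by simp⟩

theorem image_diff_singleton (L : V ≃ₗ[ZMod 2] W) (S : Set V) (m : V) :
    L '' (S \ {m}) = L '' S \ {L m} := by
  rw [Set.image_sdiff L.injective, Set.image_singleton]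

/-- A proper subspace has at most `2 ^ (n - 1)` elements, and at most half of them lie off a
hyperplane that does not contain it, so it is too small for a core set. -/
theorem IsCoreSet.span_eq_top {S : Set V} (hS : IsCoreSet S) :
    Submodule.span (ZMod 2) S = ⊤ := by
  have hfd : Module.Finite (ZMod 2) V := Module.finite_of_finrank_pos (by
    rcases hS with h | h <;> omega)
  have hfinV : Finite V := Module.finite_of_finite (ZMod 2)
  set U := Submodule.span (ZMod 2) S
  have hSU : S ⊆ U := Submodule.subset_span
  have hU : Nat.card U = 2 ^ Module.finrank (ZMod 2) U := by
    rw [Module.natCard_eq_pow_finrank (K := ZMod 2), Nat.card_zmod]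
  have hV : Nat.card V = 2 ^ Module.finrank (ZMod 2) V := by
    rw [Module.natCard_eq_pow_finrank (K := ZMod 2), Nat.card_zmod]
  refine Submodule.eq_top_of_finrank_eq ?_
  have hle := Submodule.finrank_le U
  rcases hS with ⟨hr, hS⟩ | ⟨hr, φ, hφ, hS⟩
  · have h7 : 7 ≤ (insert 0 S).ncard := by
      have hc0 : ({x | x ≠ 0} : Set V).ncard = 7 := by
        have := Set.ncard_add_ncard_compl ({0} : Set V)
        rw [Set.ncard_singleton, hV, hr] at this
        change ({0}ᶜ : Set V).ncard = 7
        omega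
      rw [Set.ncard_insert_of_notMem]
      · rcases hS with rfl | ⟨u, -, rfl⟩
        · omega
        · have := Set.pred_ncard_le_ncard_sdiff_singleton {x : V | x ≠ 0} u
          omega
      · rcases hS with rfl | ⟨u, -, rfl⟩ <;> simp
    have h8 : (insert 0 S).ncard ≤ Nat.card U :=
      Set.ncard_le_ncard (Set.insert_subset U.zero_mem hSU) (Set.toFinite (U : Set V))
    by_contra hne
    have : 2 ^ Module.finrank (ZMod 2) U ≤ 2 ^ 2 := Nat.pow_le_pow_right (by norm_num) (by omega)
    omega
  · have hc0 := ncard_functional_eq_one hφ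
    rw [hV, hr] at hc0
    have h7 : 7 ≤ S.ncard := by
      rcases hS with rfl | ⟨u, -, rfl⟩
      · omega
      · have := Set.pred_ncard_le_ncard_sdiff_singleton {x : V | φ x = 1} u
        omega
    have hSφ : ∀ x ∈ S, φ x = 1 := by
      rcases hS with rfl | ⟨u, -, rfl⟩
      · exact fun x hx => hx
      · exact fun x hx => hx.1
    have hφU : φ ∘ₗ U.subtype ≠ 0 := by
      obtain ⟨x, hx⟩ : S.Nonempty := Set.nonempty_of_ncard_ne_zero (by omega)
      intro h0
      have := LinearMap.congr_fun h0 ⟨x, hSU hx⟩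
      rw [LinearMap.comp_apply, Submodule.subtype_apply, hSφ x hx] at this
      exact one_ne_zero this
    have hc1 := ncard_functional_eq_one hφU
    have h8 : S.ncard ≤ {x | (φ ∘ₗ U.subtype) x = 1}.ncard := by
      rw [← Set.ncard_image_of_injective _ U.injective_subtype]
      refine Set.ncard_le_ncard fun x hx => ⟨⟨x, hSU hx⟩, hSφ x hx, rfl⟩
    by_contra hne
    have : 2 ^ Module.finrank (ZMod 2) U ≤ 2 ^ 3 := Nat.pow_le_pow_right (by norm_num) (by omega)
    omega

end LinearAlgebra

/-! ### Series pairs -/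

section Series

variable {V V' : Type*} [AddCommGroup V] [Module (ZMod 2) V] [AddCommGroup V'] [Module (ZMod 2) V']
  {γ γ' δ δ' : Type*}

theorem mem_span_series {u : γ → V × ZMod 2} {j : δ → γ} {v : δ → V} {D : Set δ}
    (h : ∀ x ∈ D, u (j x) = (v x, 0)) {z : V × ZMod 2} :
    z ∈ Submodule.span (ZMod 2) (u '' (j '' D)) ↔
      z.1 ∈ Submodule.span (ZMod 2) (v '' D) ∧ z.2 = 0 := by
  have : u '' (j '' D) = LinearMap.inl (ZMod 2) V (ZMod 2) '' (v '' D) := by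
    rw [Set.image_image, Set.image_image]
    exact Set.image_congr h
  rw [this, Submodule.span_image, Submodule.mem_map]
  constructor
  · rintro ⟨x, hx, rfl⟩
    exact ⟨hx, rfl⟩
  · rintro ⟨h1, h2⟩
    exact ⟨z.1, h1, Prod.ext rfl h2.symm⟩

theorem mem_span_insert_series {u : γ → V × ZMod 2} {j : δ → γ} {v : δ → V} {D : Set δ} {w : V}
    {a b : γ} (h : ∀ x ∈ D, u (j x) = (v x, 0)) (ha : u a = (w, 1)) (hb : u b = (0, 1)) :
    u a ∈ Submodule.span (ZMod 2) (u '' (insert b (j '' D))) ↔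
      w ∈ Submodule.span (ZMod 2) (v '' D) := by
  rw [Set.image_insert_eq, Submodule.mem_span_insert]
  constructor
  · rintro ⟨c, z, hz, he⟩
    rw [mem_span_series h] at hz
    rw [ha, hb] at he
    have := congrArg Prod.fst he
    simp only [Prod.fst_add, Prod.smul_fst, smul_zero, zero_add] at this
    rw [this]
    exact hz.1
  · intro hw
    exact ⟨1, (w, 0), (mem_span_series h).2 ⟨hw, rfl⟩, by rw [ha, hb]; simp⟩

theorem linearIndepOn_series {u : γ → V × ZMod 2} {j : δ → γ} {v : δ → V} {D : Set δ}
    (hj : Set.InjOn j D) (h : ∀ x ∈ D, u (j x) = (v x, 0)) :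
    LinearIndepOn (ZMod 2) u (j '' D) ↔ LinearIndepOn (ZMod 2) v D := by
  rw [linearIndepOn_image_iff hj,
    linearIndepOn_congr (v := u ∘ j) (w := LinearMap.inl (ZMod 2) V (ZMod 2) ∘ v) h]
  exact (LinearMap.inl (ZMod 2) V _).linearIndepOn_iff_of_injOn LinearMap.inl_injective.injOn

theorem linearIndepOn_insert_series {u : γ → V × ZMod 2} {j : δ → γ} {v : δ → V} {D : Set δ} {a : γ}
    (hj : Set.InjOn j D) (h : ∀ x ∈ D, u (j x) = (v x, 0)) (ha : (u a).2 = 1) (haD : a ∉ j '' D) :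
    LinearIndepOn (ZMod 2) u (insert a (j '' D)) ↔ LinearIndepOn (ZMod 2) v D := by
  rw [linearIndepOn_insert haD, linearIndepOn_series hj h, mem_span_series h, ha]
  simp

theorem linearIndepOn_insert_insert_series {u : γ → V × ZMod 2} {j : δ → γ} {v : δ → V} {D : Set δ}
    {w : V} {a b : γ} (hj : Set.InjOn j D) (h : ∀ x ∈ D, u (j x) = (v x, 0)) (ha : u a = (w, 1))
    (hb : u b = (0, 1)) (haD : a ∉ j '' D) (hbD : b ∉ j '' D) (hab : a ≠ b) :
    LinearIndepOn (ZMod 2) u (insert a (insert b (j '' D))) ↔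
      LinearIndepOn (ZMod 2) v D ∧ w ∉ Submodule.span (ZMod 2) (v '' D) := by
  have ha' : a ∉ insert b (j '' D) := fun hc => hc.elim hab haD
  rw [linearIndepOn_insert ha', mem_span_insert_series h ha hb,
    linearIndepOn_insert_series hj h (by rw [hb]) hbD]

/-- `SeriesRep T D j v w a b` says that `T` is represented by the vectors `(v x, 0)` for `x ∈ D`
(the corresponding element of `T` being `j x`) and by the two further vectors `(w, 1)` and `(0, 1)`,
which label `a` and `b`. Thus `{a, b}` is a series pair, and contracting `b` leaves the vectors `v`
on `D` together with `w`. -/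
structure SeriesRep (T : Matroid γ) (D : Set δ) (j : δ → γ) (v : δ → V) (w : V) (a b : γ) :
    Prop where
  injOn : Set.InjOn j D
  ground : T.E = insert a (insert b (j '' D))
  ne : a ≠ b
  left_notMem : a ∉ j '' D
  right_notMem : b ∉ j '' D
  exists_rep : ∃ u : γ → V × ZMod 2, T.Rep u ∧ (∀ x ∈ D, u (j x) = (v x, 0)) ∧ u a = (w, 1) ∧
    u b = (0, 1)

variable {T : Matroid γ} {T' : Matroid γ'} {D : Set δ} {D' : Set δ'} {j : δ → γ} {j' : δ' → γ'}
  {v : δ → V} {v' : δ' → V'} {w : V} {w' : V'} {a b : γ} {a' b' : γ'}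

/-- The isomorphism type of `T` depends only on the set of vectors and on `w`, up to linear
equivalence. -/
theorem SeriesRep.isIsoTo [Nonempty δ] [Nonempty δ'] (h : SeriesRep T D j v w a b)
    (h' : SeriesRep T' D' j' v' w' a' b')
    (hv : Set.InjOn v D) (hv' : Set.InjOn v' D') (L : V ≃ₗ[ZMod 2] V') (hw : L w = w')
    (hL : L '' (v '' D) = v' '' D') : T.IsIsoTo T' := by
  classical
  obtain ⟨φ, hφ, hφv⟩ := exists_bijOn_of_image_eq hv hv' L.injective hL
  obtain ⟨u, hu, huD, hua, hub⟩ := h.exists_rep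
  obtain ⟨u', hu', huD', hua', hub'⟩ := h'.exists_rep
  let F : γ → γ' := fun z => if z = a then a' else if z = b then b' else
    j' (φ (Function.invFunOn j D z))
  have hFa : F a = a' := by simp [F]
  have hFb : F b = b' := by simp [F, h.ne.symm]
  have hFj : ∀ x ∈ D, F (j x) = j' (φ x) := fun x hx => by
    have h1 : j x ≠ a := fun hc => h.left_notMem ⟨x, hx, hc⟩
    have h2 : j x ≠ b := fun hc => h.right_notMem ⟨x, hx, hc⟩
    simp only [F, h1, h2, if_false]
    rw [h.injOn.leftInvOn_invFunOn hx]
  refine hu.isIsoTo hu' (F := F) ⟨?_, ?_, ?_⟩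
    (L.toLinearMap.prodMap (LinearMap.id : ZMod 2 →ₗ[ZMod 2] ZMod 2)) ?_ ?_
  · intro z hz
    rw [h.ground] at hz
    rw [h'.ground]
    rcases hz with rfl | rfl | ⟨x, hx, rfl⟩
    · exact Or.inl hFa
    · exact Or.inr (Or.inl hFb)
    · exact Or.inr (Or.inr ⟨φ x, hφ.mapsTo hx, (hFj x hx).symm⟩)
  · have e1 : ∀ x ∈ D, F (j x) ≠ a' := fun x hx hc =>
      h'.left_notMem ⟨φ x, hφ.mapsTo hx, by rw [← hFj x hx, hc]⟩
    have e2 : ∀ x ∈ D, F (j x) ≠ b' := fun x hx hc =>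
      h'.right_notMem ⟨φ x, hφ.mapsTo hx, by rw [← hFj x hx, hc]⟩
    intro z hz y hy hzy
    rw [h.ground] at hz hy
    rcases hz with rfl | rfl | ⟨x, hx, rfl⟩ <;> rcases hy with rfl | rfl | ⟨y, hy, rfl⟩
    · rfl
    · rw [hFa, hFb] at hzy
      exact (h'.ne hzy).elim
    · exact (e1 y hy (by rw [← hzy, hFa])).elim
    · rw [hFa, hFb] at hzy
      exact (h'.ne hzy.symm).elim
    · rfl
    · exact (e2 y hy (by rw [← hzy, hFb])).elim
    · exact (e1 x hx (by rw [hzy, hFa])).elim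
    · exact (e2 x hx (by rw [hzy, hFb])).elim
    · rw [hFj x hx, hFj y hy] at hzy
      rw [hφ.injOn hx hy (h'.injOn (hφ.mapsTo hx) (hφ.mapsTo hy) hzy)]
  · intro z hz
    rw [h'.ground] at hz
    rw [h.ground]
    rcases hz with rfl | rfl | ⟨x, hx, rfl⟩
    · exact ⟨a, Or.inl rfl, hFa⟩
    · exact ⟨b, Or.inr (Or.inl rfl), hFb⟩
    · obtain ⟨y, hy, rfl⟩ := hφ.surjOn hx
      exact ⟨j y, Or.inr (Or.inr ⟨y, hy, rfl⟩), hFj y hy⟩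
  · rw [LinearMap.coe_prodMap]
    exact L.injective.prodMap Function.injective_id
  · intro z hz
    rw [h.ground] at hz
    rcases hz with rfl | rfl | ⟨x, hx, rfl⟩
    · rw [hFa, hua, hua']
      simp [hw]
    · rw [hFb, hub, hub']
      simp
    · rw [hFj x hx, huD' _ (hφ.mapsTo hx), huD x hx, hφv x hx]
      simp

theorem SeriesRep.delete_eq_image (h : SeriesRep T D j v w a b) : (T ＼ {a, b}).E = j '' D := by
  rw [delete_ground, h.ground]
  ext z
  simp only [Set.mem_sdiff, Set.mem_insert_iff, Set.mem_singleton_iff, not_or]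
  constructor
  · rintro ⟨hz | hz | hz, h1, h2⟩
    · exact (h1 hz).elim
    · exact (h2 hz).elim
    · exact hz
  · intro hz
    exact ⟨Or.inr (Or.inr hz), fun hc => h.left_notMem (hc ▸ hz),
      fun hc => h.right_notMem (hc ▸ hz)⟩

/-- The deletion of the series pair is a core matroid. -/
theorem SeriesRep.core [T.Finite] (h : SeriesRep T D j v w a b) (hv : Set.InjOn v D)
    (hS : IsCoreSet (v '' D)) : (T ＼ {a, b}).Core := by
  obtain ⟨u, hu, huD, hua, hub⟩ := h.exists_rep
  have hE := h.delete_eq_image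
  have himg : (Prod.fst ∘ u) '' (j '' D) = v '' D := by
    rw [Set.image_image]
    exact Set.image_congr fun x hx => by simp [huD x hx]
  have hrep : (T ＼ {a, b}).Rep (Prod.fst ∘ u) := by
    intro I hI
    rw [hu.delete _ I hI]
    rw [hE] at hI
    obtain ⟨J, hJ, rfl⟩ := Set.subset_image_iff.1 hI
    rw [linearIndepOn_series (h.injOn.mono hJ) fun x hx => huD x (hJ hx),
      linearIndepOn_image_iff (h.injOn.mono hJ)]
    exact linearIndepOn_congr fun x hx => by simp [huD x (hJ hx)]
  refine hrep.core ?_ (by rw [hE, himg]; exact hS)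
  rw [hE]
  rintro _ ⟨x, hx, rfl⟩ _ ⟨y, hy, rfl⟩ hxy
  simp only [Function.comp_apply, huD x hx, huD y hy] at hxy
  rw [hv hx hy hxy]

/-- If `{a, b}` is a series pair and its deletion has no set of corank `1` and nullity `2` and no
set of corank `2` and nullity `1`, then the whole matroid has no set of corank `2` and nullity
`2`. -/
theorem RankGap.of_series [M.Finite] {a b : α} (ha : a ∈ M.E) (hb : b ∈ M.E) (hab : a ≠ b)
    (h12 : (M ＼ {a, b}).RankGap 1 2) (h21 : (M ＼ {a, b}).RankGap 2 1)
    (hacl : a ∉ M.closure (M.E \ {a, b})) (hbcl : b ∉ M.closure (M.E \ {a, b}))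
    (hr : M.rk M.E = M.rk (M.E \ {a, b}) + 1) : M.RankGap 2 2 := by
  intro X hX hle
  have hX₀ : X \ {a, b} ⊆ M.E \ {a, b} := Set.sdiff_subset_sdiff_left hX
  have hfin := finite_of_subset_ground M (hX₀.trans Set.sdiff_subset)
  have hmono := M.closure_subset_closure hX₀
  have h1 := h12 (X \ {a, b}) hX₀
  have h2 := h21 (X \ {a, b}) hX₀
  rw [rk_delete _ hX₀, delete_ground, rk_delete _ subset_rfl] at h1 h2
  have ra := rk_insert_of_notMem_closure ha fun hc => hacl (hmono hc)
  have rb := rk_insert_of_notMem_closure hb fun hc => hbcl (hmono hc)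
  have na : a ∉ X \ {a, b} := fun hc => hc.2 (Or.inl rfl)
  have nb : b ∉ X \ {a, b} := fun hc => hc.2 (Or.inr rfl)
  have ca := Set.ncard_insert_of_notMem na hfin
  have cb := Set.ncard_insert_of_notMem nb hfin
  by_cases haX : a ∈ X <;> by_cases hbX : b ∈ X
  · have hXe : X = insert a (insert b (X \ {a, b})) := by
      ext z
      simp only [Set.mem_insert_iff, Set.mem_sdiff, Set.mem_singleton_iff, not_or]
      by_cases hza : z = a
      · simp [hza, haX]
      · by_cases hzb : z = b <;> simp [hza, hzb, hbX]
    have cab := Set.ncard_insert_of_notMem (a := a) (s := insert b (X \ {a, b}))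
      (fun hc => hc.elim hab na) (hfin.insert b)
    rw [← hXe] at cab
    have hm : M.rk (insert b (X \ {a, b})) ≤ M.rk X :=
      M.rk_mono (Set.insert_subset hbX Set.sdiff_subset)
    omega
  · have hXe : X = insert a (X \ {a, b}) := by
      ext z
      simp only [Set.mem_insert_iff, Set.mem_sdiff, Set.mem_singleton_iff, not_or]
      by_cases hza : z = a
      · simp [hza, haX]
      · by_cases hzb : z = b <;> simp [hza, hzb, hbX]
        exact hzb ▸ hab.symm
    rw [← hXe] at ra ca
    omega
  · have hXe : X = insert b (X \ {a, b}) := by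
      ext z
      simp only [Set.mem_insert_iff, Set.mem_sdiff, Set.mem_singleton_iff, not_or]
      by_cases hzb : z = b
      · simp [hzb, hbX]
      · by_cases hza : z = a <;> simp [hza, hzb, haX]
        exact hza ▸ hab
    rw [← hXe] at rb cb
    omega
  · have hXe : X \ {a, b} = X := by
      rw [sdiff_eq_left, Set.disjoint_insert_right, Set.disjoint_singleton_right]
      exact ⟨haX, hbX⟩
    rw [hXe] at h1 h2
    omega

/-- A matroid obtained from a core matroid by adding a series pair satisfies the conditions of the
classification; the series pair is one side of a `2`-separation. -/
theorem SeriesRep.spec [T.Finite] (h : SeriesRep T D j v w a b) (hv : Set.InjOn v D)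
    (hS : IsCoreSet (v '' D)) : T.IsBinary ∧ T.RankGap 2 2 ∧ ¬ T.IsNConnected 3 := by
  have hcore := h.core hv hS
  have hE : T.E \ {a, b} = j '' D := h.delete_eq_image
  obtain ⟨u, hu, huD, hua, hub⟩ := h.exists_rep
  have haE : a ∈ T.E := by rw [h.ground]; exact Or.inl rfl
  have hbE : b ∈ T.E := by rw [h.ground]; exact Or.inr (Or.inl rfl)
  have hDE : j '' D ⊆ T.E := hE ▸ Set.sdiff_subset
  have hacl : a ∉ T.closure (T.E \ {a, b}) := by
    rw [hE, hu.mem_closure_iff hDE haE, mem_span_series huD, hua]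
    simp
  have hbcl : b ∉ T.closure (T.E \ {a, b}) := by
    rw [hE, hu.mem_closure_iff hDE hbE, mem_span_series huD, hub]
    simp
  have hr : T.rk T.E = T.rk (T.E \ {a, b}) + 1 := by
    have h1 : a ∈ T.closure (insert b (j '' D)) := by
      rw [hu.mem_closure_iff (Set.insert_subset hbE hDE) haE, mem_span_insert_series huD hua hub,
        hS.span_eq_top]
      trivial
    rw [hE] at hbcl ⊢
    conv_lhs => rw [h.ground]
    rw [rk_insert_of_mem_closure h1, rk_insert_of_notMem_closure hbE hbcl]
  refine ⟨hu.isBinary, RankGap.of_series haE hbE h.ne hcore.gap' hcore.gap hacl hbcl hr, ?_⟩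
  have hab : {a, b} ⊆ T.E := Set.insert_subset haE (Set.singleton_subset_iff.2 hbE)
  have h3 := hcore.three_le_rk
  rw [delete_ground, rk_delete _ subset_rfl] at h3
  have h4 := rk_le_ncard (M := T) (X := T.E \ {a, b}) Set.sdiff_subset
  have h5 := rk_le_ncard hab
  rw [Set.ncard_pair h.ne] at h5
  refine not_isNConnected_three_iff.2 ⟨{a, b}, hab, Or.inr ⟨?_, by omega, by omega⟩⟩
  rw [Set.ncard_pair h.ne]

end Series

/-! ### Direct sums and parallel connections -/

section Targets

variable {V : Type*} [AddCommGroup V] [Module (ZMod 2) V]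

theorem rep_unif_one_two : (unif 1 2).Rep fun _ => (1 : ZMod 2) := by
  intro I _
  rw [unif_indep_iff, Set.ncard_le_one_iff]
  constructor
  · intro h
    rcases Set.eq_empty_or_nonempty I with rfl | ⟨x, hx⟩
    · exact linearIndepOn_empty _ _
    · have : I = {x} := Set.eq_singleton_iff_unique_mem.2 ⟨hx, fun y hy => h hy hx⟩
      rw [this, linearIndepOn_singleton_iff]
      exact one_ne_zero
  · intro h x y hx hy
    exact h.injOn hx hy rfl

theorem rep_unif_zero_one : (unif 0 1).Rep fun _ => (0 : ZMod 2) := by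
  intro I _
  rw [unif_indep_iff, Nat.le_zero, Set.ncard_eq_zero]
  constructor
  · rintro rfl
    exact linearIndepOn_empty _ _
  · intro h
    exact Set.eq_empty_of_forall_notMem fun x hx => h.ne_zero hx rfl

/-- In a direct sum with `U_{1,2}`, the two new elements form a series pair with `w = 0`. -/
theorem Rep.seriesRep_sum {N : Matroid β} {v : β → V} (hv : N.Rep v) :
    SeriesRep (N.sum (unif 1 2)) N.E Sum.inl v 0 (Sum.inr 0) (Sum.inr 1) := by
  refine ⟨Sum.inl_injective.injOn, ?_, by simp, by simp, by simp, _, hv.sum rep_unif_one_two,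
    by simp, by simp, by simp⟩
  ext (x | x)
  · simp
  · fin_cases x <;> simp [unif_ground]

theorem zero_mem_closure_unif_iff {I : Set (Fin 3)} (hI : (0 : Fin 3) ∉ I) :
    (0 : Fin 3) ∈ (unif 2 3).closure I ↔ 1 ∈ I ∧ 2 ∈ I := by
  have hsub : I ⊆ {1, 2} := by
    intro x hx
    fin_cases x
    · exact (hI hx).elim
    · simp
    · simp
  have hle : I.ncard ≤ 2 := (Set.ncard_le_ncard hsub).trans (Set.ncard_pair (by decide)).le
  have hind : (unif 2 3).Indep I := unif_indep_iff.2 hle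
  rw [← not_iff_not, hind.notMem_closure_iff_of_notMem hI (Set.mem_univ _), unif_indep_iff,
    Set.ncard_insert_of_notMem hI]
  constructor
  · rintro h ⟨h1, h2⟩
    have : ({1, 2} : Set (Fin 3)).ncard ≤ I.ncard :=
      Set.ncard_le_ncard (Set.insert_subset h1 (Set.singleton_subset_iff.2 h2))
    rw [Set.ncard_pair (by decide)] at this
    omega
  · intro h
    have hss : I ⊂ {1, 2} := hsub.ssubset_of_ne fun hc => h (by simp [hc])
    have := Set.ncard_lt_ncard hss
    rw [Set.ncard_pair (by decide)] at this
    omega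

theorem parallelConnection_ground {N : Matroid β} {N' : Matroid α} [N.Finite] [N'.Finite] (p : β)
    (q : α) : (parallelConnection N N' p q).E = Sum.inl '' N.E ∪ Sum.inr '' (N'.E \ {q}) := rfl

instance parallelConnection_finite {N : Matroid β} {N' : Matroid α} [N.Finite] [N'.Finite] (p : β)
    (q : α) : (parallelConnection N N' p q).Finite :=
  ⟨(N.ground_finite.image _).union ((N'.ground_finite.subset Set.sdiff_subset).image _)⟩

/-- A set that contains both new elements of the triangle is independent if and only if its part in
`N` is independent and does not span the basepoint. -/
theorem parallelConnection_triangle_indep_iff {N : Matroid β} [N.Finite] {p : β}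
    (hp : N.IsNonloop p) {I : Set (β ⊕ Fin 3)} :
    (parallelConnection N (unif 2 3) p 0).Indep I ↔
      I ⊆ Sum.inl '' N.E ∪ Sum.inr '' ((unif 2 3).E \ {0}) ∧ N.Indep (Sum.inl ⁻¹' I) ∧
        ¬ (p ∈ N.closure (Sum.inl ⁻¹' I) ∧ Sum.inr 1 ∈ I ∧ Sum.inr 2 ∈ I) := by
  have h1 : (parallelConnection N (unif 2 3) p 0).Indep I ↔
      I ⊆ Sum.inl '' N.E ∪ Sum.inr '' ((unif 2 3).E \ {0}) ∧
        ∀ K, N.IsParallelCircuit (unif 2 3) p 0 K → ¬ K ⊆ I := by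
    simp [parallelConnection]
  rw [h1]
  refine and_congr_right fun hI => ?_
  have h0 : (0 : Fin 3) ∉ (Sum.inr ⁻¹' I : Set (Fin 3)) := fun h => by simpa using hI h
  have hU : (unif 2 3).Indep (Sum.inr ⁻¹' I) := by
    rw [unif_indep_iff]
    refine (Set.ncard_le_ncard (t := {1, 2}) fun x hx => ?_).trans (Set.ncard_pair (by decide)).le
    fin_cases x
    · exact (h0 hx).elim
    · simp
    · simp
  have he := sum_mem_closure_iff N (unif 2 3) (N.sum (unif 2 3)).empty_indep
  rw [forall_not_parallelCircuit_iff N (unif 2 3) p 0 hI, sum_indep_iff, and_iff_left hU]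
  refine and_congr_right fun hN => ?_
  have hc := sum_mem_closure_iff N (unif 2 3) ((sum_indep_iff N (unif 2 3)).2 ⟨hN, hU⟩)
  rw [Set.insert_subset_iff, Set.singleton_subset_iff, Set.insert_subset_iff,
    Set.singleton_subset_iff, hc.1, hc.2, he.1, zero_mem_closure_unif_iff h0]
  have hpl : p ∉ N.closure ∅ := hp.not_isLoop
  simp [hpl]

/-- In `P(N, U_{2,3})`, the triangle at `p` adds the vectors `(v p, 1)` and `(0, 1)`. -/
theorem Rep.seriesRep_parallelConnection {N : Matroid β} [N.Finite] {v : β → V} (hv : N.Rep v)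
    {p : β} (hp : p ∈ N.E) (hp0 : v p ≠ 0) :
    SeriesRep (parallelConnection N (unif 2 3) p 0) N.E Sum.inl v (v p) (Sum.inr 1)
      (Sum.inr 2) := by
  classical
  have hnl : N.IsNonloop p := by
    rw [← indep_singleton, hv _ (Set.singleton_subset_iff.2 hp), linearIndepOn_singleton_iff]
    exact hp0
  refine ⟨Sum.inl_injective.injOn, ?_, by simp, by simp, by simp,
    Sum.elim (fun x => (v x, 0)) (fun i => if i = 1 then (v p, 1) else (0, 1)), ?_, by simp,
    by simp, by simp⟩
  · rw [parallelConnection_ground]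
    ext (x | x)
    · simp
    · fin_cases x <;> simp [unif_ground]
  intro I hI
  rw [parallelConnection_ground] at hI
  rw [parallelConnection_triangle_indep_iff hnl, and_iff_right hI]
  set u : β ⊕ Fin 3 → V × ZMod 2 :=
    Sum.elim (fun x => (v x, 0)) (fun i => if i = 1 then (v p, 1) else (0, 1))
  have hI1 : Sum.inl ⁻¹' I ⊆ N.E := fun x hx => by simpa using hI hx
  have h0 : Sum.inr 0 ∉ I := fun h => by simpa using hI h
  rw [hv _ hI1, hv.mem_closure_iff hI1 hp]
  have hj : Set.InjOn (Sum.inl : β → β ⊕ Fin 3) (Sum.inl ⁻¹' I) := Sum.inl_injective.injOn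
  have hu : ∀ x ∈ (Sum.inl ⁻¹' I : Set β), u (Sum.inl x) = (v x, 0) := fun x _ => rfl
  have hu1 : u (Sum.inr 1) = (v p, 1) := by simp [u]
  have hu2 : u (Sum.inr 2) = (0, 1) := by simp [u]
  have hn1 : ∀ A : Set β, (Sum.inr 1 : β ⊕ Fin 3) ∉ Sum.inl '' A := by simp
  have hn2 : ∀ A : Set β, (Sum.inr 2 : β ⊕ Fin 3) ∉ Sum.inl '' A := by simp
  by_cases h1 : Sum.inr 1 ∈ I <;> by_cases h2 : Sum.inr 2 ∈ I
  · have hIe : I = insert (Sum.inr 1) (insert (Sum.inr 2) (Sum.inl '' (Sum.inl ⁻¹' I))) := by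
      ext (x | x)
      · simp
      · fin_cases x <;> simp [h0, h1, h2]
    conv_rhs => rw [hIe]
    rw [linearIndepOn_insert_insert_series hj hu hu1 hu2 (hn1 _) (hn2 _) (by simp)]
    simp [h1, h2]
  · have hIe : I = insert (Sum.inr 1) (Sum.inl '' (Sum.inl ⁻¹' I)) := by
      ext (x | x)
      · simp
      · fin_cases x <;> simp [h0, h1, h2]
    conv_rhs => rw [hIe]
    rw [linearIndepOn_insert_series hj hu (by rw [hu1]) (hn1 _)]
    simp [h2]
  · have hIe : I = insert (Sum.inr 2) (Sum.inl '' (Sum.inl ⁻¹' I)) := by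
      ext (x | x)
      · simp
      · fin_cases x <;> simp [h0, h1, h2]
    conv_rhs => rw [hIe]
    rw [linearIndepOn_insert_series hj hu (by rw [hu2]) (hn2 _)]
    simp [h1]
  · have hIe : I = Sum.inl '' (Sum.inl ⁻¹' I) := by
      ext (x | x)
      · simp
      · fin_cases x <;> simp [h0, h1, h2]
    conv_rhs => rw [hIe]
    rw [linearIndepOn_series hj hu]
    simp [h1]

theorem Rep.seriesRep_parallelConnection_delete {N : Matroid β} [N.Finite] {v : β → V}
    (hv : N.Rep v) {p : β} (hp : p ∈ N.E) (hp0 : v p ≠ 0) :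
    SeriesRep (parallelConnection N (unif 2 3) p 0 ＼ {Sum.inl p}) (N.E \ {p}) Sum.inl v (v p)
      (Sum.inr 1) (Sum.inr 2) := by
  have h := hv.seriesRep_parallelConnection hp hp0
  obtain ⟨u, hu, huD, hua, hub⟩ := h.exists_rep
  refine ⟨Sum.inl_injective.injOn, ?_, by simp, by simp, by simp, u, hu.delete _,
    fun x hx => huD x hx.1, hua, hub⟩
  rw [delete_ground, h.ground]
  ext (x | x)
  · simp
  · fin_cases x <;> simp

end Targets

/-! ### Cycle matroids over `GF(2)` -/

section Cycle

variable {V : Type u} [DecidableEq V]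

/-- The column of an edge in the vertex-edge incidence matrix over `GF(2)`. Loops of `Sym2 V` are
sent to `0`. -/
def incidenceVector (e : Sym2 V) : V → ZMod 2 :=
  Sym2.lift ⟨fun x y => Pi.single x 1 + Pi.single y 1, fun _ _ => add_comm _ _⟩ e

theorem incidenceVector_mk (x y : V) :
    incidenceVector s(x, y) = Pi.single x 1 + Pi.single y 1 := rfl

/-- The sum of two vertices lies in the span of a set of edges if and only if the edges connect the
vertices. -/
theorem incidenceVector_mem_span_iff [Finite V] {J : Set (Sym2 V)} {x y : V} :
    incidenceVector s(x, y) ∈ Submodule.span (ZMod 2) (incidenceVector '' J) ↔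
      (SimpleGraph.fromEdgeSet J).Reachable x y := by
  classical
  have := Fintype.ofFinite V
  constructor
  · intro h
    by_contra hn
    -- Summing over the component of `x` kills all edges of `J`, but not the edge `s(x, y)`.
    let φ : (V → ZMod 2) →ₗ[ZMod 2] ZMod 2 :=
      ∑ z ∈ Finset.univ.filter fun z => (SimpleGraph.fromEdgeSet J).Reachable x z, LinearMap.proj z
    have hφ : ∀ z, φ (Pi.single z 1) =
        if (SimpleGraph.fromEdgeSet J).Reachable x z then 1 else 0 := by
      intro z
      simp [φ, LinearMap.sum_apply, Pi.single_apply, Finset.sum_ite_eq']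
    have hker : Submodule.span (ZMod 2) (incidenceVector '' J) ≤ LinearMap.ker φ := by
      rw [Submodule.span_le]
      rintro _ ⟨e, he, rfl⟩
      induction e with
      | _ a b =>
        rw [SetLike.mem_coe, LinearMap.mem_ker, incidenceVector_mk, map_add, hφ, hφ]
        by_cases hab : a = b
        · rw [hab]
          exact zmod_two_add_self _
        have hadj : (SimpleGraph.fromEdgeSet J).Adj a b :=
          (SimpleGraph.fromEdgeSet_adj J).2 ⟨he, hab⟩
        have hiff : (SimpleGraph.fromEdgeSet J).Reachable x a ↔
            (SimpleGraph.fromEdgeSet J).Reachable x b :=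
          ⟨fun h => h.trans hadj.reachable, fun h => h.trans hadj.symm.reachable⟩
        simp only [hiff]
        exact zmod_two_add_self _
    have h1 := LinearMap.mem_ker.1 (hker h)
    rw [incidenceVector_mk, map_add, hφ, hφ, if_pos (SimpleGraph.Reachable.refl x), if_neg hn] at h1
    simp at h1
  · rintro ⟨p⟩
    induction p with
    | nil =>
      rw [incidenceVector_mk, zmod_two_add_self]
      exact zero_mem _
    | @cons a b c hab _ ih =>
      have h1 : incidenceVector s(a, b) ∈ Submodule.span (ZMod 2) (incidenceVector '' J) :=
        Submodule.subset_span ⟨_, ((SimpleGraph.fromEdgeSet_adj J).1 hab).1, rfl⟩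
      have h2 := add_mem h1 ih
      rw [incidenceVector_mk, incidenceVector_mk, add_assoc, ← add_assoc (Pi.single b 1),
        zmod_two_add_self, zero_add] at h2
      exact h2

/-- Both acyclicity and linear independence say that no edge is spanned by the others. -/
theorem rep_cycleMatroid [Finite V] (G : SimpleGraph V) :
    (cycleMatroid G).Rep incidenceVector := by
  intro I hI
  have hIG : I ⊆ G.edgeSet := hI
  have h1 : (cycleMatroid G).Indep I ↔ I ⊆ G.edgeSet ∧ (SimpleGraph.fromEdgeSet I).IsAcyclic := by
    simp [cycleMatroid]
  rw [h1, and_iff_right hIG, SimpleGraph.isAcyclic_iff_forall_isBridge,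
    linearIndepOn_iff_notMem_span]
  have hE : (SimpleGraph.fromEdgeSet I).edgeSet = I := by
    rw [SimpleGraph.edgeSet_fromEdgeSet]
    exact sdiff_eq_left.2 (Set.disjoint_left.2 fun e he hd =>
      G.not_isDiag_of_mem_edgeSet (hIG he) hd)
  rw [hE]
  refine forall₂_congr fun e he => ?_
  induction e with
  | _ x y =>
    rw [SimpleGraph.isBridge_iff, incidenceVector_mem_span_iff, SimpleGraph.deleteEdges,
      ← SimpleGraph.fromEdgeSet_sdiff]

end Cycle

/-! ### Representations of the named matroids -/

section Named

theorem rep_vectorMatroid {m : Type*} (A : Matrix m α (ZMod 2)) : (vectorMatroid A).Rep A.col := by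
  intro I _
  simp [vectorMatroid]

theorem rep_binaryPG (n : ℕ) : (binaryPG n).Rep id := fun I hI => by
  rw [binaryPG, restrict_indep_iff]
  exact (and_iff_left hI).trans (rep_vectorMatroid _ I (Set.subset_univ _))

instance binaryPG_finite (n : ℕ) : (binaryPG n).Finite := ⟨Set.toFinite _⟩

instance binaryAG_finite (n : ℕ) : (binaryAG n).Finite := ⟨Set.toFinite _⟩

instance fano_finite : fano.Finite := ⟨Set.toFinite _⟩

instance wheel3_finite : wheel3.Finite := ⟨Set.toFinite _⟩

instance spike_finite (r : ℕ) : (spike r).Finite := ⟨Set.toFinite _⟩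

theorem rep_binaryAG (n : ℕ) : (binaryAG n).Rep id := (rep_binaryPG n).delete _

theorem binaryAG_ground (n : ℕ) :
    (binaryAG n).E = {x | (LinearMap.proj 0 : (Fin (n + 1) → ZMod 2) →ₗ[ZMod 2] ZMod 2) x = 1} := by
  have h2 : ∀ a : ZMod 2, a ≠ 0 ↔ a = 1 := by decide
  ext x
  constructor
  · rintro ⟨-, hx⟩
    exact (h2 _).1 hx
  · intro hx
    refine ⟨?_, (h2 _).2 hx⟩
    rintro rfl
    exact zero_ne_one hx

/-- Coordinates for the edges of the wheel with three spokes, obtained from the incidence vectors by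
dropping the hub: the spokes become the unit vectors. -/
def wheelVector (e : Sym2 (Option (Fin 3))) : Fin 3 → ZMod 2 := fun i => incidenceVector e (some i)

theorem rep_wheel3 : wheel3.Rep wheelVector := by
  let L : (Fin 3 → ZMod 2) →ₗ[ZMod 2] (Option (Fin 3) → ZMod 2) :=
    LinearMap.pi fun o => Option.elim o (∑ i, LinearMap.proj i) fun i => LinearMap.proj i
  have hL : Function.Injective L := fun x y h => funext fun i => congrFun h (some i)
  refine Rep.of_comp L hL ?_
  have hLe : L ∘ wheelVector = incidenceVector := by
    have h2 : ∀ a b : Option (Fin 3), ∑ i, incidenceVector s(a, b) (some i) =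
        incidenceVector s(a, b) none := by decide
    funext e
    induction e with
    | _ a b =>
      funext o
      cases o with
      | none => simpa [L, wheelVector] using h2 a b
      | some i => rfl
  rw [hLe]
  exact rep_cycleMatroid _

theorem wheelGraph_three_adj (a b : Option (Fin 3)) : (wheelGraph 3).Adj a b ↔ a ≠ b := by
  have h : ∀ i j : Fin 3, (SimpleGraph.cycleGraph 3).Adj i j ↔ i ≠ j := by decide
  rcases a with _ | i <;> rcases b with _ | j <;> simp [wheelGraph, h]

theorem mem_wheel3_ground (a b : Option (Fin 3)) : s(a, b) ∈ wheel3.E ↔ a ≠ b :=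
  wheelGraph_three_adj a b

theorem injOn_wheelVector : Set.InjOn wheelVector wheel3.E := by
  have h : ∀ a b c d : Option (Fin 3), a ≠ b → c ≠ d →
      (∀ i, wheelVector s(a, b) i = wheelVector s(c, d) i) → s(a, b) = s(c, d) := by decide
  intro e he f hf hef
  induction e with
  | _ a b =>
    induction f with
    | _ c d =>
      rw [mem_wheel3_ground] at he hf
      exact h a b c d he hf fun i => congrFun hef i

theorem image_wheelVector : wheelVector '' wheel3.E = {x | x ≠ 0} \ {1} := by
  have h1 : ∀ a b : Option (Fin 3), a ≠ b → wheelVector s(a, b) ≠ 0 ∧ wheelVector s(a, b) ≠ 1 := by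
    decide
  have h2 : ∀ x : Fin 3 → ZMod 2, x ≠ 0 → x ≠ 1 →
      ∃ a b : Option (Fin 3), a ≠ b ∧ wheelVector s(a, b) = x := by decide
  ext x
  constructor
  · rintro ⟨e, he, rfl⟩
    induction e with
    | _ a b => exact h1 a b ((mem_wheel3_ground a b).1 he)
  · rintro ⟨hx, hx1⟩
    obtain ⟨a, b, hab, rfl⟩ := h2 x hx hx1
    exact ⟨_, (mem_wheel3_ground a b).2 hab, rfl⟩

/-- The columns of the matrix of the rank-`4` spike: the unit vectors, their complements, and the
all-ones vector of the tip. -/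
def spikeVector (e : Fin 4 ⊕ (Fin 4 ⊕ Unit)) : Fin 4 → ZMod 2 :=
  Sum.elim (fun j => Pi.single j 1) (Sum.elim (fun j => 1 - Pi.single j 1) fun _ => 1) e

theorem rep_spike : (spike 4).Rep spikeVector := by
  refine (rep_vectorMatroid _).congr fun e _ => funext fun i => ?_
  clear * -
  revert e i
  decide

theorem spike_ground (r : ℕ) : (spike r).E = Set.univ := rfl

theorem spikeVector_injective : Function.Injective spikeVector := by
  have h : ∀ e f, (∀ i, spikeVector e i = spikeVector f i) → e = f := by decide
  exact fun e f hef => h e f fun i => congrFun hef i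

/-- The sum of the coordinates of a vector in `GF(2)^4`. It is `1` on all elements of the rank-`4`
spike other than the tip, and `0` on the tip. -/
def coordSum : Module.Dual (ZMod 2) (Fin 4 → ZMod 2) := ∑ i, LinearMap.proj i

theorem coordSum_apply (x : Fin 4 → ZMod 2) : coordSum x = ∑ i, x i := by
  simp [coordSum, LinearMap.sum_apply]

theorem image_spikeVector :
    spikeVector '' ((spike 4).E \ {spikeTip 4}) = {x | coordSum x = 1} := by
  have h1 : ∀ e, e ≠ spikeTip 4 → ∑ i, spikeVector e i = 1 := by unfold spikeTip; decide
  have h2 : ∀ x : Fin 4 → ZMod 2, ∑ i, x i = 1 → ∃ e, e ≠ spikeTip 4 ∧ spikeVector e = x := by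
    unfold spikeTip; decide
  ext x
  rw [spike_ground]
  constructor
  · rintro ⟨e, he, rfl⟩
    exact (coordSum_apply _).trans (h1 e he.2)
  · intro hx
    obtain ⟨e, he, rfl⟩ := h2 x ((coordSum_apply x).symm.trans hx)
    exact ⟨e, ⟨trivial, he⟩, rfl⟩

theorem image_spikeVector_S8 : spikeVector '' (S8.E \ {spikeTip 4}) =
    {x | coordSum x = 1} \ {spikeVector (Sum.inr (Sum.inl 3))} := by
  rw [← image_spikeVector, ← Set.image_singleton, ← Set.image_sdiff spikeVector_injective]
  congr 1
  ext e
  simp [S8, spike_ground, and_comm]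

end Named

/-! ### Identifying the matroids with their models -/

section Realizes

variable {V W : Type*} [AddCommGroup V] [Module (ZMod 2) V] [AddCommGroup W] [Module (ZMod 2) W]

/-- `N` is the matroid of linear independence on the set `S` of vectors, up to the labelling of the
elements. -/
def Realizes (N : Matroid β) (S : Set V) : Prop :=
  ∃ v : β → V, N.Rep v ∧ Set.InjOn v N.E ∧ v '' N.E = S

theorem Rep.realizes {v : β → W} (hv : N.Rep v) (hinj : Set.InjOn v N.E) (L : W ≃ₗ[ZMod 2] V)
    {S : Set V} (h : L '' (v '' N.E) = S) : N.Realizes S :=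
  ⟨L ∘ v, hv.comp L.toLinearMap L.injective, L.injective.comp_injOn hinj, by
    rw [Set.image_comp, h]⟩

theorem fano_realizes (hd : Module.finrank (ZMod 2) V = 3) :
    fano.Realizes {x : V | x ≠ 0} := by
  have : FiniteDimensional (ZMod 2) V := Module.finite_of_finrank_pos (by omega)
  refine (rep_binaryPG 2).realizes Function.injective_id.injOn
    (LinearEquiv.ofFinrankEq (Fin 3 → ZMod 2) V (by simp [hd])) ?_
  rw [Set.image_id]
  exact image_ne_zero _

theorem wheel3_realizes (hd : Module.finrank (ZMod 2) V = 3) {u : V} (hu : u ≠ 0) :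
    wheel3.Realizes ({x : V | x ≠ 0} \ {u}) := by
  have : FiniteDimensional (ZMod 2) V := Module.finite_of_finrank_pos (by omega)
  obtain ⟨L, hL⟩ := exists_linearEquiv_apply_eq (V := Fin 3 → ZMod 2) (W := V) (by simp [hd])
    one_ne_zero hu
  refine rep_wheel3.realizes injOn_wheelVector L ?_
  rw [image_wheelVector, image_diff_singleton, image_ne_zero, hL]

theorem exists_linearEquiv_functional_eq [FiniteDimensional (ZMod 2) V]
    [FiniteDimensional (ZMod 2) W]
    (hd : Module.finrank (ZMod 2) V = Module.finrank (ZMod 2) W)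
    (h2 : 2 ≤ Module.finrank (ZMod 2) V) {h : Module.Dual (ZMod 2) V} {h' : Module.Dual (ZMod 2) W}
    {m : V} {m' : W} (hm : h m = 1) (hm' : h' m' = 1) :
    ∃ L : V ≃ₗ[ZMod 2] W, L m = m' ∧ ∀ x, h' (L x) = h x := by
  obtain ⟨w, hw0, hw⟩ := exists_ne_zero_functional_eq_zero h2 h
  obtain ⟨w', hw0', hw'⟩ := exists_ne_zero_functional_eq_zero (hd ▸ h2) h'
  obtain ⟨L, h1, -, h3⟩ := exists_linearEquiv_functional hd hm hm' hw hw' hw0 hw0'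
  exact ⟨L, h1, h3⟩

theorem binaryAG_realizes (hd : Module.finrank (ZMod 2) V = 4) {h : Module.Dual (ZMod 2) V}
    (hh : h ≠ 0) : (binaryAG 3).Realizes {x | h x = 1} := by
  have : FiniteDimensional (ZMod 2) V := Module.finite_of_finrank_pos (by omega)
  obtain ⟨m, hm⟩ := exists_functional_eq_one hh
  obtain ⟨L, -, hL⟩ := exists_linearEquiv_functional_eq (V := Fin 4 → ZMod 2) (W := V)
    (h := LinearMap.proj 0) (m := 1) (by simp [hd]) (by simp) (by simp) hm
  refine (rep_binaryAG 3).realizes Function.injective_id.injOn L ?_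
  rw [Set.image_id, binaryAG_ground]
  exact image_functional_eq_one L hL

theorem fano_core : fano.Core :=
  (rep_binaryPG 2).core Function.injective_id.injOn
    (Or.inl ⟨by simp, Or.inl (Set.image_id _)⟩)

/-- By duality `F₇✶` is a core matroid, and as it has rank `4` and `7` elements, its vectors are
those off a hyperplane with one omitted. -/
theorem fano_dual_realizes (hd : Module.finrank (ZMod 2) V = 4) {h : Module.Dual (ZMod 2) V}
    {m : V} (hm : h m = 1) : fano✶.Realizes ({x | h x = 1} \ {m}) := by
  have : FiniteDimensional (ZMod 2) V := Module.finite_of_finrank_pos (by omega)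
  have hc7 : fano.E.ncard = 7 := by
    have h1 := Set.ncard_add_ncard_compl ({0} : Set (Fin 3 → ZMod 2))
    rw [Set.ncard_singleton] at h1
    have h2 : Nat.card (Fin 3 → ZMod 2) = 8 := by simp
    have h3 : fano.E = ({0} : Set (Fin 3 → ZMod 2))ᶜ := rfl
    rw [h3]
    omega
  have hr3 : fano.rk fano.E = 3 := by
    have h1 := Rep.finrank_span (M := fano) (rep_binaryPG 2) (X := fano.E) subset_rfl
    have h2 : IsCoreSet (id '' fano.E) := Or.inl ⟨by simp, Or.inl (Set.image_id _)⟩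
    rw [h2.span_eq_top, finrank_top] at h1
    rw [← h1]
    simp
  have hr4 : fano✶.rk fano✶.E = 4 := by
    have := fano.rk_add_rk_dual
    rw [dual_ground]
    omega
  obtain ⟨n, v, hv⟩ := isBinary_iff_exists_rep.1 fano_core.dual.isBinary
  obtain ⟨v', hv', -, hs⟩ := hv.exists_span_eq_top
  obtain ⟨hinj, hS⟩ := fano_core.dual.isCoreSet hv' hs
  have hd' := hv'.finrank_span subset_rfl
  rw [hs, finrank_top, hr4] at hd'
  have hcard : (v' '' fano✶.E).ncard = 7 := by rw [hinj.ncard_image, dual_ground, hc7]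
  rcases hS with ⟨h3, -⟩ | ⟨-, h', hh', hS⟩
  · omega
  have hfin : Finite (Submodule.span (ZMod 2) (v '' fano✶.E)) := Module.finite_of_finite (ZMod 2)
  rcases hS with hS | ⟨m', hm', hS⟩
  · have h8 := ncard_functional_eq_one hh'
    rw [← hS, hcard, Module.natCard_eq_pow_finrank (K := ZMod 2), hd'] at h8
    simp at h8
  obtain ⟨L, hLm, hL⟩ := exists_linearEquiv_functional_eq (W := V) (by rw [hd', hd]) (by omega)
    hm' hm
  refine hv'.realizes hinj L ?_
  rw [hS, image_diff_singleton, image_functional_eq_one L hL, hLm]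

/-- The four kinds of core sets are the sets of vectors of `F₇`, `M(W₃)`, `AG(3, 2)` and `F₇✶`. -/
theorem IsCoreSet.realizes {S : Set V} (hS : IsCoreSet S) :
    wheel3.Realizes S ∨ fano.Realizes S ∨ fano✶.Realizes S ∨ (binaryAG 3).Realizes S := by
  rcases hS with ⟨hd, rfl | ⟨u, hu, rfl⟩⟩ | ⟨hd, h, hh, rfl | ⟨m, hm, rfl⟩⟩
  · exact Or.inr (Or.inl (fano_realizes hd))
  · exact Or.inl (wheel3_realizes hd hu)
  · exact Or.inr (Or.inr (Or.inr (binaryAG_realizes hd hh)))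
  · exact Or.inr (Or.inr (Or.inl (fano_dual_realizes hd hm)))

theorem Realizes.core [N.Finite] {S : Set V} (h : N.Realizes S) (hS : IsCoreSet S) : N.Core := by
  obtain ⟨v, hv, hinj, rfl⟩ := h
  exact hv.core hinj hS

theorem wheel3_core : wheel3.Core :=
  (wheel3_realizes (V := Fin 3 → ZMod 2) (by simp) one_ne_zero).core
    (Or.inl ⟨by simp, Or.inr ⟨1, one_ne_zero, rfl⟩⟩)

theorem binaryAG_core : (binaryAG 3).Core := by
  refine (rep_binaryAG 3).core Function.injective_id.injOn
    (Or.inr ⟨by simp, LinearMap.proj 0, ?_, Or.inl ?_⟩)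
  · intro hc
    exact one_ne_zero (LinearMap.congr_fun hc (1 : Fin 4 → ZMod 2))
  · rw [Set.image_id, binaryAG_ground]

end Realizes

/-! ### Series extensions of the core matroids -/

section SeriesExtensions

variable {γ δ V : Type*} [AddCommGroup V] [Module (ZMod 2) V] {T : Matroid γ} {D : Set δ}
  {j : δ → γ} {v : δ → V} {w : V} {a b : γ}

theorem IsCoreSet.nonempty {S : Set V} (hS : IsCoreSet S) : S.Nonempty := by
  rw [Set.nonempty_iff_ne_empty]
  rintro rfl
  have h1 := hS.span_eq_top
  rw [Submodule.span_empty] at h1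
  have h2 : Module.finrank (ZMod 2) V = 0 := by rw [← finrank_top, ← h1, finrank_bot]
  rcases hS with h | h <;> omega

theorem SeriesRep.isIsoTo_of_image_eq (h : SeriesRep T D j v w a b) (hv : Set.InjOn v D)
    (hS : IsCoreSet (v '' D)) {γ' δ' : Type*} {T' : Matroid γ'} {D' : Set δ'} {j' : δ' → γ'}
    {v' : δ' → V} {a' b' : γ'} (h' : SeriesRep T' D' j' v' w a' b') (hv' : Set.InjOn v' D')
    (him : v' '' D' = v '' D) : T.IsIsoTo T' := by
  have h1 : Nonempty δ := hS.nonempty.of_image.to_type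
  have h2 : Nonempty δ' := (him ▸ hS.nonempty).of_image.to_type
  exact h.isIsoTo h' hv hv' (LinearEquiv.refl _ _) rfl (by rw [him]; exact Set.image_id _)

theorem SeriesRep.isIsoTo_sum (h : SeriesRep T D j v 0 a b) (hv : Set.InjOn v D)
    (hS : IsCoreSet (v '' D)) (hN : N.Realizes (v '' D)) : T.IsIsoTo (N.sum (unif 1 2)) := by
  obtain ⟨v', hv', hinj, him⟩ := hN
  exact h.isIsoTo_of_image_eq hv hS hv'.seriesRep_sum hinj him

theorem SeriesRep.isParallelTriangle [N.Finite] (h : SeriesRep T D j v w a b)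
    (hv : Set.InjOn v D) (hS : IsCoreSet (v '' D)) (hw : w ∈ v '' D) (hw0 : w ≠ 0)
    (hN : N.Realizes (v '' D)) : T.IsParallelTriangle N := by
  obtain ⟨v', hv', hinj, him⟩ := hN
  rw [← him] at hw
  obtain ⟨p, hp, rfl⟩ := hw
  exact ⟨p, hp, h.isIsoTo_of_image_eq hv hS (hv'.seriesRep_parallelConnection hp hw0) hinj him⟩

theorem SeriesRep.isParallelTriangleDelete [N.Finite] (h : SeriesRep T D j v w a b)
    (hv : Set.InjOn v D) (hS : IsCoreSet (v '' D)) (hw0 : w ≠ 0) {v' : β → V} {p : β}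
    (hv' : N.Rep v') (hp : p ∈ N.E) (hpw : v' p = w) (hinj : Set.InjOn v' N.E)
    (him : v' '' (N.E \ {p}) = v '' D) : T.IsParallelTriangleDelete N p := by
  subst hpw
  exact h.isIsoTo_of_image_eq hv hS (hv'.seriesRep_parallelConnection_delete hp hw0)
    (hinj.mono Set.sdiff_subset) him

/-- A version of `SeriesRep.isParallelTriangleDelete` for the deletion of one vector from the set
of all vectors of `N`. -/
theorem SeriesRep.exists_isParallelTriangleDelete [N.Finite] (h : SeriesRep T D j v w a b)
    (hv : Set.InjOn v D) (hS : IsCoreSet (v '' D)) (hw0 : w ≠ 0) {S : Set V} (hN : N.Realizes S)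
    (hw : w ∈ S) (hSD : v '' D = S \ {w}) : ∃ p ∈ N.E, T.IsParallelTriangleDelete N p := by
  obtain ⟨v', hv', hinj, rfl⟩ := hN
  obtain ⟨p, hp, rfl⟩ := hw
  refine ⟨p, hp, h.isParallelTriangleDelete hv hS hw0 hv' hp rfl hinj ?_⟩
  rw [hSD, hinj.image_sdiff_subset (Set.singleton_subset_iff.2 hp), Set.image_singleton]

/-- A core matroid with a series pair added is determined by the core set `S` and the vector `w`.
For `w = 0` it is a direct sum with `U_{1,2}`, and for `w ∈ S` a parallel connection with a
triangle. A nonzero vector `w` outside `S` is either an omitted vector, in which case adding it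
gives `F₇` or `AG(3, 2)`, or a nonzero vector of the hyperplane that `S` avoids, in which case
adding it gives `Z₄` or `S₈` with tip `w`; the basepoint of the parallel connection is then deleted.
-/
theorem SeriesRep.inBinaryList (h : SeriesRep T D j v w a b) (hv : Set.InjOn v D)
    (hS : IsCoreSet (v '' D)) : T.InBinaryList := by
  have hreal := hS.realizes
  by_cases hw0 : w = 0
  · subst hw0
    refine Or.inr (Or.inr (Or.inr (Or.inr (Or.inl ?_))))
    exact hreal.imp (h.isIsoTo_sum hv hS) (Or.imp (h.isIsoTo_sum hv hS)
      (Or.imp (h.isIsoTo_sum hv hS) (h.isIsoTo_sum hv hS)))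
  by_cases hwD : w ∈ v '' D
  · refine Or.inr (Or.inr (Or.inr (Or.inr (Or.inr (Or.inr (Or.inr ?_))))))
    exact hreal.imp (h.isParallelTriangle hv hS hwD hw0)
      (Or.imp (h.isParallelTriangle hv hS hwD hw0)
      (Or.imp (h.isParallelTriangle hv hS hwD hw0) (h.isParallelTriangle hv hS hwD hw0)))
  have h2 : ∀ a : ZMod 2, a ≠ 1 → a = 0 := by decide
  have htip : coordSum (spikeVector (spikeTip 4)) = 0 := by rw [coordSum_apply]; decide
  have htip0 : spikeVector (spikeTip 4) ≠ 0 := fun hc =>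
    absurd (congrFun hc 0) (by decide)
  have hm0 : coordSum (spikeVector (Sum.inr (Sum.inl 3))) = 1 := by rw [coordSum_apply]; decide
  rcases id hS with ⟨hd, hE | ⟨u, hu, hE⟩⟩ | ⟨hd, f, hf, hE | ⟨m, hm, hE⟩⟩
  · exact (hwD (by rw [hE]; exact hw0)).elim
  · have hwu : w = u := by
      by_contra hne
      exact hwD (by rw [hE]; exact ⟨hw0, hne⟩)
    subst hwu
    exact Or.inr (Or.inr (Or.inr (Or.inr (Or.inr (Or.inr (Or.inl (Or.inl
      (h.exists_isParallelTriangleDelete hv hS hw0 (fano_realizes hd) hw0 hE))))))))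
  · have : FiniteDimensional (ZMod 2) V := Module.finite_of_finrank_pos (by omega)
    have hfw : f w = 0 := h2 _ fun hc => hwD (by rw [hE]; exact hc)
    obtain ⟨m, hm⟩ := exists_functional_eq_one hf
    obtain ⟨L, -, hLw, hL⟩ := exists_linearEquiv_functional (by simp [hd]) hm0 hm htip hfw htip0 hw0
    refine Or.inr (Or.inr (Or.inr (Or.inr (Or.inr (Or.inl (Or.inl ?_))))))
    refine h.isParallelTriangleDelete hv hS hw0 (rep_spike.comp L.toLinearMap L.injective)
      (Set.mem_univ _) hLw (L.injective.comp spikeVector_injective).injOn ?_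
    rw [hE, LinearEquiv.coe_toLinearMap, Set.image_comp, image_spikeVector,
      image_functional_eq_one L hL]
  · have : FiniteDimensional (ZMod 2) V := Module.finite_of_finrank_pos (by omega)
    by_cases hwm : w = m
    · subst hwm
      exact Or.inr (Or.inr (Or.inr (Or.inr (Or.inr (Or.inr (Or.inl (Or.inr
        (h.exists_isParallelTriangleDelete hv hS hw0 (binaryAG_realizes hd hf) hm hE))))))))
    · have hfw : f w = 0 := h2 _ fun hc => hwD (by rw [hE]; exact ⟨hc, hwm⟩)
      obtain ⟨L, hLm, hLw, hL⟩ := exists_linearEquiv_functional (by simp [hd]) hm0 hm htip hfw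
        htip0 hw0
      refine Or.inr (Or.inr (Or.inr (Or.inr (Or.inr (Or.inl (Or.inr ?_))))))
      refine h.isParallelTriangleDelete hv hS hw0
        ((rep_spike.delete _).comp L.toLinearMap L.injective) ?_ hLw
        (L.injective.comp spikeVector_injective).injOn ?_
      · exact ⟨Set.mem_univ _, by simp [spikeTip]⟩
      · rw [hE, LinearEquiv.coe_toLinearMap, Set.image_comp]
        change L '' (spikeVector '' (S8.E \ {spikeTip 4})) = _
        rw [image_spikeVector_S8, image_diff_singleton, image_functional_eq_one L hL, hLm]

end SeriesExtensions

/-! ### Matroids with a loop -/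

section Loop

theorem IsLoop.rk_insert {e : α} (he : M.IsLoop e) (X : Set α) : M.rk (insert e X) = M.rk X :=
  rk_insert_of_mem_closure (he.mem_closure X)

theorem IsLoop.rk_ground_diff {e : α} (he : M.IsLoop e) : M.rk (M.E \ {e}) = M.rk M.E := by
  rw [← he.rk_insert, Set.insert_sdiff_singleton, Set.insert_eq_of_mem he.mem_ground]

theorem IsLoop.rk_delete_ground {e : α} (he : M.IsLoop e) :
    (M ＼ {e}).rk (M ＼ {e}).E = M.rk M.E := by
  rw [delete_ground, rk_delete _ subset_rfl, he.rk_ground_diff]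

/-- A loop raises the nullity of a set by one and keeps its corank. -/
theorem IsLoop.rankGap_iff [M.Finite] {e : α} (he : M.IsLoop e) :
    M.RankGap 2 2 ↔ (M ＼ {e}).RankGap 2 1 := by
  constructor
  · intro h X hX hle
    rw [he.rk_delete_ground] at hle
    rw [delete_ground] at hX
    rw [rk_delete _ hX] at hle ⊢
    have hXE := hX.trans Set.sdiff_subset
    have h1 := h (insert e X) (Set.insert_subset he.mem_ground hXE)
    rw [he.rk_insert, Set.ncard_insert_of_notMem (fun hc => (hX hc).2 rfl)
      (finite_of_subset_ground M hXE)] at h1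
    have := h1 hle
    omega
  · intro h X hX hle
    have hX' : X \ {e} ⊆ M.E \ {e} := Set.sdiff_subset_sdiff_left hX
    have h1 := h (X \ {e}) hX'
    rw [he.rk_delete_ground, rk_delete _ hX'] at h1
    have h2 := M.rk_mono (Set.sdiff_subset (s := X) (t := {e}))
    have h3 := Set.ncard_le_ncard_sdiff_add_ncard X {e} (Set.finite_singleton e)
    rw [Set.ncard_singleton] at h3
    have := h1 (by omega)
    omega

instance sum_finite [M.Finite] [N.Finite] : (M.sum N).Finite := ⟨by
  rw [sum_ground]
  exact (M.ground_finite.image _).union (N.ground_finite.image _)⟩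

theorem isIsoTo_sum_unif_delete : N.IsIsoTo (N.sum (unif 0 1) ＼ {Sum.inr 0}) := by
  refine isIsoTo_of_bijOn Sum.inl ⟨?_, Sum.inl_injective.injOn, ?_⟩ fun I hI => ?_
  · intro x hx
    simpa using hx
  · rintro (x | x) hx
    · exact ⟨x, by simpa using hx, rfl⟩
    · fin_cases x
      simp at hx
  · rw [delete_indep_iff, sum_indep_iff, Set.preimage_image_eq _ Sum.inl_injective]
    simp

theorem isLoop_sum_unif : (N.sum (unif 0 1)).IsLoop (Sum.inr 0) := by
  rw [← singleton_not_indep (by simp [unif_ground]), sum_indep_iff, unif_indep_iff]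
  have : Sum.inr ⁻¹' {(Sum.inr 0 : β ⊕ Fin 1)} = {0} := by
    ext x
    simp
  rw [this, Set.ncard_singleton]
  simp

/-- A binary matroid with a loop is determined by the vectors that represent the other elements. -/
theorem Rep.isIsoTo_sum_of_isLoop {V : Type*} [AddCommGroup V] [Module (ZMod 2) V] {v : α → V}
    (hv : M.Rep v) {e : α} (he : M.IsLoop e) (hinj : Set.InjOn v (M ＼ {e}).E)
    (hne : (M ＼ {e}).E.Nonempty)
    (hN : N.Realizes (v '' (M ＼ {e}).E)) : M.IsIsoTo (N.sum (unif 0 1)) := by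
  classical
  obtain ⟨v', hv', hinj', him⟩ := hN
  have hβ : Nonempty β := (him ▸ hne.image v).of_image.to_type
  obtain ⟨φ, hφ, hφv⟩ := exists_bijOn_of_image_eq hinj hinj' (L := id) Function.injective_id
    (by rw [Set.image_id, him])
  have hve : v e = 0 := by
    have h1 := (hv {e} (Set.singleton_subset_iff.2 he.mem_ground)).not.1
      ((singleton_not_indep he.mem_ground).2 he)
    rw [linearIndepOn_singleton_iff] at h1
    exact not_not.1 h1
  have hmem : ∀ z ∈ M.E, z ≠ e → z ∈ (M ＼ {e}).E := fun z hz hze => ⟨hz, hze⟩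
  refine hv.isIsoTo (hv'.sum rep_unif_zero_one)
    (F := fun z => if z = e then Sum.inr 0 else Sum.inl (φ z)) ⟨?_, ?_, ?_⟩
    (LinearMap.inl (ZMod 2) V (ZMod 2)) LinearMap.inl_injective ?_
  · intro z hz
    by_cases hze : z = e
    · simp [hze, unif_ground]
    · simpa [hze] using hφ.mapsTo (hmem z hz hze)
  · intro z hz y hy hzy
    by_cases hze : z = e <;> by_cases hye : y = e
    · rw [hze, hye]
    · simp [hze, hye] at hzy
    · simp [hze, hye] at hzy
    · simp only [hze, hye, if_false, Sum.inl.injEq] at hzy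
      exact hφ.injOn (hmem z hz hze) (hmem y hy hye) hzy
  · rintro (x | x) hx
    · obtain ⟨z, hz, rfl⟩ := hφ.surjOn (show x ∈ N.E by simpa using hx)
      have hze : z ≠ e := hz.2
      exact ⟨z, hz.1, by simp [hze]⟩
    · fin_cases x
      exact ⟨e, he.mem_ground, by simp⟩
  · intro z hz
    by_cases hze : z = e
    · simp [hze, hve]
    · simp [hze, hφv z (hmem z hz hze)]

end Loop

/-! ### Simple binary matroids -/

section Simple

theorem IsSimple.two_le_rk [M.Finite] (h : M.IsSimple) {X : Set α} (hX : X ⊆ M.E)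
    (h2 : 2 ≤ X.ncard) : 2 ≤ M.rk X := by
  obtain ⟨Y, hYX, hY⟩ := Set.exists_subset_card_eq h2
  have h1 := (isSimple_iff_indep.1 h Y (hYX.trans hX) hY.le).rk_eq_ncard
  have := M.rk_mono hYX
  omega

theorem IsSimple.rk_singleton [M.Finite] (h : M.IsSimple) {X : Set α} (hX : X ⊆ M.E)
    (h2 : X.ncard = 1) : M.rk X = 1 := by
  rw [(isSimple_iff_indep.1 h X hX (by omega)).rk_eq_ncard, h2]

/-- A projective line over `GF(2)` has three points. -/
theorem IsSimple.ncard_le_three [M.Finite] (h : M.IsSimple) (hb : M.IsBinary) {X : Set α}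
    (hX : X ⊆ M.E) (hr : M.rk X ≤ 2) : X.ncard ≤ 3 := by
  obtain ⟨n, v, hv⟩ := isBinary_iff_exists_rep.1 hb
  have hind := isSimple_iff_indep.1 h
  have hinj : Set.InjOn v X := by
    intro x hx y hy hxy
    by_contra hne
    have h1 := hind {x, y} (Set.insert_subset (hX hx) (Set.singleton_subset_iff.2 (hX hy)))
      (Set.ncard_pair hne).le
    rw [hv _ h1.subset_ground] at h1
    exact hne (h1.injOn (Set.mem_insert _ _) (Set.mem_insert_of_mem _ rfl) hxy)
  have h0 : (0 : Fin n → ZMod 2) ∉ v '' X := by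
    rintro ⟨x, hx, hx0⟩
    have h1 := hind {x} (Set.singleton_subset_iff.2 (hX hx)) (by simp)
    rw [hv _ h1.subset_ground] at h1
    exact h1.ne_zero rfl hx0
  have hsub : insert 0 (v '' X) ⊆ (Submodule.span (ZMod 2) (v '' X) : Set (Fin n → ZMod 2)) :=
    Set.insert_subset (zero_mem _) Submodule.subset_span
  have h1 := Set.ncard_le_ncard hsub (Set.toFinite _)
  rw [Set.ncard_insert_of_notMem h0 (Set.toFinite _), hinj.ncard_image] at h1
  have h2 := Module.natCard_eq_pow_finrank (K := ZMod 2) (V := Submodule.span (ZMod 2) (v '' X))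
  rw [hv.finrank_span hX, Nat.card_zmod] at h2
  have h3 : 2 ^ M.rk X ≤ 2 ^ 2 := Nat.pow_le_pow_right (by norm_num) hr
  have h4 : (Submodule.span (ZMod 2) (v '' X) : Set (Fin n → ZMod 2)).ncard =
    Nat.card (Submodule.span (ZMod 2) (v '' X)) := (Nat.card_coe_set_eq _).symm
  omega

/-- No triangle of a simple binary matroid is a triad, since a circuit and a cocircuit of a binary
matroid meet in an even number of elements. -/
theorem IsSimple.not_triangle_triad [M.Finite] (h : M.IsSimple) (h' : M✶.IsSimple)
    (hb : M.IsBinary) {X : Set α} (hX : X ⊆ M.E) (h3 : X.ncard = 3) (hr : M.rk X = 2)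
    (hr' : M✶.rk X = 2) : False := by
  classical
  obtain ⟨n, v, hv⟩ := isBinary_iff_exists_rep.1 hb
  have h2 : ∀ a : ZMod 2, a ≠ 0 → a = 1 := by decide
  have hXfin := finite_of_subset_ground M hX
  have hrk : ¬ M.Spanning (M.E \ X) := by
    rw [spanning_iff_rk Set.sdiff_subset]
    have := rk_dual_add hX
    omega
  rw [hv.spanning_iff Set.sdiff_subset, span_eq_span_iff_forall_functional Set.sdiff_subset] at hrk
  push Not at hrk
  obtain ⟨φ, hφ, e, heE, hφe⟩ := hrk
  -- The functional `φ` does not vanish anywhere on `X`.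
  have hφX : ∀ x ∈ X, φ (v x) = 1 := by
    intro x hx
    refine h2 _ fun hx0 => ?_
    have hXx : X \ {x} ⊆ M.E := Set.sdiff_subset.trans hX
    have hc := Set.ncard_sdiff_singleton_add_one hx hXfin
    have h4 := (isSimple_iff_indep.1 h' (X \ {x}) hXx (by omega)).rk_eq_ncard
    have h5 := rk_dual_add hXx
    have h6 : M.Spanning (M.E \ (X \ {x})) := by
      rw [spanning_iff_rk Set.sdiff_subset]
      omega
    rw [hv.spanning_iff Set.sdiff_subset,
      span_eq_span_iff_forall_functional Set.sdiff_subset] at h6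
    refine hφe (h6 φ (fun y hy => ?_) e heE)
    by_cases hyx : y = x
    · rw [hyx, hx0]
    · exact hφ y ⟨hy.1, fun hyX => hy.2 ⟨hyX, hyx⟩⟩
  have hdep : ¬ M.Indep X := by
    rw [← rk_lt_ncard_iff_not_indep hX]
    omega
  rw [hv X hX, linearIndepOn_iff_sum_ne_zero] at hdep
  push Not at hdep
  obtain ⟨T, hTX, hTne, hT⟩ := hdep
  have hcard : ((T.card : ℕ) : ZMod 2) = 0 := by
    have := congrArg φ hT
    rw [map_sum, Finset.sum_congr rfl fun x hx => hφX x (hTX hx), map_zero] at this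
    simpa using this
  rw [ZMod.natCast_eq_zero_iff] at hcard
  have hle := Set.ncard_le_ncard hTX hXfin
  rw [Set.ncard_coe_finset] at hle
  have hpos := hTne.card_pos
  refine hv.not_indep_of_sum_eq_zero (hTX.trans hX) hTne hT
    (isSimple_iff_indep.1 h _ (hTX.trans hX) ?_)
  rw [Set.ncard_coe_finset]
  omega

/-- Each side of a `1`- or `2`-separation has rank at least two in the matroid and in its dual, as
both are simple. If no set has corank and nullity at least `2`, one of the sides is both a triangle
and a triad, which is impossible in a binary matroid. -/
theorem IsSimple.isNConnected_three [M.Finite] (h : M.IsSimple) (h' : M✶.IsSimple)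
    (hb : M.IsBinary) (hg : M.RankGap 2 2) : M.IsNConnected 3 := by
  by_contra hn
  rw [not_isNConnected_three_iff] at hn
  obtain ⟨X, hX, hsep⟩ := hn
  have hY : M.E \ X ⊆ M.E := Set.sdiff_subset
  have hXE : X ⊆ M✶.E := hX
  have hYE : M.E \ X ⊆ M✶.E := hY
  have e1 := rk_dual_add hX
  have e2 := rk_dual_add hY
  rw [Set.sdiff_sdiff_cancel_left hX] at e2
  have eu := M.rk_union_le X (M.E \ X)
  rw [Set.union_sdiff_cancel hX] at eu
  have l1 := rk_le_ncard hX
  have l2 := rk_le_ncard hY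
  have hx2 : 2 ≤ X.ncard := by
    by_contra hlt
    have hx1 : X.ncard = 1 := by omega
    have b1 := h.rk_singleton hX hx1
    have b2 := h'.rk_singleton hXE hx1
    omega
  have hy2 : 2 ≤ (M.E \ X).ncard := by
    by_contra hlt
    have hy1 : (M.E \ X).ncard = 1 := by omega
    have b1 := h.rk_singleton hY hy1
    have b2 := h'.rk_singleton hYE hy1
    omega
  have a1 := h.two_le_rk hX hx2
  have a2 := h.two_le_rk hY hy2
  have a3 := h'.two_le_rk hXE hx2
  have a4 := h'.two_le_rk hYE hy2
  have hsum : M.rk X + M.rk (M.E \ X) = M.rk M.E + 1 := by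
    by_contra hne
    have g1 := hg X hX (by omega)
    omega
  clear hsep
  by_cases hr : 3 ≤ M.rk (M.E \ X)
  · have g1 := hg X hX (by omega)
    have c3 := h'.ncard_le_three hb.dual hXE (by omega)
    exact h.not_triangle_triad h' hb hX (by omega) (by omega) (by omega)
  · have c2 := h.ncard_le_three hb hY (by omega)
    exact h.not_triangle_triad h' hb hY (by omega) (by omega) (by omega)

end Simple

/-! ### Ranks at most one -/

section RankOne

theorem eRank_le_iff_rk [M.Finite] {n : ℕ} : M.eRank ≤ n ↔ M.rk M.E ≤ n := by
  rw [← cast_rk_ground, Nat.cast_le]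

theorem eRank_eq_iff_rk [M.Finite] {n : ℕ} : M.eRank = n ↔ M.rk M.E = n := by
  rw [← cast_rk_ground, Nat.cast_inj]

theorem isIsoTo_unif [M.Finite] {r n : ℕ} (hn : M.E.ncard = n)
    (h : ∀ I ⊆ M.E, M.Indep I ↔ I.ncard ≤ r) : M.IsIsoTo (unif r n) := by
  have : Finite M.E := M.ground_finite
  let e : M.E ≃ Fin n := Finite.equivFinOfCardEq hn
  refine ⟨e.trans (Equiv.Set.univ (Fin n)).symm, fun I => ?_⟩
  rw [h _ (by simp), unif_indep_iff, Set.ncard_image_of_injective _ Subtype.val_injective,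
    Set.ncard_image_of_injective _ Subtype.val_injective,
    Set.ncard_image_of_injective _ (Equiv.injective _)]

/-- The exceptions of rank at most one: in `U_{1,2}` and `U_{1,3}` both sides of a partition have
rank one, and each `2`-separation needs four elements. -/
theorem isNConnected_unif {r n : ℕ} (h : n ≤ 1 ∨ r = 1 ∧ n ≤ 3) : (unif r n).IsNConnected 3 := by
  by_contra hc
  rw [not_isNConnected_three_iff] at hc
  obtain ⟨X, hX, hsep⟩ := hc
  have h1 := ncard_diff_add hX
  have h2 : (unif r n).E.ncard = n := by simp [unif_ground]
  have hr : r = 1 → ∀ Y : Set (Fin n), 1 ≤ Y.ncard → 1 ≤ (unif r n).rk Y := by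
    rintro rfl Y hY
    obtain ⟨y, hy⟩ := Set.nonempty_of_ncard_ne_zero (s := Y) (by omega)
    have hi : (unif 1 n).Indep {y} := unif_indep_iff.2 (by simp)
    have := (unif 1 n).rk_mono (Set.singleton_subset_iff.2 hy)
    rw [hi.rk_eq_ncard, Set.ncard_singleton] at this
    exact this
  have hE : r = 1 → (unif r n).rk (unif r n).E ≤ 1 := by
    rintro rfl
    obtain ⟨B, hB⟩ := (unif 1 n).exists_isBase
    rw [← hB.ncard_eq_rk]
    exact unif_indep_iff.1 hB.indep
  rcases h with h | ⟨hr1, h⟩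
  · omega
  · have e1 := hE hr1
    have e2 := hr hr1 X
    have e3 := hr hr1 ((unif r n).E \ X)
    omega

/-- In rank at most one, send all nonloops to `1` and all loops to `0`. -/
theorem isBinary_of_rk_le_one [M.Finite] (h : M.rk M.E ≤ 1) : M.IsBinary := by
  classical
  refine Rep.isBinary (V := ZMod 2) (v := fun e => if M.Indep {e} then 1 else 0) fun I hI => ?_
  rw [linearIndepOn_iff_sum_ne_zero]
  constructor
  · intro hi T hT hne
    have h1 := hi.rk_eq_ncard
    have h2 := M.rk_le_rk_ground I
    have h3 := Set.ncard_le_ncard hT (finite_of_subset_ground M hI)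
    rw [Set.ncard_coe_finset] at h3
    have h4 : T.card = 1 := by
      have := hne.card_pos
      omega
    obtain ⟨e, rfl⟩ := Finset.card_eq_one.1 h4
    have he : M.Indep {e} := hi.subset (by simpa using hT)
    rw [Finset.sum_singleton, if_pos he]
    exact one_ne_zero
  · intro hs
    have he : ∀ e ∈ I, M.Indep {e} := by
      intro e heI
      by_contra hn
      exact hs {e} (by simpa using heI) (Finset.singleton_nonempty e) (by
        rw [Finset.sum_singleton, if_neg hn])
    have hsub : I.Subsingleton := by
      intro x hx y hy
      by_contra hne
      refine hs {x, y} (by simp [Set.insert_subset_iff, hx, hy]) (Finset.insert_nonempty _ _) ?_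
      rw [Finset.sum_pair hne, if_pos (he x hx), if_pos (he y hy)]
      rfl
    rcases hsub.eq_empty_or_singleton with rfl | ⟨x, rfl⟩
    · exact M.empty_indep
    · exact he x rfl

/-- In rank at most one, a loop is one side of a `1`-separation if it is not the only element, and
any two of at least four elements of a loopless matroid are one side of a `2`-separation. -/
theorem not_isNConnected_three_of_rk_le_one [M.Finite] (h : M.rk M.E ≤ 1)
    (h00 : ¬ M.IsIsoTo (unif 0 0)) (h01 : ¬ M.IsIsoTo (unif 0 1)) (h11 : ¬ M.IsIsoTo (unif 1 1))
    (h12 : ¬ M.IsIsoTo (unif 1 2)) (h13 : ¬ M.IsIsoTo (unif 1 3)) : ¬ M.IsNConnected 3 := by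
  have hind : (∀ e, ¬ M.IsLoop e) → 1 ≤ M.E.ncard →
      ∀ I ⊆ M.E, M.Indep I ↔ I.ncard ≤ 1 := by
    intro hl _ I hI
    constructor
    · intro hi
      have := hi.rk_eq_ncard
      have := M.rk_le_rk_ground I
      omega
    · intro hc
      have := (finite_of_subset_ground M hI).to_subtype
      rcases (Set.ncard_le_one_iff_subsingleton.1 hc).eq_empty_or_singleton with rfl | ⟨x, rfl⟩
      · exact M.empty_indep
      · by_contra hn
        exact hl x ((singleton_not_indep (hI rfl)).1 hn)
  rw [not_isNConnected_three_iff]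
  by_cases hl : ∃ e, M.IsLoop e
  · obtain ⟨e, he⟩ := hl
    have hE : {e} ⊆ M.E := Set.singleton_subset_iff.2 he.mem_ground
    have h1 := ncard_diff_add hE
    have h2 := (isLoop_iff_rk he.mem_ground).1 he
    have h3 := M.rk_le_rk_ground (M.E \ {e})
    rw [Set.ncard_singleton] at h1
    have h4 : 2 ≤ M.E.ncard := by
      by_contra hlt
      refine h01 (isIsoTo_unif (by omega) fun I hI => ?_)
      have hEe : M.E = {e} := by
        have h5 : (M.E \ {e}).ncard = 0 := by omega
        rw [Set.ncard_eq_zero (finite_of_subset_ground M Set.sdiff_subset),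
          Set.sdiff_eq_empty] at h5
        exact h5.antisymm hE
      rw [hEe] at hI
      rcases Set.subset_singleton_iff_eq.1 hI with rfl | rfl
      · simp
      · exact iff_of_false ((singleton_not_indep he.mem_ground).2 he) (by simp)
    exact ⟨{e}, hE, Or.inl ⟨by simp, by omega, by omega⟩⟩
  · push Not at hl
    have hind' := hind hl
    have h0 : M.E.ncard ≠ 0 := fun hc => h00 (isIsoTo_unif hc fun I hI => by
      rw [Set.ncard_eq_zero M.ground_finite] at hc
      rw [hc] at hI
      simp [Set.subset_empty_iff.1 hI])
    have h1 : M.E.ncard ≠ 1 := fun hc => h11 (isIsoTo_unif hc (hind' (by omega)))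
    have h2 : M.E.ncard ≠ 2 := fun hc => h12 (isIsoTo_unif hc (hind' (by omega)))
    have h3 : M.E.ncard ≠ 3 := fun hc => h13 (isIsoTo_unif hc (hind' (by omega)))
    obtain ⟨X, hX, hX2⟩ := Set.exists_subset_card_eq (s := M.E) (n := 2) (by omega)
    have h4 := ncard_diff_add hX
    have h5 := M.rk_le_rk_ground X
    have h6 := M.rk_le_rk_ground (M.E \ X)
    have h7 : 1 ≤ M.rk M.E := by
      obtain ⟨e, he⟩ := Set.nonempty_of_ncard_ne_zero (s := M.E) (by omega)
      have hi := (hind' (by omega) {e} (Set.singleton_subset_iff.2 he)).2 (by simp)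
      have h8 := M.rk_le_rk_ground {e}
      rw [hi.rk_eq_ncard, Set.ncard_singleton] at h8
      exact h8
    exact ⟨X, hX, Or.inr ⟨by omega, by omega, by omega⟩⟩

end RankOne

/-! ### Parallel classes -/

section Parallel

theorem isCircuit_pair [M.Finite] (hl : M.Loopless) {a b : α} (ha : a ∈ M.E) (hb : b ∈ M.E)
    (h : ¬ M.Indep {a, b}) : M.IsCircuit {a, b} := by
  have hE : {a, b} ⊆ M.E := Set.insert_subset ha (Set.singleton_subset_iff.2 hb)
  obtain ⟨C, hC, hcirc⟩ := ((not_indep_iff hE).1 h).exists_isCircuit_subset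
  have hns : ∀ x ∈ M.E, C ≠ {x} := by
    rintro x - rfl
    exact loopless_iff_forall_not_isLoop.1 hl x (hcirc.subset_ground rfl)
      (singleton_isCircuit.1 hcirc)
  rcases Set.subset_pair_iff_eq.1 hC with rfl | rfl | rfl | rfl
  · exact (hcirc.nonempty.ne_empty rfl).elim
  · exact (hns a ha rfl).elim
  · exact (hns b hb rfl).elim
  · exact hcirc

theorem rk_le_one_of_isCircuit_pair [M.Finite] {X : Set α} (hX : X ⊆ M.E)
    (h : ∀ e ∈ X, ∀ f ∈ X, e ≠ f → M.IsCircuit {e, f}) : M.rk X ≤ 1 := by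
  obtain ⟨I, hI⟩ := M.exists_isBasis X hX
  rw [← hI.ncard_eq_rk, Set.ncard_le_one (finite_of_subset_ground M hI.indep.subset_ground)]
  intro x hx y hy
  by_contra hne
  exact (h x (hI.subset hx) y (hI.subset hy) hne).not_indep
    (hI.indep.subset (Set.insert_subset hx (Set.singleton_subset_iff.2 hy)))

/-- In rank at least `3`, a parallel class has corank at least `2`, hence nullity at most `1`. -/
theorem IsParallelClass.encard_le_two [M.Finite] (hg : M.RankGap 2 2) (hr : 3 ≤ M.rk M.E)
    {X : Set α} (hX : M.IsParallelClass X) : X.encard ≤ 2 := by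
  have hXE : X ⊆ M.E := fun e he => (hX.prop.1 e he).mem_ground
  have h1 := rk_le_one_of_isCircuit_pair hXE hX.prop.2
  have h2 := hg X hXE (by omega)
  rw [← (finite_of_subset_ground M hXE).cast_ncard_eq]
  exact_mod_cast (by omega : X.ncard ≤ 2)

/-- A set of rank one without loops is contained in a parallel class. -/
theorem exists_isParallelClass [M.Finite] (hl : M.Loopless) {X : Set α} (hX : X ⊆ M.E)
    (hr : M.rk X ≤ 1) : ∃ Y, M.IsParallelClass Y ∧ X ⊆ Y := by
  let P : Set α → Prop := fun Y =>
    (∀ e ∈ Y, M.IsNonloop e) ∧ ∀ e ∈ Y, ∀ f ∈ Y, e ≠ f → M.IsCircuit {e, f}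
  have hfin : {Y | P Y}.Finite :=
    M.ground_finite.finite_subsets.subset fun Y hY e he => (hY.1 e he).mem_ground
  have hXP : P X := by
    refine ⟨fun e he => isNonloop_of_loopless (hX he), fun e he f hf hef =>
      isCircuit_pair hl (hX he) (hX hf) fun hi => ?_⟩
    have h1 := M.rk_mono (Set.insert_subset he (Set.singleton_subset_iff.2 hf))
    rw [hi.rk_eq_ncard, Set.ncard_pair hef] at h1
    omega
  obtain ⟨Y, hXY, hY⟩ := hfin.exists_le_maximal hXP
  exact ⟨Y, hY, hXY⟩

theorem rankGap_of_isParallelClass [M.Finite] (hl : M.Loopless) (hr : M.rk M.E = 3)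
    (h : ∀ X, M.IsParallelClass X → X.encard ≤ 2) : M.RankGap 2 2 := by
  intro X hX hle
  obtain ⟨Y, hY, hXY⟩ := exists_isParallelClass hl hX (by omega)
  have h1 := (Set.encard_le_encard hXY).trans (h Y hY)
  rw [← (finite_of_subset_ground M hX).cast_ncard_eq] at h1
  have h2 : X.ncard ≤ 2 := by exact_mod_cast h1
  rcases Set.eq_empty_or_nonempty X with rfl | ⟨e, he⟩
  · simp
  · have h3 := M.rk_mono (Set.singleton_subset_iff.2 he)
    rw [(isNonloop_of_loopless (hX he)).indep.rk_eq_ncard, Set.ncard_singleton] at h3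
    omega

end Parallel

/-! ### The matroids of the list are `(2, 2)`-uniform -/

section Items

theorem IsIsoTo.spec [M.Finite] [N.Finite] (h : M.IsIsoTo N)
    (hN : N.IsBinary ∧ N.RankGap 2 2 ∧ ¬ N.IsNConnected 3) :
    M.IsBinary ∧ M.RankGap 2 2 ∧ ¬ M.IsNConnected 3 :=
  ⟨h.isBinary hN.1, h.rankGap_iff.2 hN.2.1, h.isNConnected_iff.not.2 hN.2.2⟩

theorem Core.exists_rep [M.Finite] (h : M.Core) :
    ∃ (V : Type) (_ : AddCommGroup V) (_ : Module (ZMod 2) V) (v : α → V),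
      M.Rep v ∧ Set.InjOn v M.E ∧ IsCoreSet (v '' M.E) := by
  obtain ⟨n, v, hv⟩ := isBinary_iff_exists_rep.1 h.isBinary
  obtain ⟨v', hv', -, hs⟩ := hv.exists_span_eq_top
  obtain ⟨hinj, hS⟩ := h.isCoreSet hv' hs
  exact ⟨_, _, _, v', hv', hinj, hS⟩

theorem Core.sum_loop_spec [N.Finite] (h : N.Core) :
    (N.sum (unif 0 1)).IsBinary ∧ (N.sum (unif 0 1)).RankGap 2 2 ∧
      ¬ (N.sum (unif 0 1)).IsNConnected 3 := by
  obtain ⟨n, v, hv⟩ := isBinary_iff_exists_rep.1 h.isBinary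
  have hloop := isLoop_sum_unif (N := N)
  refine ⟨(hv.sum rep_unif_zero_one).isBinary, hloop.rankGap_iff.2
    (isIsoTo_sum_unif_delete.rankGap_iff.1 h.gap), not_isNConnected_of_not_isSimple ?_ ?_⟩
  · intro hs
    have := hs _ (singleton_isCircuit.2 hloop)
    rw [Set.encard_singleton] at this
    exact absurd this (by decide)
  · have h1 := h.three_le_rk
    rw [(isIsoTo_sum_unif_delete (N := N)).rk_ground_eq, hloop.rk_delete_ground] at h1
    omega

theorem Core.sum_spec [N.Finite] (h : N.Core) :
    (N.sum (unif 1 2)).IsBinary ∧ (N.sum (unif 1 2)).RankGap 2 2 ∧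
      ¬ (N.sum (unif 1 2)).IsNConnected 3 := by
  obtain ⟨V, _, _, v, hv, hinj, hS⟩ := h.exists_rep
  exact hv.seriesRep_sum.spec hinj hS

theorem Rep.ne_zero {V : Type*} [AddCommGroup V] [Module (ZMod 2) V] {v : α → V} (hv : M.Rep v)
    {p : α} (hp : M.IsNonloop p) : v p ≠ 0 := by
  have h1 := hp.indep
  rw [hv _ h1.subset_ground, linearIndepOn_singleton_iff] at h1
  exact h1

theorem Core.loopless [M.Finite] (h : M.Core) : M.Loopless := by
  refine loopless_iff_forall_not_isLoop.2 fun e he hl => ?_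
  have h1 := h.three_le_rk
  exact hl.not_indep_of_mem (Set.mem_singleton e) (rankGap_two_one_iff.1 h.gap {e}
    (Set.singleton_subset_iff.2 he) (by rw [Set.ncard_singleton]; omega))

theorem Core.spec_of_isParallelTriangle [M.Finite] [N.Finite] (h : N.Core)
    (hM : M.IsParallelTriangle N) : M.IsBinary ∧ M.RankGap 2 2 ∧ ¬ M.IsNConnected 3 := by
  obtain ⟨p, hp, hiso⟩ := hM
  have := h.loopless
  obtain ⟨V, _, _, v, hv, hinj, hS⟩ := h.exists_rep
  exact hiso.spec ((hv.seriesRep_parallelConnection hp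
    (hv.ne_zero (isNonloop_of_loopless hp))).spec hinj hS)

theorem Rep.spec_of_isParallelTriangleDelete {V : Type*} [AddCommGroup V] [Module (ZMod 2) V]
    [M.Finite] [N.Finite] {v : β → V} (hv : N.Rep v)
    {p : β} (hp : p ∈ N.E) (hp0 : v p ≠ 0) (hinj : Set.InjOn v N.E)
    (hS : IsCoreSet (v '' (N.E \ {p}))) (hM : M.IsParallelTriangleDelete N p) :
    M.IsBinary ∧ M.RankGap 2 2 ∧ ¬ M.IsNConnected 3 :=
  IsIsoTo.spec hM ((hv.seriesRep_parallelConnection_delete hp hp0).spec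
    (hinj.mono Set.sdiff_subset) hS)

theorem coordSum_ne_zero : coordSum ≠ 0 := by
  intro hc
  have h1 := LinearMap.congr_fun hc (spikeVector (Sum.inr (Sum.inl 3)))
  rw [coordSum_apply] at h1
  revert h1
  decide

/-- Every matroid of the list satisfies the conditions of the classification. -/
theorem InBinaryList.spec [M.Finite] (h : M.InBinaryList) :
    M.IsBinary ∧ M.RankGap 2 2 ∧ ¬ M.IsNConnected 3 := by
  have htip0 : spikeVector (spikeTip 4) ≠ 0 := fun hc => absurd (congrFun hc 0) (by decide)
  have hproj : (LinearMap.proj 0 : (Fin 4 → ZMod 2) →ₗ[ZMod 2] ZMod 2) ≠ 0 := fun hc =>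
    one_ne_zero (LinearMap.congr_fun hc (1 : Fin 4 → ZMod 2))
  rcases h with ⟨hr, h00, h01, h11, h12, h13⟩ | ⟨hb, hr, hs, hl⟩ | ⟨hb, hr, hl, hs, hp⟩ |
    (h | h | h | h) | (h | h | h | h) | (h | h) | (⟨p, hp, h⟩ | ⟨p, hp, h⟩) | (h | h | h | h)
  · have hr' : M.rk M.E ≤ 1 := eRank_le_iff_rk.1 hr
    exact ⟨isBinary_of_rk_le_one hr', fun X _ hX => by omega,
      not_isNConnected_three_of_rk_le_one hr' h00 h01 h11 h12 h13⟩
  · have hr' : M.rk M.E = 2 := eRank_eq_iff_rk.1 hr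
    refine ⟨hb, fun X hX hle => ?_, not_isNConnected_of_not_isSimple hs hr'.ge⟩
    have hXl : X ⊆ M.loops := by
      intro e he
      have h1 := M.rk_mono (Set.singleton_subset_iff.2 he)
      exact (isLoop_iff_rk (hX he)).2 (by omega)
    have h1 := (Set.encard_le_encard hXl).trans hl
    rw [← (finite_of_subset_ground M hX).cast_ncard_eq] at h1
    have h2 : X.ncard ≤ 1 := by exact_mod_cast h1
    omega
  · have hr' : M.rk M.E = 3 := eRank_eq_iff_rk.1 hr
    exact ⟨hb, rankGap_of_isParallelClass hl hr' hp,
      not_isNConnected_of_not_isSimple hs (by omega)⟩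
  · exact h.spec wheel3_core.sum_loop_spec
  · exact h.spec fano_core.sum_loop_spec
  · exact h.spec fano_core.dual.sum_loop_spec
  · exact h.spec binaryAG_core.sum_loop_spec
  · exact h.spec wheel3_core.sum_spec
  · exact h.spec fano_core.sum_spec
  · exact h.spec fano_core.dual.sum_spec
  · exact h.spec binaryAG_core.sum_spec
  · refine rep_spike.spec_of_isParallelTriangleDelete (Set.mem_univ _) htip0
      spikeVector_injective.injOn ?_ h
    rw [image_spikeVector]
    exact Or.inr ⟨by simp, coordSum, coordSum_ne_zero, Or.inl rfl⟩
  · refine Rep.spec_of_isParallelTriangleDelete (N := S8) (rep_spike.delete _)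
      ⟨Set.mem_univ _, by simp [spikeTip]⟩ htip0 spikeVector_injective.injOn ?_ h
    rw [image_spikeVector_S8]
    exact Or.inr ⟨by simp, coordSum, coordSum_ne_zero,
      Or.inr ⟨_, by rw [coordSum_apply]; decide, rfl⟩⟩
  · refine Rep.spec_of_isParallelTriangleDelete (N := fano) (rep_binaryPG 2) hp hp
      Function.injective_id.injOn ?_ h
    rw [Set.image_id]
    exact Or.inl ⟨by simp, Or.inr ⟨p, hp, rfl⟩⟩
  · have hp' := hp
    rw [binaryAG_ground] at hp'
    refine (rep_binaryAG 3).spec_of_isParallelTriangleDelete hp ?_ Function.injective_id.injOn ?_ h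
    · exact hp.1
    · rw [Set.image_id, binaryAG_ground]
      exact Or.inr ⟨by simp, _, hproj, Or.inr ⟨p, hp', rfl⟩⟩
  · exact wheel3_core.spec_of_isParallelTriangle h
  · exact fano_core.spec_of_isParallelTriangle h
  · exact fano_core.dual.spec_of_isParallelTriangle h
  · exact binaryAG_core.spec_of_isParallelTriangle h

end Items

/-! ### Exhaustiveness of the list -/

section Forward

theorem inBinaryList_of_rk_le_one [M.Finite] (hr : M.rk M.E ≤ 1) (hc : ¬ M.IsNConnected 3) :
    M.InBinaryList := by
  refine Or.inl ⟨eRank_le_iff_rk.2 hr, ?_, ?_, ?_, ?_, ?_⟩ <;>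
    exact fun h => hc (h.isNConnected_iff.2 (isNConnected_unif (by simp)))

theorem inBinaryList_of_rk_eq_two [M.Finite] (hb : M.IsBinary) (hg : M.RankGap 2 2)
    (hr : M.rk M.E = 2) (hs : ¬ M.IsSimple) : M.InBinaryList := by
  refine Or.inr (Or.inl ⟨hb, eRank_eq_iff_rk.2 hr, hs, ?_⟩)
  have hl : M.loops ⊆ M.E := M.loops_subset_ground
  have h0 : M.rk M.loops = 0 := by rw [rk, eRk_loops]; rfl
  have h1 := hg _ hl (by omega)
  rw [← (finite_of_subset_ground M hl).cast_ncard_eq]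
  exact_mod_cast (by omega : M.loops.ncard ≤ 1)

theorem inBinaryList_of_rk_eq_three [M.Finite] (hb : M.IsBinary) (hg : M.RankGap 2 2)
    (hr : M.rk M.E = 3) (hl : M.Loopless) (hs : ¬ M.IsSimple) : M.InBinaryList :=
  Or.inr (Or.inr (Or.inl ⟨hb, eRank_eq_iff_rk.2 hr, hl, hs, fun _ hX =>
    hX.encard_le_two hg hr.ge⟩))

/-- Without the loop, such a matroid is a core matroid. -/
theorem IsLoop.inBinaryList [M.Finite] {e : α} (he : M.IsLoop e) (hb : M.IsBinary)
    (hg : M.RankGap 2 2) (hr : 3 ≤ M.rk M.E) (hr' : 4 ≤ M✶.rk M.E) : M.InBinaryList := by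
  have hE : {e} ⊆ M.E := Set.singleton_subset_iff.2 he.mem_ground
  have hcore : (M ＼ {e}).Core := by
    refine ⟨hb.delete _, he.rankGap_iff.1 hg, by rw [he.rk_delete_ground]; exact hr, ?_⟩
    have h1 := (M ＼ {e}).rk_add_rk_dual
    have h2 := M.rk_add_rk_dual
    have h3 := ncard_diff_add hE
    rw [he.rk_delete_ground] at h1
    rw [Set.ncard_singleton] at h3
    have h4 : (M ＼ {e}).E = M.E \ {e} := rfl
    rw [← h4] at h3
    omega
  obtain ⟨n, v₀, hv₀⟩ := isBinary_iff_exists_rep.1 hb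
  obtain ⟨v, hv, -, hs⟩ := hv₀.exists_span_eq_top
  have hs' : Submodule.span (ZMod 2) (v '' (M ＼ {e}).E) = ⊤ := by
    rw [← hs, delete_ground, ← hv.spanning_iff Set.sdiff_subset, spanning_iff_rk Set.sdiff_subset,
      he.rk_ground_diff]
  obtain ⟨hinj, hS⟩ := hcore.isCoreSet (hv.delete _) hs'
  have hne := hS.nonempty.of_image
  exact Or.inr (Or.inr (Or.inr (Or.inl (hS.realizes.imp (hv.isIsoTo_sum_of_isLoop he hinj hne)
    (Or.imp (hv.isIsoTo_sum_of_isLoop he hinj hne) (Or.imp (hv.isIsoTo_sum_of_isLoop he hinj hne)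
      (hv.isIsoTo_sum_of_isLoop he hinj hne)))))))

/-- If a matroid with a loop has dual rank `3`, its dual is a loopless rank-`3` matroid with a
coloop. It is not simple, since without the coloop it has rank `2` and at least five elements. -/
theorem IsLoop.inBinaryList_dual [M.Finite] {e : α} (he : M.IsLoop e) (hb : M.IsBinary)
    (hg : M.RankGap 2 2) (hr : 3 ≤ M.rk M.E) (hr' : M✶.rk M.E = 3) : M✶.InBinaryList := by
  have heE := he.mem_ground
  have hE : {e} ⊆ M.E := Set.singleton_subset_iff.2 heE
  have hn := M.rk_add_rk_dual
  have hne := ncard_diff_add hE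
  rw [Set.ncard_singleton] at hne
  refine inBinaryList_of_rk_eq_three hb.dual hg.dual hr' ?_ ?_
  · refine loopless_iff_forall_not_isLoop.2 fun f hf hloop => ?_
    have hfE : {f} ⊆ M.E := Set.singleton_subset_iff.2 hf
    have h1 := rk_dual_add hfE
    have hg2 := (hb.delete {e}).rankGap_one_two (he.rankGap_iff.1 hg)
      (by rw [he.rk_delete_ground]; exact hr)
    rw [(isLoop_iff_rk hf).1 hloop, Set.ncard_singleton] at h1
    have hX : (M.E \ {e}) \ {f} ⊆ M.E \ {e} := Set.sdiff_subset
    have h2 := hg2 ((M.E \ {e}) \ {f}) hX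
    rw [he.rk_delete_ground, rk_delete _ hX] at h2
    have h3 := M.rk_mono (Set.sdiff_subset_sdiff_left (t := {f})
      (Set.sdiff_subset (s := M.E) (t := {e})))
    have h4 := Set.ncard_le_ncard_sdiff_add_ncard (M.E \ {e}) {f} (Set.finite_singleton f)
    rw [Set.ncard_singleton] at h4
    have h5 := h2 (by omega)
    omega
  · intro hs
    have h1 := rk_dual_add (M := M) (X := M.E \ {e}) Set.sdiff_subset
    rw [Set.sdiff_sdiff_cancel_left hE, (isLoop_iff_rk heE).1 he] at h1
    have h2 := hs.ncard_le_three hb.dual (X := M.E \ {e}) Set.sdiff_subset (by omega)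
    omega

/-- A series pair `{a, b}` puts a matroid in the form of `SeriesRep`, over the span of the other
elements. -/
theorem Rep.exists_seriesRep {V : Type*} [AddCommGroup V] [Module (ZMod 2) V] [M.Finite]
    {v : α → V} (hv : M.Rep v) {a b : α} (ha : a ∈ M.E) (hb : b ∈ M.E) (hab : a ≠ b)
    (haD : a ∉ M.closure (M.E \ {a, b})) (hbD : b ∉ M.closure (M.E \ {a, b}))
    (hr : M.rk M.E = M.rk (M.E \ {a, b}) + 1) :
    ∃ (x : α → Submodule.span (ZMod 2) (v '' (M.E \ {a, b})))
      (w : Submodule.span (ZMod 2) (v '' (M.E \ {a, b}))), (M ＼ {a, b}).Rep x ∧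
      Submodule.span (ZMod 2) (x '' (M.E \ {a, b})) = ⊤ ∧
      SeriesRep M (M.E \ {a, b}) id x w a b := by
  classical
  obtain ⟨x, hx, hxv, hxs⟩ : ∃ x : α → Submodule.span (ZMod 2) (v '' (M.E \ {a, b})),
      (M ＼ {a, b}).Rep x ∧ (∀ e ∈ M.E \ {a, b}, (x e : V) = v e) ∧
        Submodule.span (ZMod 2) (x '' (M.E \ {a, b})) = ⊤ := (hv.delete {a, b}).exists_span_eq_top
  have hDE : M.E \ {a, b} ⊆ M.E := Set.sdiff_subset
  have hspan : M.Spanning (insert b (M.E \ {a, b})) := by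
    rw [spanning_iff_rk (Set.insert_subset hb hDE), rk_insert_of_notMem_closure hb hbD, hr]
  have hva : v a ∈ Submodule.span (ZMod 2) (insert (v b) (v '' (M.E \ {a, b}))) := by
    rw [← Set.image_insert_eq, ← hv.mem_closure_iff (Set.insert_subset hb hDE) ha,
      hspan.closure_eq]
    exact ha
  rw [hv.mem_closure_iff hDE ha] at haD
  rw [hv.mem_closure_iff hDE hb] at hbD
  obtain ⟨c, z, hz, hc⟩ := Submodule.mem_span_insert.1 hva
  have hc01 : ∀ t : ZMod 2, t = 0 ∨ t = 1 := by decide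
  have hc1 : c = 1 := (hc01 c).resolve_left fun h0 => haD (by rwa [hc, h0, zero_smul, zero_add])
  rw [hc1, one_smul] at hc
  -- `(y, t) ↦ y + t • v b` identifies the product of the span with `GF(2)` with a subspace of `V`.
  let Ψ : Submodule.span (ZMod 2) (v '' (M.E \ {a, b})) × ZMod 2 →ₗ[ZMod 2] V :=
    (Submodule.subtype _).coprod (LinearMap.toSpanSingleton (ZMod 2) V (v b))
  have hΨ : ∀ y t, Ψ (y, t) = y + t • v b := fun y t => rfl
  have hΨi : Function.Injective Ψ := by
    rw [injective_iff_map_eq_zero]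
    rintro ⟨y, t⟩ h0
    rw [hΨ] at h0
    rcases hc01 t with rfl | rfl
    · rw [zero_smul, add_zero, ZeroMemClass.coe_eq_zero] at h0
      rw [h0]
      rfl
    · rw [one_smul, zmod_two_add_eq_zero_iff] at h0
      exact (hbD (h0 ▸ y.2)).elim
  let u : α → Submodule.span (ZMod 2) (v '' (M.E \ {a, b})) × ZMod 2 := fun e =>
    if e = a then (⟨z, hz⟩, 1) else if e = b then (0, 1) else (x e, 0)
  have hua : u a = (⟨z, hz⟩, 1) := if_pos rfl
  have hub : u b = (0, 1) := by simp [u, hab.symm]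
  have huD : ∀ e ∈ M.E \ {a, b}, u e = (x e, 0) := by
    intro e he
    have h1 : e ≠ a := fun h => he.2 (Or.inl h)
    have h2 : e ≠ b := fun h => he.2 (Or.inr h)
    simp [u, h1, h2]
  have hE : M.E = insert a (insert b (M.E \ {a, b})) := by
    ext e
    by_cases h1 : e = a
    · simp [h1, ha]
    · by_cases h2 : e = b
      · simp [h2, hb]
      · simp [h1, h2]
  have hu : M.Rep u := by
    refine Rep.of_comp Ψ hΨi (hv.congr fun e he => ?_)
    rw [hE] at he
    rw [Function.comp_apply]
    rcases he with rfl | rfl | he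
    · rw [hua, hΨ, one_smul, hc, add_comm]
    · rw [hub, hΨ, one_smul, ZeroMemClass.coe_zero, zero_add]
    · rw [huD e he, hΨ, zero_smul, add_zero, hxv e he]
  refine ⟨x, ⟨z, hz⟩, hx, hxs, Set.injOn_id _, ?_, hab, ?_, ?_, u, hu, huD, hua, hub⟩
  · rw [Set.image_id]
    exact hE
  · simp
  · simp

/-- If the rank and the dual rank are at least `4`, a parallel pair is a series pair of the dual,
whose deletion is a core matroid. -/
theorem IsCircuit.inBinaryList_dual [M.Finite] {a b : α} (hab : a ≠ b)
    (hC : M.IsCircuit {a, b}) (hb : M.IsBinary) (hg : M.RankGap 2 2) (hr : 4 ≤ M.rk M.E)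
    (hr' : 4 ≤ M✶.rk M.E) : M✶.InBinaryList := by
  classical
  have hE : {a, b} ⊆ M.E := hC.subset_ground
  have haE : a ∈ M.E := hE (Set.mem_insert _ _)
  have hbE : b ∈ M.E := hE (Set.mem_insert_of_mem _ rfl)
  have hn := M.rk_add_rk_dual
  have hnE := ncard_diff_add hE
  have hrC := hC.rk_add_one
  rw [Set.ncard_pair hab] at hrC hnE
  have hrD := rk_dual_add (M := M) (X := M.E \ {a, b}) Set.sdiff_subset
  rw [Set.sdiff_sdiff_cancel_left hE] at hrD
  have hDE : M.E \ {a, b} ⊆ M✶.E := Set.sdiff_subset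
  have hdel : (M✶ ＼ {a, b}).rk (M.E \ {a, b}) = M✶.rk (M.E \ {a, b}) := rk_delete _ subset_rfl
  have hcard := (M✶ ＼ {a, b}).rk_add_rk_dual
  rw [delete_ground, dual_ground, hdel] at hcard
  -- A set of corank `1` in the deletion of the pair has corank `2` in the whole matroid.
  have hgap : (M✶ ＼ {a, b}).RankGap 1 2 := by
    intro X hX hle
    rw [delete_ground, dual_ground] at hX hle
    rw [hdel, rk_delete M✶ hX] at hle
    rw [rk_delete M✶ hX]
    exact hg.dual X (hX.trans Set.sdiff_subset) (by rw [dual_ground]; omega)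
  have hcore : (M✶ ＼ {a, b}).Core := by
    have h1 : (M✶ ＼ {a, b})✶.Core := by
      refine ⟨(hb.dual.delete _).dual, hgap.dual, ?_, ?_⟩
      · rw [dual_ground, delete_ground, dual_ground]
        omega
      · rw [dual_dual, dual_ground, delete_ground, dual_ground, hdel]
        omega
    simpa using h1.dual
  have hnot : ∀ c ∈ ({a, b} : Set α), c ∉ M✶.closure (M.E \ {a, b}) := by
    intro c hc hcl
    have hcE := hE hc
    have h1 := rk_insert_of_mem_closure hcl
    have hins : insert c (M.E \ {a, b}) = M.E \ ({a, b} \ {c}) := by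
      ext e
      by_cases hec : e = c
      · simp [hec, hcE]
      · simp [hec]
    have hsub : {a, b} \ {c} ⊆ M.E := Set.sdiff_subset.trans hE
    have h2 := rk_dual_add (M := M) (X := M.E \ ({a, b} \ {c})) Set.sdiff_subset
    have h3 := ncard_diff_add hsub
    have h4 := Set.ncard_sdiff_singleton_add_one hc (Set.toFinite _)
    rw [Set.ncard_pair hab] at h4
    rw [Set.sdiff_sdiff_cancel_left hsub, ← hins, h1,
      (hC.sdiff_singleton_indep hc).rk_eq_ncard] at h2
    rw [← hins] at h3
    omega
  obtain ⟨n, v, hv⟩ := isBinary_iff_exists_rep.1 hb.dual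
  obtain ⟨x, w, hx, hxs, hser⟩ := hv.exists_seriesRep haE hbE hab (hnot a (Or.inl rfl))
    (hnot b (Or.inr rfl)) (by rw [dual_ground]; omega)
  obtain ⟨hinj, hS⟩ := hcore.isCoreSet hx hxs
  exact hser.inBinaryList hinj hS

/-- A loop or a parallel pair of `M` leads to a core matroid, except in some cases of rank or dual
rank `3`, in which `M` or its dual is a loopless non-simple matroid of rank `3`. -/
theorem inBinaryList_or_dual_of_not_isSimple [M.Finite] (hb : M.IsBinary) (hg : M.RankGap 2 2)
    (hr : 3 ≤ M.rk M.E) (hr' : 3 ≤ M✶.rk M.E) (hs : ¬ M.IsSimple) :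
    M.InBinaryList ∨ M✶.InBinaryList := by
  have hloop : ∀ {K : Matroid α} [K.Finite] {e : α}, K.IsLoop e → K.IsBinary → K.RankGap 2 2 →
      3 ≤ K.rk K.E → 3 ≤ K✶.rk K.E → K.InBinaryList ∨ K✶.InBinaryList := by
    intro K _ e he hb hg hr hr'
    rcases hr'.lt_or_eq with h4 | h3
    · exact Or.inl (he.inBinaryList hb hg hr h4)
    · exact Or.inr (he.inBinaryList_dual hb hg hr h3.symm)
  rcases exists_of_not_isSimple hs with ⟨e, he⟩ | ⟨hl, a, b, hab, hC⟩
  · exact hloop he hb hg hr hr'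
  rcases hr.lt_or_eq with h4 | h3
  · rcases hr'.lt_or_eq with h4' | h3'
    · exact Or.inr (hC.inBinaryList_dual hab hb hg h4 h4')
    · by_cases hs' : M✶.IsSimple
      · -- Without `a` and `b`, the dual has rank `2`, which is too small for its size.
        exfalso
        have hE := hC.subset_ground
        have h1 := rk_dual_add (M := M) (X := M.E \ {a, b}) Set.sdiff_subset
        have h2 := hC.rk_add_one
        have h3 := ncard_diff_add hE
        have h5 := M.rk_add_rk_dual
        rw [Set.sdiff_sdiff_cancel_left hE] at h1
        rw [Set.ncard_pair hab] at h2 h3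
        have h6 := hs'.ncard_le_three hb.dual (X := M.E \ {a, b}) Set.sdiff_subset (by omega)
        omega
      · rcases exists_of_not_isSimple hs' with ⟨e, he⟩ | ⟨hl', -⟩
        · have := hloop he hb.dual hg.dual hr' (by rw [dual_dual]; exact hr)
          rw [dual_dual] at this
          exact this.symm
        · exact Or.inr (inBinaryList_of_rk_eq_three hb.dual hg.dual h3'.symm hl' hs')
  · exact Or.inl (inBinaryList_of_rk_eq_three hb hg h3.symm hl hs)

/-- Ranks and dual ranks at most `2` are treated directly; a simple binary matroid of rank `2` has
at most three elements, hence dual rank at most `1`. -/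
theorem inBinaryList_or_dual [M.Finite] (hb : M.IsBinary) (hg : M.RankGap 2 2)
    (hc : ¬ M.IsNConnected 3) : M.InBinaryList ∨ M✶.InBinaryList := by
  have hdual : ¬ M✶.IsNConnected 3 := fun h => hc (by simpa using h.dual)
  have htwo : ∀ {K : Matroid α} [K.Finite], K.IsBinary → K.RankGap 2 2 → 2 ≤ K✶.rk K.E →
      K.rk K.E = 2 → K.InBinaryList := by
    intro K _ hb hg hr' hr
    refine inBinaryList_of_rk_eq_two hb hg hr fun hs => ?_
    have h1 := hs.ncard_le_three hb subset_rfl hr.le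
    have h2 := K.rk_add_rk_dual
    omega
  by_cases h1 : M.rk M.E ≤ 1
  · exact Or.inl (inBinaryList_of_rk_le_one h1 hc)
  by_cases h1' : M✶.rk M.E ≤ 1
  · exact Or.inr (inBinaryList_of_rk_le_one h1' hdual)
  by_cases h2 : M.rk M.E = 2
  · exact Or.inl (htwo hb hg (by omega) h2)
  by_cases h2' : M✶.rk M.E = 2
  · exact Or.inr (htwo hb.dual hg.dual (by rw [dual_dual, dual_ground]; omega) h2')
  by_cases hs : M.IsSimple
  · by_cases hs' : M✶.IsSimple
    · exact (hc (hs.isNConnected_three hs' hb hg)).elim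
    · have := inBinaryList_or_dual_of_not_isSimple hb.dual hg.dual (by rw [dual_ground]; omega)
        (by rw [dual_dual, dual_ground]; omega) hs'
      rw [dual_dual] at this
      exact this.symm
  · exact inBinaryList_or_dual_of_not_isSimple hb hg (by omega) (by omega) hs

end Forward

end Matroid

theorem mainTheorem6 {α : Type*} (M : Matroid α) [M.Finite] :
    (M.IsBinary ∧ M.IsKLUniform 2 2 ∧ ¬ M.IsNConnected 3) ↔
      (M.InBinaryList ∨ M✶.InBinaryList) := by
  rw [Matroid.isKLUniform_iff_rankGap]
  constructor
  · rintro ⟨hb, hg, hc⟩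
    exact Matroid.inBinaryList_or_dual hb hg hc
  · rintro (h | h)
    · exact h.spec
    · obtain ⟨hb, hg, hc⟩ := h.spec
      exact ⟨by simpa using hb.dual, by simpa using hg.dual, fun h => hc h.dual⟩
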